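/- Let $X$ be a compact connected complex manifold of dimension $n>1$ and let $f\colon X\dashrightarrow X$ be a dominant meromorphic self-map. Let $\iota\colon\mathbb P^1\to X$ be a holomorphic embedding with image $L$, and suppose that $f$ is holomorphic in a neighborhood of $L$ and that $L$ is invariant with $f|_L$ conjugate to $z\mapsto z^b$ for some integer $b\ge 2$, the conjugacy being $\iota$, that is, $f(\iota(z))=\iota(z^b)$ for all $z\in\mathbb P^1=\mathbb C\cup\{\infty\}$. Suppose that $L$ is transversally superattracting of degree $a$: whenever $\chi$ is a holomorphic function near a point $\eta\in L$ that vanishes along $L$, and $\xi\in L$ satisfies $f(\xi)=\eta$, the function $\chi\circ f$ vanishes to order at least $a$ along $L$ at $\xi$. Let $S=\iota(\{|z|=1\})$ be the invariant circle and, for an open neighborhood $\Omega$ of $S$, let $$W^s_{\mathrm{loc}}(S)=\{x\in X:\ f^k(x)\in\Omega \text{ for all } k\ge 0 \text{ and } f^k(x)\to S \text{ as } k\to\infty\}.$$ If $a\ge b$, then for every sufficiently small open neighborhood $\Omega$ of $S$ the set $W^s_{\mathrm{loc}}(S)$ is a real analytic submanifold of $X$ of real dimension $2n-1$. -/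

import Mathlib

open scoped Manifold ContDiff Topology
open Set Filter

noncomputable section

/-! ### The Riemann sphere `ℙ¹ = ℂ ∪ {∞}` as a complex manifold -/

namespace RiemannSphere

/-- The involution `z ↦ 1/z` of `ℙ¹`, exchanging `0` and `∞`. -/
def inv : OnePoint ℂ → OnePoint ℂ
  | OnePoint.infty => ((0 : ℂ) : OnePoint ℂ)
  | OnePoint.some z => if z = 0 then OnePoint.infty else ((z⁻¹ : ℂ) : OnePoint ℂ)

theorem inv_infty : inv OnePoint.infty = ((0 : ℂ) : OnePoint ℂ) := rfl

theorem inv_zero : inv ((0 : ℂ) : OnePoint ℂ) = OnePoint.infty := if_pos rfl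

theorem inv_coe {z : ℂ} (hz : z ≠ 0) : inv (z : OnePoint ℂ) = ((z⁻¹ : ℂ) : OnePoint ℂ) :=
  if_neg hz

theorem inv_inv (p : OnePoint ℂ) : inv (inv p) = p := by
  induction p using OnePoint.rec with
  | infty => rw [inv_infty, inv_zero]
  | coe z =>
    by_cases hz : z = 0
    · subst hz; rw [inv_zero, inv_infty]
    · rw [inv_coe hz, inv_coe (inv_ne_zero hz), _root_.inv_inv]

theorem continuous_inv : Continuous inv := by
  have hcob : coclosedCompact ℂ = Bornology.cobounded ℂ := by
    rw [coclosedCompact_eq_cocompact, Metric.cobounded_eq_cocompact]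
  rw [OnePoint.continuous_iff]
  constructor
  · rw [hcob, inv_infty]
    have h1 : Tendsto (fun z : ℂ => ((z⁻¹ : ℂ) : OnePoint ℂ)) (Bornology.cobounded ℂ)
        (𝓝 ((0 : ℂ) : OnePoint ℂ)) :=
      (OnePoint.continuous_coe.tendsto 0).comp tendsto_inv₀_cobounded
    refine h1.congr' ?_
    filter_upwards [Bornology.eventually_ne_cobounded (0 : ℂ)] with z hz
    exact (inv_coe hz).symm
  · rw [continuous_iff_continuousAt]
    intro z
    by_cases hz : z = 0
    · subst hz
      rw [continuousAt_iff_punctured_nhds, inv_zero]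
      have h1 : Tendsto (fun z : ℂ => ((z⁻¹ : ℂ) : OnePoint ℂ)) (𝓝[≠] 0) (𝓝 OnePoint.infty) := by
        refine OnePoint.tendsto_coe_infty.comp ?_
        rw [hcob]
        exact tendsto_inv₀_nhdsNE_zero
      refine h1.congr' ?_
      filter_upwards [self_mem_nhdsWithin] with z hz
      exact (inv_coe hz).symm
    · have h1 : ContinuousAt (fun z : ℂ => ((z⁻¹ : ℂ) : OnePoint ℂ)) z :=
        OnePoint.continuous_coe.continuousAt.comp (continuousAt_inv₀ hz)
      refine h1.congr ?_
      filter_upwards [isOpen_ne.mem_nhds hz] with w hw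
      exact (inv_coe hw).symm

/-- `z ↦ 1/z` as a homeomorphism. -/
def invHomeo : OnePoint ℂ ≃ₜ OnePoint ℂ where
  toFun := inv
  invFun := inv
  left_inv := inv_inv
  right_inv := inv_inv
  continuous_toFun := continuous_inv
  continuous_invFun := continuous_inv

/-- The affine chart `z` on `ℙ¹ \ {∞}`. -/
def chartFinite : OpenPartialHomeomorph (OnePoint ℂ) ℂ :=
  (OnePoint.isOpenEmbedding_coe.toOpenPartialHomeomorph ((↑) : ℂ → OnePoint ℂ)).symm

/-- The chart `1/z` on `ℙ¹ \ {0}`. -/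
def chartInfty : OpenPartialHomeomorph (OnePoint ℂ) ℂ :=
  invHomeo.toOpenPartialHomeomorph.trans chartFinite

theorem chartFinite_source : chartFinite.source = range ((↑) : ℂ → OnePoint ℂ) := by
  simp [chartFinite]

theorem chartFinite_target : chartFinite.target = univ := by
  simp [chartFinite]

theorem chartFinite_symm (z : ℂ) : chartFinite.symm z = (z : OnePoint ℂ) := by
  simp [chartFinite]

theorem chartFinite_coe (z : ℂ) : chartFinite (z : OnePoint ℂ) = z := by
  rw [← chartFinite_symm z]
  exact chartFinite.right_inv (by rw [chartFinite_target]; trivial)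

instance : ChartedSpace ℂ (OnePoint ℂ) where
  atlas := {chartFinite, chartInfty}
  chartAt p := open Classical in if p = OnePoint.infty then chartInfty else chartFinite
  mem_chart_source p := by
    split_ifs with h
    · subst h
      simp only [chartInfty, OpenPartialHomeomorph.trans_source, mem_inter_iff, mem_preimage]
      refine ⟨trivial, ?_⟩
      rw [chartFinite_source]
      exact ⟨0, rfl⟩
    · rw [chartFinite_source]
      exact OnePoint.ne_infty_iff_exists.1 h
  chart_mem_atlas p := by
    split_ifs <;> simp

theorem inv_mem_chartFinite_source {z : ℂ} (hz : inv (z : OnePoint ℂ) ∈ chartFinite.source) :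
    z ≠ 0 := by
  rintro rfl
  rw [inv_zero, chartFinite_source] at hz
  exact OnePoint.infty_notMem_range_coe hz

theorem contDiffOn_inv_of_eq {s : Set ℂ} {g : ℂ → ℂ} (h0 : ∀ z ∈ s, z ≠ 0)
    (hg : ∀ z ∈ s, g z = z⁻¹) : ContDiffOn ℂ ω g s :=
  (contDiffOn_inv ℂ (n := ω)).mono (fun z hz => h0 z hz) |>.congr hg

instance : IsManifold 𝓘(ℂ) ω (OnePoint ℂ) := by
  apply isManifold_of_contDiffOn
  have hF : ∀ z, chartFinite.symm z = (z : OnePoint ℂ) := chartFinite_symm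
  have hI : ∀ z, chartInfty.symm z = inv (z : OnePoint ℂ) := fun z => by
    change inv (chartFinite.symm z) = _
    rw [hF]
  have hI' : ∀ p, chartInfty p = chartFinite (inv p) := fun p => rfl
  have hsI : ∀ p, p ∈ chartInfty.source ↔ inv p ∈ chartFinite.source := fun p => by
    change p ∈ univ ∩ inv ⁻¹' _ ↔ _
    simp
  have hmix : ∀ z : ℂ, z ≠ 0 → chartFinite (inv (z : OnePoint ℂ)) = z⁻¹ := fun z hz => by
    rw [inv_coe hz, chartFinite_coe]
  intro e e' he he'
  rcases he with rfl | rfl <;> rcases he' with rfl | rfl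
  · refine contDiffOn_id.congr fun z _ => ?_
    change chartFinite (chartFinite.symm z) = z
    rw [hF, chartFinite_coe]
  · have h0 : ∀ z ∈ (𝓘(ℂ).symm ⁻¹' (chartFinite.symm ≫ₕ chartInfty).source ∩ range 𝓘(ℂ)),
        z ≠ 0 := by
      rintro z ⟨⟨-, hz⟩, -⟩
      have hz' : chartFinite.symm z ∈ chartInfty.source := hz
      rw [hF, hsI] at hz'
      exact inv_mem_chartFinite_source hz'
    refine contDiffOn_inv_of_eq h0 fun z hz => ?_
    change chartInfty (chartFinite.symm z) = _
    rw [hF, hI', hmix z (h0 z hz)]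
  · have h0 : ∀ z ∈ (𝓘(ℂ).symm ⁻¹' (chartInfty.symm ≫ₕ chartFinite).source ∩ range 𝓘(ℂ)),
        z ≠ 0 := by
      rintro z ⟨⟨-, hz⟩, -⟩
      have hz' : chartInfty.symm z ∈ chartFinite.source := hz
      rw [hI] at hz'
      exact inv_mem_chartFinite_source hz'
    refine contDiffOn_inv_of_eq h0 fun z hz => ?_
    change chartFinite (chartInfty.symm z) = _
    rw [hI, hmix z (h0 z hz)]
  · refine contDiffOn_id.congr fun z _ => ?_
    change chartInfty (chartInfty.symm z) = z
    rw [hI, hI', inv_inv, chartFinite_coe]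

/-- The extension of `z ↦ z ^ b` to `ℙ¹`, fixing `∞` (meant for `b ≥ 1`). -/
def powMap (b : ℕ) : OnePoint ℂ → OnePoint ℂ := OnePoint.map fun z => z ^ b

/-- The unit circle `{|z| = 1}` in `ℙ¹`. -/
def unitCircle : Set (OnePoint ℂ) := ((↑) : ℂ → OnePoint ℂ) '' Metric.sphere 0 1

end RiemannSphere

/-! ### Analytic subsets and meromorphic self-maps -/

/-- `A` is an analytic subset of the complex manifold `M`: near every point of `M` it is the
common zero set of finitely many holomorphic functions. (In particular `A` is closed.) -/
def IsAnalyticSubset {E H M : Type*} [NormedAddCommGroup E] [NormedSpace ℂ E]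
    [TopologicalSpace H] (I : ModelWithCorners ℂ E H) [TopologicalSpace M] [ChartedSpace H M]
    (A : Set M) : Prop :=
  ∀ x : M, ∃ U : Set M, IsOpen U ∧ x ∈ U ∧ ∃ (k : ℕ) (g : Fin k → M → ℂ),
    (∀ i, ContMDiffOn I 𝓘(ℂ) ω (g i) U) ∧ ∀ y ∈ U, y ∈ A ↔ ∀ i, g i y = 0

/-- The model space `ℂⁿ` of an `n`-dimensional complex manifold. -/
abbrev Cn (n : ℕ) : Type := EuclideanSpace ℂ (Fin n)

/-- A meromorphic self-map `X ⇢ X` of an `n`-dimensional compact complex manifold: a holomorphic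
map `X \ indet → X`, where `indet` is a nowhere dense analytic subset, such that the closure of its
graph is an analytic subset of `X × X`. One may always take for `indet` the indeterminacy locus,
the smallest possible choice. The values of `toFun` on `indet` carry no meaning. -/
structure MeromorphicSelfMap (n : ℕ) (X : Type*) [TopologicalSpace X]
    [ChartedSpace (Cn n) X] where
  /-- the underlying map, meaningful off `indet` -/
  toFun : X → X
  /-- the exceptional set -/
  indet : Set X
  isAnalyticSubset_indet : IsAnalyticSubset 𝓘(ℂ, Cn n) indet
  isNowhereDense_indet : IsNowhereDense indet
  holomorphic : ContMDiffOn 𝓘(ℂ, Cn n) 𝓘(ℂ, Cn n) ω toFun indetᶜ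
  isAnalyticSubset_graph : IsAnalyticSubset (𝓘(ℂ, Cn n).prod 𝓘(ℂ, Cn n))
    (closure {p : X × X | p.1 ∉ indet ∧ p.2 = toFun p.1})

/-- `f` is dominant: its image is dense (for compact `X`, the closure of the graph maps onto `X`
under the second projection). -/
def MeromorphicSelfMap.IsDominant {n : ℕ} {X : Type*} [TopologicalSpace X]
    [ChartedSpace (Cn n) X] (f : MeromorphicSelfMap n X) : Prop :=
  Dense (f.toFun '' f.indetᶜ)

/-! ### Transversally superattracting subsets -/

/-- The function `g` vanishes to order at least `a` along `L` at `ξ`: at all points `p` of `L` near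
`ξ`, `g` vanishes to order at least `a`, that is `g y = O(|y - p| ^ a)` in local coordinates. -/
def VanishesToOrderAlong (n : ℕ) {X : Type*} [TopologicalSpace X] [ChartedSpace (Cn n) X]
    (g : X → ℂ) (L : Set X) (a : ℕ) (ξ : X) : Prop :=
  ∀ᶠ p in 𝓝[L] ξ, g =O[𝓝 p] fun y => ‖chartAt (Cn n) ξ y - chartAt (Cn n) ξ p‖ ^ a

/-- `L` is transversally superattracting of degree `a` for `f`: whenever `χ` is a holomorphic
function at a point `η ∈ L` that vanishes along `L`, and `ξ ∈ L` satisfies `f ξ = η`, then `χ ∘ f`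
vanishes to order at least `a` along `L` at `ξ`. -/
def IsTransversallySuperattracting (n : ℕ) {X : Type*} [TopologicalSpace X]
    [ChartedSpace (Cn n) X] (f : X → X) (L : Set X) (a : ℕ) : Prop :=
  ∀ η ∈ L, ∀ χ : X → ℂ, ContMDiffAt 𝓘(ℂ, Cn n) 𝓘(ℂ) ω χ η → (∀ᶠ y in 𝓝[L] η, χ y = 0) →
    ∀ ξ ∈ L, f ξ = η → VanishesToOrderAlong n (χ ∘ f) L a ξ

/-! ### The local stable set and real analytic submanifolds -/

/-- The local stable set of `S` relative to a neighbourhood `Ω` of `S`: the points whose forward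
orbit stays in `Ω` and converges to `S`. -/
def localStableSet {X : Type*} [TopologicalSpace X] (f : X → X) (S Ω : Set X) : Set X :=
  {x | (∀ k : ℕ, f^[k] x ∈ Ω) ∧ Tendsto (fun k : ℕ => f^[k] x) atTop (𝓝ˢ S)}

/-- `W` is a (locally closed, embedded) real analytic submanifold of real dimension `d`: near each
of its points there are real analytic coordinates `Ψ` (obtained from the given chart by a real
analytic change of coordinates) in which `W` is a `d`-dimensional real linear subspace. -/
def IsRealAnalyticSubmanifold (E : Type*) [NormedAddCommGroup E] [NormedSpace ℝ E]
    {X : Type*} [TopologicalSpace X] [ChartedSpace E X] (d : ℕ) (W : Set X) : Prop :=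
  ∀ p ∈ W, ∃ (Ψ : OpenPartialHomeomorph E E) (V : Submodule ℝ E),
    chartAt E p p ∈ Ψ.source ∧ Ψ.source ⊆ (chartAt E p).target ∧
    AnalyticOnNhd ℝ Ψ Ψ.source ∧ AnalyticOnNhd ℝ Ψ.symm Ψ.target ∧
    Module.finrank ℝ V = d ∧
    ∀ v ∈ Ψ.source, (chartAt E p).symm v ∈ W ↔ Ψ v ∈ V

end

noncomputable section

/-! ### Holomorphic functions of several variables -/

section SeveralVariables

open Metric

variable {E F : Type*} [NormedAddCommGroup E] [NormedSpace ℂ E]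
  [NormedAddCommGroup F] [NormedSpace ℂ F]

/-! Near the line L a point x has a coordinate Z x along L, read off from a local holomorphic
retraction onto L, and a transversal size D x. Put m = min(|Z|, 1/|Z|), which measures how far x is
from the two ends 0 and ∞ of L. Superattraction gives D ∘ f ≤ C D^a, and the form of f on L gives Z
∘ f = Z^b (1 + O(D / m^b)). Because a ≥ b, the cone D < ε m^b is invariant and the slope D / m^b
shrinks geometrically along orbits (`slope_comp_le`). Böttcher's construction therefore converges
there: φ = Z exp(∑ b^{-(k+1)} log(Z(f^{k+1} x) / Z(f^k x)^b)) satisfies φ ∘ f = φ^b, and φ restricts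
to the affine coordinate on the part of L inside the cone.

The stable set is then {|φ| = 1}, locally at each of its points. If the orbit of x converges to the
circle, |φ x|^{b^k} tends to 1, so |φ x| = 1 (`norm_bottcher_eq_one`). Conversely |φ| = 1 persists
along orbits, D tends to 0, and a point with |φ| = 1 and D small is close to the circle
(`exists_mem_of_norm_bottcher_eq_one`). Since φ is the coordinate on L, its derivative does not
vanish near the circle, so {|φ| = 1} is a smooth real analytic hypersurface there.

The delicate point is that φ is holomorphic. Only local retractions are available, and Z is
assembled from finitely many of them by an arbitrary selection, so Z may jump. Freezing the charts
along the orbit of one point p produces holomorphic models of φ, but the k-th model lives only on a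
ball of radius about C^{-k}, since nearby orbits may separate at rate C. Its error is O(C^{-4k}),
smaller than the cube of that radius, and this suffices for complex differentiability at p
(`differentiableAt_of_approx_on_shrinking_balls`). Differentiability at every point of an open set
then gives analyticity by a several-variable Goursat theorem. -/

theorem norm_fderiv_le_of_norm_le_on_ball {g : E → F} {x : E} {r M : ℝ} (hr : 0 < r)
    (hg : DifferentiableOn ℂ g (ball x r)) (hM : ∀ y ∈ ball x r, ‖g y‖ ≤ M) :
    ‖fderiv ℂ g x‖ ≤ 2 * M / r := by
  refine Complex.norm_fderiv_le_div_of_mapsTo_ball hg (fun y hy => ?_) hr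
  rw [mem_closedBall, dist_eq_norm]
  linarith [norm_sub_le (g y) (g x), hM y hy, hM x (mem_ball_self hr)]

/-- Second order Taylor estimate for a bounded holomorphic function on a ball. -/
theorem norm_sub_sub_fderiv_le_of_norm_le_on_ball {g : E → F} {x v : E} {r M : ℝ}
    (hg : DifferentiableOn ℂ g (ball x r)) (hM : ∀ y ∈ ball x r, ‖g y‖ ≤ M) (hv : ‖v‖ < r) :
    ‖g (x + v) - g x - fderiv ℂ g x v‖ ≤ 4 * M * (‖v‖ / r) ^ 2 := by
  have hr : 0 < r := (norm_nonneg v).trans_lt hv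
  have hgx : DifferentiableAt ℂ g x := hg.differentiableAt (ball_mem_nhds x hr)
  have hA := norm_fderiv_le_of_norm_le_on_ball hr hg hM
  have hM0 : 0 ≤ M := (norm_nonneg _).trans (hM x (mem_ball_self hr))
  -- Removing the linear part makes `h y - h x` vanish to second order at `x`, so the Schwarz lemma
  -- of order 2 applies. The bound 4M is M for `g y`, 2M for the linear term and M for `g x`.
  set h : E → F := fun y => g y - fderiv ℂ g x (y - x) with hh
  have hhx : h x = g x := by simp [hh]
  have key := Complex.dist_le_mul_div_pow_of_mapsTo_ball_of_isLittleO (f := h) (c := x) (z := x + v)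
    (R₁ := r) (R₂ := 4 * M) (n := 1) ?_ ?_ ?_ ?_
  · rw [dist_eq_norm, hhx] at key
    simpa [hh, dist_eq_norm, sub_right_comm] using key
  · exact hg.sub ((fderiv ℂ g x).differentiable.comp
      (differentiable_id.sub_const x)).differentiableOn
  · intro y hy
    rw [mem_closedBall, dist_eq_norm, hhx]
    have h1 : ‖fderiv ℂ g x (y - x)‖ ≤ 2 * M := by
      refine ((fderiv ℂ g x).le_opNorm _).trans ?_
      have : ‖y - x‖ ≤ r := by rw [← dist_eq_norm]; exact (mem_ball.1 hy).le
      calc ‖fderiv ℂ g x‖ * ‖y - x‖ ≤ (2 * M / r) * r := by gcongr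
        _ = 2 * M := by field_simp
    calc ‖g y - fderiv ℂ g x (y - x) - g x‖ ≤ ‖g y - fderiv ℂ g x (y - x)‖ + ‖g x‖ :=
          norm_sub_le _ _
      _ ≤ ‖g y‖ + ‖fderiv ℂ g x (y - x)‖ + ‖g x‖ := by gcongr; exact norm_sub_le _ _
      _ ≤ 4 * M := by linarith [hM y hy, hM x (mem_ball_self hr)]
  · simp only [pow_one]
    rw [Asymptotics.isLittleO_norm_right]
    refine (hgx.hasFDerivAt.isLittleO).congr_left fun y => ?_
    rw [hhx]; simp only [hh]; abel
  · simpa [dist_eq_norm] using hv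

/-- A uniform limit of holomorphic functions is holomorphic. -/
theorem differentiableAt_of_uniform_approx [CompleteSpace F] {g : E → F} {x : E} {r M : ℝ}
    (hr : 0 < r) (G : ℕ → E → F) (ε : ℕ → ℝ) (hε : Tendsto ε atTop (𝓝 0))
    (hG : ∀ k, DifferentiableOn ℂ (G k) (ball x r)) (hM : ∀ k, ∀ y ∈ ball x r, ‖G k y‖ ≤ M)
    (h : ∀ k, ∀ y ∈ ball x r, ‖g y - G k y‖ ≤ ε k) : DifferentiableAt ℂ g x := by
  -- The Cauchy estimate applied to differences makes the derivatives at `x` a Cauchy sequence; the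
  -- quadratic Taylor remainder is uniform in `k` and survives in the limit.
  have hA : ∀ k l, ‖fderiv ℂ (G k) x - fderiv ℂ (G l) x‖ ≤ 2 * (ε k + ε l) / r := by
    intro k l
    have hk := (hG k).differentiableAt (ball_mem_nhds x hr)
    have hl := (hG l).differentiableAt (ball_mem_nhds x hr)
    rw [← fderiv_sub hk hl]
    refine norm_fderiv_le_of_norm_le_on_ball hr ((hG k).sub (hG l)) fun y hy => ?_
    have e : (G k - G l) y = (g y - G l y) - (g y - G k y) := by simp
    rw [e]
    linarith [norm_sub_le (g y - G l y) (g y - G k y), h k y hy, h l y hy]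
  have hc : CauchySeq fun k => fderiv ℂ (G k) x := by
    rw [cauchySeq_iff_tendsto_dist_atTop_0]
    have h2 : Tendsto (fun p : ℕ × ℕ => 2 * (ε p.1 + ε p.2) / r) atTop (𝓝 0) := by
      have h3 : Tendsto (fun p : ℕ × ℕ => ε p.1 + ε p.2) atTop (𝓝 (0 + 0)) := by
        rw [← prod_atTop_atTop_eq]
        exact (hε.comp tendsto_fst).add (hε.comp tendsto_snd)
      simpa using (h3.const_mul 2).div_const r
    refine squeeze_zero (fun _ => dist_nonneg) (fun p => ?_) h2
    rw [dist_eq_norm]; exact hA p.1 p.2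
  obtain ⟨A, hAlim⟩ := cauchySeq_tendsto_of_complete hc
  have hlim : ∀ y ∈ ball x r, Tendsto (fun k => G k y) atTop (𝓝 (g y)) := fun y hy => by
    rw [tendsto_iff_norm_sub_tendsto_zero]
    refine squeeze_zero (fun _ => norm_nonneg _) (fun k => ?_) hε
    rw [norm_sub_rev]; exact h k y hy
  have hbd : ∀ v : E, ‖v‖ < r → ‖g (x + v) - g x - A v‖ ≤ 4 * M * (‖v‖ / r) ^ 2 := fun v hv => by
    have hmem : x + v ∈ ball x r := by simpa [dist_eq_norm] using hv
    have hAv : Tendsto (fun k => fderiv ℂ (G k) x v) atTop (𝓝 (A v)) :=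
      ((ContinuousLinearMap.apply ℂ F v).continuous.tendsto A).comp hAlim
    exact le_of_tendsto (((hlim _ hmem).sub (hlim x (mem_ball_self hr))).sub hAv).norm
      (Eventually.of_forall fun k =>
        norm_sub_sub_fderiv_le_of_norm_le_on_ball (hG k) (hM k) hv)
  refine HasFDerivAt.differentiableAt (f' := A) ?_
  rw [hasFDerivAt_iff_isLittleO_nhds_zero]
  have hO : (fun v : E => g (x + v) - g x - A v) =O[𝓝 0] fun v => ‖v‖ ^ 2 := by
    refine Asymptotics.IsBigO.of_bound (4 * M / r ^ 2) ?_
    filter_upwards [ball_mem_nhds (0 : E) hr] with v hv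
    rw [mem_ball_zero_iff] at hv
    refine (hbd v hv).trans (le_of_eq ?_)
    rw [norm_pow, norm_norm]; field_simp
  refine hO.trans_isLittleO ?_
  rw [← Asymptotics.isLittleO_norm_right]
  exact (Asymptotics.isLittleO_pow_id one_lt_two).comp_tendsto (tendsto_norm_zero (E := E))

/-- A function that is approximated on a shrinking sequence of balls by bounded holomorphic
functions, with an error that is small with respect to the cube of the radius, is complex
differentiable at the centre. -/
theorem differentiableAt_of_approx_on_shrinking_balls [CompleteSpace F] {g : E → F} {x : E}
    {δ μ ϑ A M : ℝ} (hδ : 0 < δ) (hμ : 1 < μ) (hϑ : 0 ≤ ϑ) (hϑμ : ϑ * μ ^ 3 < 1) (G : ℕ → E → F)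
    (hG : ∀ k, DifferentiableOn ℂ (G k) (ball x (δ / μ ^ k)))
    (hM : ∀ k, ∀ y ∈ ball x (δ / μ ^ k), ‖G k y‖ ≤ M)
    (h : ∀ k, ∀ y ∈ ball x (δ / μ ^ k), ‖g y - G k y‖ ≤ A * ϑ ^ k) :
    DifferentiableAt ℂ g x := by
  have hμ0 : 0 < μ := one_pos.trans hμ
  have hr : ∀ k, 0 < δ / μ ^ k := fun k => by positivity
  have hA0 : 0 ≤ A := by simpa using (norm_nonneg _).trans (h 0 x (mem_ball_self (hr 0)))
  have hM0 : 0 ≤ M := (norm_nonneg _).trans (hM 0 x (mem_ball_self (hr 0)))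
  set ρ : ℝ := ϑ * μ with hρ
  have hρ0 : 0 ≤ ρ := by positivity
  have hρ1 : ρ < 1 := by
    refine lt_of_le_of_lt ?_ hϑμ
    rw [hρ]; gcongr; exact le_self_pow₀ hμ.le (by norm_num)
  have hsub : ∀ k, ball x (δ / μ ^ (k + 1)) ⊆ ball x (δ / μ ^ k) := fun k => by
    apply ball_subset_ball; gcongr
    · exact hμ.le
    · omega
  have hϑ1 : ϑ ≤ 1 := by
    by_contra! hc
    have : 1 ≤ μ ^ 3 := one_le_pow₀ hμ.le
    nlinarith
  set B : ℝ := 2 * (2 * A) * μ / δ with hB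
  have hstep : ∀ k, dist (fderiv ℂ (G k) x) (fderiv ℂ (G (k + 1)) x) ≤ B * ρ ^ k := by
    intro k
    have hk := (hG k).differentiableAt (ball_mem_nhds x (hr k))
    have hl := (hG (k + 1)).differentiableAt (ball_mem_nhds x (hr (k + 1)))
    rw [dist_eq_norm, ← fderiv_sub hk hl]
    refine (norm_fderiv_le_of_norm_le_on_ball (M := 2 * (A * ϑ ^ k)) (hr (k + 1))
      (((hG k).mono (hsub k)).sub (hG (k + 1))) fun y hy => ?_).trans (le_of_eq ?_)
    · have e : (G k - G (k + 1)) y = (g y - G (k + 1) y) - (g y - G k y) := by simp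
      rw [e]
      have h3 : A * ϑ ^ (k + 1) ≤ A * ϑ ^ k := by
        gcongr ?_ * ?_
        exact pow_le_pow_of_le_one hϑ hϑ1 (Nat.le_succ k)
      linarith [norm_sub_le (g y - G (k + 1) y) (g y - G k y), h k y (hsub k hy), h (k + 1) y hy]
    · rw [hB, hρ, mul_pow, pow_succ]; field_simp
  obtain ⟨L, hL⟩ := cauchySeq_tendsto_of_complete (cauchySeq_of_le_geometric ρ B hρ1 hstep)
  have hAL : ∀ k, ‖fderiv ℂ (G k) x - L‖ ≤ B * ρ ^ k / (1 - ρ) := fun k => by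
    rw [← dist_eq_norm]; exact dist_le_of_le_geometric_of_tendsto ρ B hρ1 hstep hL k
  refine HasFDerivAt.differentiableAt (f' := L) ?_
  rw [hasFDerivAt_iff_isLittleO_nhds_zero, Asymptotics.isLittleO_iff]
  intro c hc
  -- A vector `v` of size comparable to μ^{-3m} is tested against the m-th model. Divided by ‖v‖,
  -- the approximation error is of order (ϑ μ³)^m, the Taylor remainder of order μ^{-m}, and the
  -- error in the derivative of order ρ^m; all tend to 0. The cube balances the first two: ‖v‖ must
  -- be well below the radius μ^{-m} and well above ϑ^m.
  set s : ℕ → ℝ := fun k => δ / 2 / (μ ^ 3) ^ k with hs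
  have hμ3 : 1 < μ ^ 3 := one_lt_pow₀ hμ (by norm_num)
  have hlim : Tendsto (fun k : ℕ => (4 * A * μ ^ 3 / δ) * (ϑ * μ ^ 3) ^ k + (B / (1 - ρ)) * ρ ^ k
      + (2 * M / δ) * (1 / μ) ^ k) atTop (𝓝 0) := by
    have h1 := tendsto_pow_atTop_nhds_zero_of_lt_one (r := ϑ * μ ^ 3) (by positivity) hϑμ
    have h2 := tendsto_pow_atTop_nhds_zero_of_lt_one hρ0 hρ1
    have h3 := tendsto_pow_atTop_nhds_zero_of_lt_one (r := 1 / μ) (by positivity)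
      ((div_lt_one hμ0).2 hμ)
    simpa using ((h1.const_mul (4 * A * μ ^ 3 / δ)).add (h2.const_mul (B / (1 - ρ)))).add
      (h3.const_mul (2 * M / δ))
  obtain ⟨k₀, hk₀⟩ := eventually_atTop.1 ((tendsto_order.1 hlim).2 c hc)
  have hs0 : ∀ k, 0 < s k := fun k => by positivity
  filter_upwards [ball_mem_nhds (0 : E) (hs0 k₀)] with v hv
  rw [mem_ball_zero_iff] at hv
  by_cases hv0 : v = 0
  · simp [hv0]
  have hvpos : 0 < ‖v‖ := norm_pos_iff.2 hv0
  obtain ⟨m, hm1, hm2⟩ : ∃ m, s (m + 1) < ‖v‖ ∧ ‖v‖ ≤ s m := by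
    have hle : 1 ≤ δ / 2 / ‖v‖ := by
      rw [one_le_div hvpos]
      refine hv.le.trans ?_
      exact div_le_self (by positivity) (one_le_pow₀ hμ3.le)
    obtain ⟨m, h1, h2⟩ := exists_nat_pow_near hle hμ3
    refine ⟨m, ?_, ?_⟩
    · rw [div_lt_iff₀ hvpos] at h2
      rw [hs]; simp only; rw [div_lt_iff₀ (by positivity)]; linarith
    · rw [le_div_iff₀ hvpos] at h1
      rw [hs]; simp only; rw [le_div_iff₀ (by positivity)]; linarith
  have hmk : k₀ ≤ m := by
    by_contra! hlt
    have : s k₀ ≤ s (m + 1) := by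
      simp only [hs]; gcongr
      · exact hμ3.le
      · omega
    linarith
  have hsr : s m < δ / μ ^ m := by
    have h1 : s m ≤ δ / 2 / μ ^ m := by
      simp only [hs]; gcongr
      exact le_self_pow₀ hμ.le (by norm_num)
    have h2 : δ / 2 / μ ^ m < δ / μ ^ m := by gcongr; linarith
    linarith
  have hvr : ‖v‖ < δ / μ ^ m := hm2.trans_lt hsr
  have hmem : x + v ∈ ball x (δ / μ ^ m) := by simpa [dist_eq_norm] using hvr
  have e1 := norm_sub_sub_fderiv_le_of_norm_le_on_ball (hG m) (hM m) hvr
  have e2 := h m _ hmem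
  have e3 := h m x (mem_ball_self (hr m))
  have e4 : ‖(fderiv ℂ (G m) x - L) v‖ ≤ B * ρ ^ m / (1 - ρ) * ‖v‖ :=
    ((fderiv ℂ (G m) x - L).le_opNorm v).trans (by gcongr; exact hAL m)
  have e5 : g (x + v) - g x - L v = (g (x + v) - G m (x + v)) - (g x - G m x)
      + (G m (x + v) - G m x - fderiv ℂ (G m) x v) + (fderiv ℂ (G m) x - L) v := by
    simp only [sub_apply]; abel
  have e6 : ‖g (x + v) - g x - L v‖ ≤ A * ϑ ^ m + A * ϑ ^ m + 4 * M * (‖v‖ / (δ / μ ^ m)) ^ 2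
      + B * ρ ^ m / (1 - ρ) * ‖v‖ := by
    rw [e5]
    refine (norm_add_le _ _).trans (add_le_add ((norm_add_le _ _).trans (add_le_add
      ((norm_sub_le _ _).trans (add_le_add e2 e3)) e1)) e4)
  have f1 : A * ϑ ^ m + A * ϑ ^ m ≤ (4 * A * μ ^ 3 / δ) * (ϑ * μ ^ 3) ^ m * ‖v‖ := by
    have : A * ϑ ^ m + A * ϑ ^ m = (4 * A * μ ^ 3 / δ) * (ϑ * μ ^ 3) ^ m * s (m + 1) := by
      simp only [hs]; rw [mul_pow, pow_succ (μ ^ 3)]; field_simp; ring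
    rw [this]
    gcongr
  have f2 : 4 * M * (‖v‖ / (δ / μ ^ m)) ^ 2 ≤ (2 * M / δ) * (1 / μ) ^ m * ‖v‖ := by
    have : 4 * M * (‖v‖ / (δ / μ ^ m)) ^ 2 = 4 * M * ‖v‖ * (μ ^ m) ^ 2 / δ ^ 2 * ‖v‖ := by
      field_simp
    rw [this]
    refine mul_le_mul_of_nonneg_right ?_ (norm_nonneg v)
    calc 4 * M * ‖v‖ * (μ ^ m) ^ 2 / δ ^ 2 ≤ 4 * M * s m * (μ ^ m) ^ 2 / δ ^ 2 := by gcongr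
      _ = (2 * M / δ) * (1 / μ) ^ m := by
        simp only [hs]; rw [← pow_mul, mul_comm 3 m, pow_mul, one_div, inv_pow]; field_simp; ring
  have hfin := (hk₀ m hmk).le
  calc ‖g (x + v) - g x - L v‖ ≤ _ := e6
    _ ≤ ((4 * A * μ ^ 3 / δ) * (ϑ * μ ^ 3) ^ m + (B / (1 - ρ)) * ρ ^ m
      + (2 * M / δ) * (1 / μ) ^ m) * ‖v‖ := by
      have : B * ρ ^ m / (1 - ρ) = B / (1 - ρ) * ρ ^ m := by ring
      rw [this]; linarith
    _ ≤ c * ‖v‖ := by gcongr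

end SeveralVariables

/-! ### Goursat's theorem in several variables -/

section Goursat

open Metric

variable {E F : Type*} [NormedAddCommGroup E] [NormedSpace ℂ E]
  [NormedAddCommGroup F] [NormedSpace ℂ F]

theorem differentiableAt_of_forall_apply [FiniteDimensional ℂ E] {D : Type*}
    [NormedAddCommGroup D] [NormedSpace ℂ D] {h : D → E →L[ℂ] F} {x : D}
    (hh : ∀ v, DifferentiableAt ℂ (fun y => h y v) x) : DifferentiableAt ℂ h x := by
  set b := Module.finBasis ℂ E
  have e : h = fun y => ∑ i, ContinuousLinearMap.smulRightL ℂ E F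
      (LinearMap.toContinuousLinearMap (b.coord i)) (h y (b i)) := by
    funext y
    refine ContinuousLinearMap.coe_injective (b.ext fun j => ?_)
    simp [Finsupp.single_apply]
  rw [e]
  refine DifferentiableAt.fun_sum fun i _ => ?_
  exact (ContinuousLinearMap.differentiableAt _).comp x (hh (b i))

/-- The derivative of a holomorphic function is holomorphic. -/
theorem DifferentiableOn.fderiv_of_isOpen [FiniteDimensional ℂ E] [CompleteSpace F] {g : E → F}
    {s : Set E} (hg : DifferentiableOn ℂ g s) (hs : IsOpen s) :
    DifferentiableOn ℂ (fderiv ℂ g) s := by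
  intro x hx
  refine DifferentiableAt.differentiableWithinAt (differentiableAt_of_forall_apply fun v => ?_)
  obtain ⟨M, R, hR, hRs, hRM⟩ : ∃ M R, 0 < R ∧ ball x R ⊆ s ∧ ∀ y ∈ ball x R, ‖g y‖ ≤ M := by
    have hc : ContinuousAt g x := (hg.differentiableAt (hs.mem_nhds hx)).continuousAt
    have h1 : ∀ᶠ y in 𝓝 x, ‖g y‖ < ‖g x‖ + 1 := hc.norm.eventually_lt_const (lt_add_one _)
    obtain ⟨R, hR, h2⟩ := Metric.eventually_nhds_iff_ball.1 (h1.and (hs.mem_nhds hx))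
    exact ⟨‖g x‖ + 1, R, hR, fun y hy => (h2 y hy).2, fun y hy => (h2 y hy).1.le⟩
  set r := R / 2 with hr
  have hr0 : 0 < r := by positivity
  have hM0 : 0 ≤ M := (norm_nonneg _).trans (hRM x (mem_ball_self hR))
  have hball : ∀ y ∈ ball x r, ball y r ⊆ ball x R := fun y hy => by
    apply ball_subset_ball'
    have := mem_ball.1 hy
    linarith
  -- The directional derivative is a uniform limit of the difference quotients with step 1/t, t = k
  -- + K. The offset K keeps the displacement v/t shorter than r from the first index on, and the
  -- second order estimate bounds the error by a multiple of 1/t.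
  obtain ⟨K, hK⟩ := exists_nat_gt (‖v‖ / r)
  have hvr : ‖v‖ < K * r := (div_lt_iff₀ hr0).1 hK
  have hK0 : (0 : ℝ) < K := (div_nonneg (norm_nonneg v) hr0.le).trans_lt hK
  set t : ℕ → ℝ := fun k => k + K with ht
  have ht0 : ∀ k, 0 < t k := fun k => by positivity
  have htn : ∀ k, ‖(((t k)⁻¹ : ℝ) : ℂ) • v‖ = ‖v‖ / t k := fun k => by
    rw [norm_smul, Complex.norm_real, norm_inv, Real.norm_of_nonneg (ht0 k).le]; ring
  have htr : ∀ k, ‖(((t k)⁻¹ : ℝ) : ℂ) • v‖ < r := fun k => by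
    rw [htn, div_lt_iff₀ (ht0 k)]
    have : (0 : ℝ) ≤ k := by positivity
    simp only [ht]; nlinarith
  set ε : ℕ → ℝ := fun k => 4 * M * (‖v‖ / r) ^ 2 / t k with hε
  have hεlim : Tendsto ε atTop (𝓝 0) := by
    refine Tendsto.const_div_atTop ?_ _
    exact tendsto_atTop_add_const_right _ _ tendsto_natCast_atTop_atTop
  have hεle : ∀ k, ε k ≤ 4 * M * (‖v‖ / r) ^ 2 / K := fun k => by
    simp only [hε, ht]; gcongr; simp
  have happ : ∀ k, ∀ y ∈ ball x r,
      ‖fderiv ℂ g y v - (t k : ℂ) • (g (y + (((t k)⁻¹ : ℝ) : ℂ) • v) - g y)‖ ≤ ε k := by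
    intro k y hy
    have h1 := norm_sub_sub_fderiv_le_of_norm_le_on_ball (hg.mono ((hball y hy).trans hRs))
      (fun z hz => hRM z (hball y hy hz)) (htr k)
    have htk : (t k : ℂ) ≠ 0 := by exact_mod_cast (ht0 k).ne'
    have e : fderiv ℂ g y v - (t k : ℂ) • (g (y + (((t k)⁻¹ : ℝ) : ℂ) • v) - g y) =
        -((t k : ℂ) • (g (y + (((t k)⁻¹ : ℝ) : ℂ) • v) - g y
          - fderiv ℂ g y ((((t k)⁻¹ : ℝ) : ℂ) • v))) := by
      rw [smul_sub (t k : ℂ) (_ - _) (fderiv ℂ g y _), map_smul, smul_smul, Complex.ofReal_inv,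
        mul_inv_cancel₀ htk, one_smul]
      abel
    rw [e, norm_neg, norm_smul, Complex.norm_real, Real.norm_of_nonneg (ht0 k).le]
    calc t k * _ ≤ t k * (4 * M * (‖(((t k)⁻¹ : ℝ) : ℂ) • v‖ / r) ^ 2) := by
          have := (ht0 k).le
          gcongr
      _ = ε k := by
        rw [htn]; simp only [hε]; have := (ht0 k).ne'; field_simp
  refine differentiableAt_of_uniform_approx (M := 2 * M / r * ‖v‖ + 4 * M * (‖v‖ / r) ^ 2 / K) hr0
    (fun k y => (t k : ℂ) • (g (y + (((t k)⁻¹ : ℝ) : ℂ) • v) - g y)) ε hεlim (fun k => ?_)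
    (fun k y hy => ?_) happ
  · have hR1 : DifferentiableOn ℂ g (ball x R) := hg.mono hRs
    refine DifferentiableOn.fun_const_smul (DifferentiableOn.fun_sub (hR1.comp
      (differentiable_id.add_const _).differentiableOn fun y hy => ?_)
      (hR1.mono (ball_subset_ball (by linarith)))) _
    refine hball y hy ?_
    simpa [dist_eq_norm] using htr k
  · have h1 := happ k y hy
    have h2 : ‖fderiv ℂ g y v‖ ≤ 2 * M / r * ‖v‖ := by
      refine ((fderiv ℂ g y).le_opNorm v).trans ?_
      gcongr
      exact norm_fderiv_le_of_norm_le_on_ball hr0 (hg.mono ((hball y hy).trans hRs))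
        (fun z hz => hRM z (hball y hy hz))
    have h3 := norm_sub_norm_le ((t k : ℂ) • (g (y + (((t k)⁻¹ : ℝ) : ℂ) • v) - g y))
      (fderiv ℂ g y v)
    rw [norm_sub_rev] at h3
    linarith [hεle k]

theorem DifferentiableOn.iteratedFDeriv_of_isOpen [FiniteDimensional ℂ E] [CompleteSpace F]
    {g : E → F} {s : Set E} (hg : DifferentiableOn ℂ g s) (hs : IsOpen s) (k : ℕ) :
    DifferentiableOn ℂ (iteratedFDeriv ℂ k g) s := by
  induction k with
  | zero =>
    rw [iteratedFDeriv_zero_eq_comp]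
    exact (LinearIsometryEquiv.differentiable _).comp_differentiableOn hg
  | succ k ih =>
    rw [iteratedFDeriv_succ_eq_comp_left]
    exact (LinearIsometryEquiv.differentiable _).comp_differentiableOn (ih.fderiv_of_isOpen hs)

/-- Cauchy estimates for the iterated derivatives. -/
theorem norm_iteratedFDeriv_le_of_norm_le [FiniteDimensional ℂ E] [CompleteSpace F]
    {g : E → F} {s : Set E} (hg : DifferentiableOn ℂ g s) (hs : IsOpen s) {M ρ : ℝ} (hρ : 0 < ρ)
    (hM : ∀ y ∈ s, ‖g y‖ ≤ M) (k : ℕ) :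
    ∀ y, ball y ((k + 1) * ρ) ⊆ s → ‖iteratedFDeriv ℂ k g y‖ ≤ M * (2 / ρ) ^ k := by
  induction k with
  | zero =>
    intro y hy
    simpa using hM y (hy (mem_ball_self (by positivity)))
  | succ k ih =>
    intro y hy
    rw [← norm_fderiv_iteratedFDeriv]
    have hsub : ∀ z ∈ ball y ρ, ball z ((k + 1) * ρ) ⊆ s := fun z hz => by
      refine Subset.trans (ball_subset_ball' ?_) hy
      have := mem_ball.1 hz
      push_cast; linarith
    refine (norm_fderiv_le_of_norm_le_on_ball hρ ((hg.iteratedFDeriv_of_isOpen hs k).mono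
      fun z hz => hsub z hz (mem_ball_self (by positivity)))
      fun z hz => ih z (hsub z hz)).trans (le_of_eq ?_)
    rw [pow_succ]; ring

/-- Restriction to complex lines reduces the convergence of the Taylor series in several variables
to the one-variable theorem. -/
theorem iteratedDeriv_comp_line [FiniteDimensional ℂ E] [CompleteSpace F]
    {g : E → F} {s : Set E} (hg : DifferentiableOn ℂ g s) (hs : IsOpen s) (x v : E) (k : ℕ) :
    ∀ t : ℂ, x + t • v ∈ s → iteratedDeriv k (fun t : ℂ => g (x + t • v)) t =
      iteratedFDeriv ℂ k g (x + t • v) fun _ => v := by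
  induction k with
  | zero => intro t _; simp
  | succ k ih =>
    intro t ht
    rw [iteratedDeriv_succ]
    have hc : Continuous fun t : ℂ => x + t • v := by fun_prop
    have hev : iteratedDeriv k (fun t : ℂ => g (x + t • v)) =ᶠ[𝓝 t]
        fun t => iteratedFDeriv ℂ k g (x + t • v) fun _ => v := by
      filter_upwards [hc.continuousAt.preimage_mem_nhds (hs.mem_nhds ht)] with u hu using ih u hu
    rw [hev.deriv_eq]
    have h1 : HasFDerivAt (iteratedFDeriv ℂ k g) (fderiv ℂ (iteratedFDeriv ℂ k g) (x + t • v))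
        (x + t • v) :=
      ((hg.iteratedFDeriv_of_isOpen hs k).differentiableAt (hs.mem_nhds ht)).hasFDerivAt
    have h2 : HasDerivAt (fun t : ℂ => x + t • v) v t := by
      simpa using ((hasDerivAt_id t).smul_const v).const_add x
    have h3 := h1.comp_hasDerivAt t h2
    have h4 := ((ContinuousMultilinearMap.apply ℂ (fun _ : Fin k => E) F
      fun _ => v).hasFDerivAt.comp_hasDerivAt t h3)
    rw [iteratedFDeriv_succ_apply_left]
    exact h4.deriv

/-- A complex differentiable function on an open subset of a finite-dimensional space is
analytic. -/
theorem DifferentiableOn.analyticOnNhd_of_finiteDimensional [FiniteDimensional ℂ E]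
    [CompleteSpace F] {g : E → F} {s : Set E} (hg : DifferentiableOn ℂ g s) (hs : IsOpen s) :
    AnalyticOnNhd ℂ g s := by
  intro x hx
  obtain ⟨M, R, hR, hRs, hRM⟩ : ∃ M R, 0 < R ∧ ball x R ⊆ s ∧ ∀ y ∈ ball x R, ‖g y‖ ≤ M := by
    have hc : ContinuousAt g x := (hg.differentiableAt (hs.mem_nhds hx)).continuousAt
    have h1 : ∀ᶠ y in 𝓝 x, ‖g y‖ < ‖g x‖ + 1 := hc.norm.eventually_lt_const (lt_add_one _)
    obtain ⟨R, hR, h2⟩ := Metric.eventually_nhds_iff_ball.1 (h1.and (hs.mem_nhds hx))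
    exact ⟨‖g x‖ + 1, R, hR, fun y hy => (h2 y hy).2, fun y hy => (h2 y hy).1.le⟩
  have hM0 : 0 ≤ M := (norm_nonneg _).trans (hRM x (mem_ball_self hR))
  have hgR : DifferentiableOn ℂ g (ball x R) := hg.mono hRs
  set p : FormalMultilinearSeries ℂ E F := fun k => ((k.factorial : ℂ)⁻¹) • iteratedFDeriv ℂ k g x
  -- The Cauchy estimates with step R/(k+1) bound the k-th coefficient by M (2(k+1)/R)^k / k!. Since
  -- (k+1)^k / k! ≤ e^{k+1}, the radius R/(2e) keeps the terms bounded by M e.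
  obtain ⟨r, hr⟩ : ∃ r : NNReal, (r : ℝ) = R / (2 * Real.exp 1) := ⟨⟨_, by positivity⟩, rfl⟩
  have hr0 : 0 < r := by
    rw [← NNReal.coe_pos, hr]; positivity
  have hrR : (r : ℝ) ≤ R := by
    rw [hr]
    refine div_le_self hR.le ?_
    linarith [Real.one_le_exp (zero_le_one (α := ℝ))]
  refine ⟨p, (r : ENNReal), ?_, by exact_mod_cast hr0, ?_⟩
  · refine p.le_radius_of_bound (M * Real.exp 1) fun k => ?_
    have hk1 : (0 : ℝ) < k + 1 := by positivity
    have h1 := norm_iteratedFDeriv_le_of_norm_le hgR isOpen_ball (ρ := R / (k + 1)) (by positivity)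
      hRM k x (by rw [mul_div_cancel₀ _ hk1.ne'])
    have h2 : ‖p k‖ ≤ ((k.factorial : ℝ))⁻¹ * (M * (2 / (R / (k + 1))) ^ k) := by
      simp only [p]
      rw [norm_smul, norm_inv, Complex.norm_natCast]
      gcongr
    have h3 := Real.pow_div_factorial_le_exp ((k : ℝ) + 1) hk1.le k
    calc ‖p k‖ * (r : ℝ) ^ k ≤ ((k.factorial : ℝ))⁻¹ * (M * (2 / (R / (k + 1))) ^ k)
          * (R / (2 * Real.exp 1)) ^ k := by
          rw [hr]; gcongr
      _ = M * (((k : ℝ) + 1) ^ k / k.factorial) * (Real.exp 1 ^ k)⁻¹ := by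
        simp only [div_pow, mul_pow]; field_simp
      _ ≤ M * Real.exp (k + 1) * (Real.exp 1 ^ k)⁻¹ := by gcongr
      _ = M * Real.exp 1 := by
        rw [Real.exp_add, Real.exp_one_pow]; field_simp
  · intro v hv
    have hv' : ‖v‖ < r := by
      rw [Metric.eball_coe, mem_ball_zero_iff] at hv; exact hv
    -- The one-variable series along t ↦ x + t v is evaluated at t = 1, so its disc must have radius
    -- greater than 1.
    obtain ⟨ρ, hρ1, hρ⟩ : ∃ ρ : ℝ, 1 < ρ ∧ ρ * ‖v‖ ≤ R := by
      rcases eq_or_ne v 0 with rfl | h0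
      · exact ⟨2, by norm_num, by simpa using hR.le⟩
      · have : 0 < ‖v‖ := norm_pos_iff.2 h0
        exact ⟨R / ‖v‖, by rw [one_lt_div this]; linarith, by field_simp; exact le_rfl⟩
    have hmaps : ∀ t ∈ ball (0 : ℂ) ρ, x + t • v ∈ ball x R := fun t ht => by
      rw [mem_ball_zero_iff] at ht
      rw [mem_ball, dist_eq_norm, add_sub_cancel_left, norm_smul]
      rcases eq_or_ne v 0 with rfl | h0
      · simpa using hR
      · have : 0 < ‖v‖ := norm_pos_iff.2 h0
        nlinarith
    have hd : DifferentiableOn ℂ (fun t : ℂ => g (x + t • v)) (ball 0 ρ) :=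
      hgR.comp (by fun_prop) hmaps
    have hsum := Complex.hasSum_taylorSeries_on_ball hd (z := 1) (by simpa using hρ1)
    simp only [sub_zero, one_pow, one_smul] at hsum
    have hterm : ∀ k : ℕ, (p k fun _ => v) = ((k.factorial : ℂ)⁻¹) •
        iteratedDeriv k (fun t : ℂ => g (x + t • v)) 0 := fun k => by
      rw [iteratedDeriv_comp_line hgR isOpen_ball x v k 0 (by simpa using hR)]
      simp [p]
    simpa only [hterm] using hsum

end Goursat

/-! ### Holomorphic maps of the Riemann sphere -/

namespace RiemannSphere

/-- The affine coordinate on `ℙ¹`, extended by `0` at `∞`. -/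
def coord : OnePoint ℂ → ℂ
  | OnePoint.infty => 0
  | OnePoint.some z => z

@[simp] theorem coord_coe (z : ℂ) : coord (z : OnePoint ℂ) = z := rfl

@[simp] theorem coord_infty : coord OnePoint.infty = 0 := rfl

theorem coe_coord {p : OnePoint ℂ} (hp : p ≠ OnePoint.infty) : (coord p : OnePoint ℂ) = p := by
  induction p using OnePoint.rec with
  | infty => exact absurd rfl hp
  | coe z => rfl

theorem coord_inv (p : OnePoint ℂ) : coord (inv p) = (coord p)⁻¹ := by
  induction p using OnePoint.rec with
  | infty => simp [inv_infty]
  | coe z =>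
    by_cases hz : z = 0
    · subst hz; simp [inv_zero]
    · simp [inv_coe hz]

theorem powMap_coe (b : ℕ) (z : ℂ) : powMap b (z : OnePoint ℂ) = ((z ^ b : ℂ) : OnePoint ℂ) := rfl

theorem powMap_infty (b : ℕ) : powMap b OnePoint.infty = OnePoint.infty := rfl

theorem coord_powMap {b : ℕ} (hb : b ≠ 0) (p : OnePoint ℂ) :
    coord (powMap b p) = coord p ^ b := by
  induction p using OnePoint.rec with
  | infty => simp [powMap_infty, hb]
  | coe z => simp [powMap_coe]

theorem inv_powMap {b : ℕ} (hb : b ≠ 0) (p : OnePoint ℂ) : inv (powMap b p) = powMap b (inv p) := by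
  induction p using OnePoint.rec with
  | infty => simp [powMap_infty, inv_infty, powMap_coe, hb]
  | coe z =>
    by_cases hz : z = 0
    · subst hz; simp [powMap_infty, inv_zero, powMap_coe, hb]
    · rw [powMap_coe, inv_coe hz, inv_coe (pow_ne_zero b hz), powMap_coe, inv_pow]

theorem chartFinite_mem_maximalAtlas :
    chartFinite ∈ IsManifold.maximalAtlas 𝓘(ℂ) ω (OnePoint ℂ) :=
  IsManifold.subset_maximalAtlas (Or.inl rfl)

theorem chartInfty_mem_maximalAtlas :
    chartInfty ∈ IsManifold.maximalAtlas 𝓘(ℂ) ω (OnePoint ℂ) :=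
  IsManifold.subset_maximalAtlas (Or.inr rfl)

theorem mem_chartFinite_source {p : OnePoint ℂ} :
    p ∈ chartFinite.source ↔ p ≠ OnePoint.infty := by
  rw [chartFinite_source, OnePoint.ne_infty_iff_exists]; rfl

theorem contMDiffAt_coord {p : OnePoint ℂ} (hp : p ≠ OnePoint.infty) :
    ContMDiffAt 𝓘(ℂ) 𝓘(ℂ) ω coord p := by
  have hs : chartFinite.source ∈ 𝓝 p :=
    chartFinite.open_source.mem_nhds (mem_chartFinite_source.2 hp)
  refine ((contMDiffOn_of_mem_maximalAtlas chartFinite_mem_maximalAtlas).contMDiffAt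
    hs).congr_of_eventuallyEq ?_
  filter_upwards [hs] with q hq
  rw [← coe_coord (mem_chartFinite_source.1 hq), chartFinite_coe, coord_coe]

theorem contMDiff_coe : ContMDiff 𝓘(ℂ) 𝓘(ℂ) ω ((↑) : ℂ → OnePoint ℂ) := by
  have h := contMDiffOn_symm_of_mem_maximalAtlas chartFinite_mem_maximalAtlas
  rw [chartFinite_target, contMDiffOn_univ] at h
  exact h.congr fun z => (chartFinite_symm z).symm

theorem mem_chartInfty_source {p : OnePoint ℂ} :
    p ∈ chartInfty.source ↔ inv p ∈ chartFinite.source := by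
  change p ∈ univ ∩ inv ⁻¹' _ ↔ _
  simp

theorem contMDiff_inv : ContMDiff 𝓘(ℂ) 𝓘(ℂ) ω inv := by
  intro p
  by_cases hp : p = OnePoint.infty
  · have hs : chartInfty.source ∈ 𝓝 p := chartInfty.open_source.mem_nhds (by
      rw [mem_chartInfty_source, hp, inv_infty, chartFinite_source]; exact ⟨0, rfl⟩)
    refine ((contMDiff_coe _).comp p ((contMDiffOn_of_mem_maximalAtlas
      chartInfty_mem_maximalAtlas).contMDiffAt hs)).congr_of_eventuallyEq ?_
    filter_upwards [hs] with q hq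
    rw [mem_chartInfty_source, mem_chartFinite_source] at hq
    change inv q = ((chartFinite (inv q) : ℂ) : OnePoint ℂ)
    conv_lhs => rw [← coe_coord hq]
    conv_rhs => rw [← coe_coord hq, chartFinite_coe]
  · have hs : chartFinite.source ∈ 𝓝 p :=
      chartFinite.open_source.mem_nhds (mem_chartFinite_source.2 hp)
    have h1 := contMDiffOn_symm_of_mem_maximalAtlas chartInfty_mem_maximalAtlas
    have ht : chartInfty.target = univ := by
      simp [chartInfty, chartFinite_target]
    rw [ht, contMDiffOn_univ] at h1
    refine ((h1 _).comp p ((contMDiffOn_of_mem_maximalAtlas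
      chartFinite_mem_maximalAtlas).contMDiffAt hs)).congr_of_eventuallyEq ?_
    filter_upwards [hs] with q hq
    change inv q = inv (chartFinite.symm (chartFinite q))
    rw [chartFinite.left_inv hq]

theorem contMDiff_powMap {b : ℕ} (hb : b ≠ 0) : ContMDiff 𝓘(ℂ) 𝓘(ℂ) ω (powMap b) := by
  have hfin : ∀ p, p ≠ OnePoint.infty → ContMDiffAt 𝓘(ℂ) 𝓘(ℂ) ω (powMap b) p := by
    intro p hp
    have h1 : ContMDiffAt 𝓘(ℂ) 𝓘(ℂ) ω (fun z : ℂ => z ^ b) (coord p) :=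
      (contDiff_id.pow b).contMDiff.contMDiffAt
    refine ((contMDiff_coe _).comp p (h1.comp p (contMDiffAt_coord hp))).congr_of_eventuallyEq ?_
    filter_upwards [chartFinite.open_source.mem_nhds (mem_chartFinite_source.2 hp)] with q hq
    rw [mem_chartFinite_source] at hq
    conv_lhs => rw [← coe_coord hq]
    rfl
  intro p
  by_cases hp : p = OnePoint.infty
  · have h0 : inv p ≠ OnePoint.infty := by
      rw [hp, inv_infty]; exact OnePoint.coe_ne_infty 0
    -- The power map commutes with the inversion, which carries its behaviour at ∞ to that at 0.
    refine ((contMDiff_inv _).comp p ((hfin _ h0).comp p (contMDiff_inv p))).congr_of_eventuallyEq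
      (Eventually.of_forall fun q => ?_)
    change powMap b q = inv (powMap b (inv q))
    rw [← inv_powMap hb, inv_inv]
  · exact hfin p hp

/-- The distance-like function `min(|z|, 1/|z|)` to `{0, ∞}`. -/
def gauge (p : OnePoint ℂ) : ℝ := min ‖coord p‖ ‖coord p‖⁻¹

theorem gauge_nonneg (p : OnePoint ℂ) : 0 ≤ gauge p := by unfold gauge; positivity

end RiemannSphere

/-! ### Local holomorphic retractions onto an embedded line -/

section Retraction

open RiemannSphere

variable {n : ℕ} {X : Type*} [TopologicalSpace X] [ChartedSpace (Cn n) X]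

/-- In charts adapted to an immersion, the line is q ↦ (q, 0), and projection to the first factor is
a retraction. Since ι is a topological embedding, intersecting with the open set `O` excludes the
points of the line coming from outside the chart domain. -/
theorem exists_local_retraction [IsManifold 𝓘(ℂ, Cn n) ω X] {ι : OnePoint ℂ → X}
    (hι : Manifold.IsSmoothEmbedding 𝓘(ℂ) 𝓘(ℂ, Cn n) ω ι) (p : OnePoint ℂ) :
    ∃ U : Set X, IsOpen U ∧ ι p ∈ U ∧ ∃ r : X → OnePoint ℂ,
      ContMDiffOn 𝓘(ℂ, Cn n) 𝓘(ℂ) ω r U ∧ ∀ q, ι q ∈ U → r (ι q) = q := by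
  have h := hι.isImmersion.isImmersionAt p
  obtain ⟨O, hO, hOs⟩ := hι.isEmbedding.isInducing.isOpen_iff.1 h.domChart.open_source
  set π : X → ℂ := fun x => (h.equiv.symm (h.codChart x)).1 with hπ
  have hπs : ContMDiffOn 𝓘(ℂ, Cn n) 𝓘(ℂ) ω π h.codChart.source := by
    have h1 : ContMDiff 𝓘(ℂ, Cn n) 𝓘(ℂ) ω fun v : Cn n => (h.equiv.symm v).1 :=
      ((ContinuousLinearMap.fst ℂ ℂ h.complement).comp
        (h.equiv.symm : Cn n →L[ℂ] ℂ × h.complement)).contDiff.contMDiff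
    exact h1.comp_contMDiffOn (contMDiffOn_of_mem_maximalAtlas h.codChart_mem_maximalAtlas)
  have hπι : ∀ q ∈ h.domChart.source, π (ι q) = h.domChart q := by
    intro q hq
    have hq' : h.domChart q ∈ (h.domChart.extend 𝓘(ℂ)).target := by
      simpa using h.domChart.map_source hq
    have h1 := h.writtenInCharts hq'
    simp only [Function.comp_apply, OpenPartialHomeomorph.extend, mfld_simps,
      h.domChart.left_inv hq] at h1
    simp only [hπ]
    rw [h1]; simp
  refine ⟨O ∩ (h.codChart.source ∩ π ⁻¹' h.domChart.target), hO.inter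
    (hπs.continuousOn.isOpen_inter_preimage h.codChart.open_source h.domChart.open_target), ?_,
    fun x => h.domChart.symm (π x), ?_, ?_⟩
  · have hp := h.mem_domChart_source
    refine ⟨?_, h.mem_codChart_source, ?_⟩
    · rw [← hOs] at hp; exact hp
    · rw [mem_preimage, hπι p hp]; exact h.domChart.map_source hp
  · exact (contMDiffOn_symm_of_mem_maximalAtlas h.domChart_mem_maximalAtlas).comp
      (hπs.mono fun x hx => hx.2.1) fun x hx => hx.2.2
  · rintro q ⟨hqO, -⟩
    have hq : q ∈ h.domChart.source := by rw [← hOs]; exact hqO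
    simp only [hπι q hq, h.domChart.left_inv hq]

variable (n) in
/-- A chart of `X` near a point of the embedded line `range ι`, together with a holomorphic
retraction `r` onto the line. -/
structure RetractionChart (ι : OnePoint ℂ → X) where
  /-- the chart -/
  chart : OpenPartialHomeomorph X (Cn n)
  chart_mem : chart ∈ IsManifold.maximalAtlas 𝓘(ℂ, Cn n) ω X
  /-- the domain of the retraction -/
  dom : Set X
  isOpen_dom : IsOpen dom
  /-- the retraction -/
  r : X → OnePoint ℂ
  dom_subset : dom ⊆ chart.source
  maps_r : ∀ x ∈ dom, ι (r x) ∈ chart.source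
  contMDiffOn_r : ContMDiffOn 𝓘(ℂ, Cn n) 𝓘(ℂ) ω r dom
  r_apply : ∀ q, ι q ∈ dom → r (ι q) = q

/-- The transversal coordinate of a retraction chart: it vanishes exactly on the line. -/
def RetractionChart.w {ι : OnePoint ℂ → X} (c : RetractionChart n ι) (x : X) : Cn n :=
  c.chart x - c.chart (ι (c.r x))

theorem exists_retractionChart [IsManifold 𝓘(ℂ, Cn n) ω X] {ι : OnePoint ℂ → X}
    (hι : Manifold.IsSmoothEmbedding 𝓘(ℂ) 𝓘(ℂ, Cn n) ω ι) (p : OnePoint ℂ) :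
    ∃ c : RetractionChart n ι, ι p ∈ c.dom := by
  obtain ⟨U, hU, hpU, r, hr, hrι⟩ := exists_local_retraction hι p
  set e := chartAt (Cn n) (ι p)
  have hc : ContinuousOn (fun x => ι (r x)) U :=
    hι.isEmbedding.continuous.comp_continuousOn hr.continuousOn
  refine ⟨⟨e, IsManifold.chart_mem_maximalAtlas _, e.source ∩ (U ∩ (fun x => ι (r x)) ⁻¹' e.source),
    e.open_source.inter (hc.isOpen_inter_preimage hU e.open_source), r, inter_subset_left,
    fun x hx => hx.2.2, hr.mono fun x hx => hx.2.1, fun q hq => hrι q hq.2.1⟩,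
    mem_chart_source _ _, hpU, ?_⟩
  change ι (r (ι p)) ∈ e.source
  rw [hrι p hpU]; exact mem_chart_source _ _

namespace RetractionChart

variable {ι : OnePoint ℂ → X} (c : RetractionChart n ι)

theorem w_eq_zero_iff {x : X} (hx : x ∈ c.dom) : c.w x = 0 ↔ x ∈ range ι := by
  constructor
  · intro h
    exact ⟨c.r x, (c.chart.injOn (c.dom_subset hx) (c.maps_r x hx) (sub_eq_zero.1 h)).symm⟩
  · rintro ⟨q, rfl⟩
    simp [w, c.r_apply q hx]

theorem ι_r_of_mem {x : X} (hx : x ∈ c.dom) (hL : x ∈ range ι) : ι (c.r x) = x := by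
  obtain ⟨q, rfl⟩ := hL
  rw [c.r_apply q hx]

theorem continuousAt_ι_r (hι : Continuous ι) {x : X} (hx : x ∈ c.dom) :
    ContinuousAt (fun y => ι (c.r y)) x :=
  hι.continuousAt.comp (c.contMDiffOn_r.continuousOn.continuousAt (c.isOpen_dom.mem_nhds hx))

theorem tendsto_ι_r (hι : Continuous ι) {x : X} (hx : x ∈ c.dom) (hL : x ∈ range ι) :
    Tendsto (fun y => ι (c.r y)) (𝓝 x) (𝓝[range ι] x) := by
  refine tendsto_nhdsWithin_iff.2 ⟨?_, Eventually.of_forall fun y => mem_range_self _⟩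
  have := (c.continuousAt_ι_r hι hx).tendsto
  rwa [c.ι_r_of_mem hx hL] at this

theorem contMDiffAt_chart {x : X} (hx : x ∈ c.chart.source) :
    ContMDiffAt 𝓘(ℂ, Cn n) 𝓘(ℂ, Cn n) ω c.chart x :=
  (contMDiffOn_of_mem_maximalAtlas c.chart_mem).contMDiffAt (c.chart.open_source.mem_nhds hx)

theorem contMDiffAt_chart_symm {v : Cn n} (hv : v ∈ c.chart.target) :
    ContMDiffAt 𝓘(ℂ, Cn n) 𝓘(ℂ, Cn n) ω c.chart.symm v :=
  (contMDiffOn_symm_of_mem_maximalAtlas c.chart_mem).contMDiffAt (c.chart.open_target.mem_nhds hv)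

theorem contMDiffAt_r {x : X} (hx : x ∈ c.dom) : ContMDiffAt 𝓘(ℂ, Cn n) 𝓘(ℂ) ω c.r x :=
  c.contMDiffOn_r.contMDiffAt (c.isOpen_dom.mem_nhds hx)

theorem contMDiffAt_w (hι : ContMDiff 𝓘(ℂ) 𝓘(ℂ, Cn n) ω ι) {x : X} (hx : x ∈ c.dom) :
    ContMDiffAt 𝓘(ℂ, Cn n) 𝓘(ℂ, Cn n) ω c.w x :=
  (c.contMDiffAt_chart (c.dom_subset hx)).sub
    ((c.contMDiffAt_chart (c.maps_r x hx)).comp x ((hι _).comp x (c.contMDiffAt_r hx)))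

/-- A holomorphic function, read in the chart, is holomorphic. -/
theorem contDiffAt_comp_symm {F : Type*} [NormedAddCommGroup F] [NormedSpace ℂ F] {g : X → F}
    {x : X} (hg : ContMDiffAt 𝓘(ℂ, Cn n) 𝓘(ℂ, F) ω g x) (hx : x ∈ c.chart.source) :
    ContDiffAt ℂ ω (g ∘ c.chart.symm) (c.chart x) := by
  rw [← contMDiffAt_iff_contDiffAt]
  refine ContMDiffAt.comp _ ?_ (c.contMDiffAt_chart_symm (c.chart.map_source hx))
  rwa [c.chart.left_inv hx]

/-- A holomorphic function vanishing along the line is dominated by the transversal coordinate. -/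
theorem isBigO_w (hι : Continuous ι) {F : Type*} [NormedAddCommGroup F] [NormedSpace ℂ F]
    {g : X → F} {x : X} (hx : x ∈ c.dom) (hL : x ∈ range ι)
    (hg : ContMDiffAt 𝓘(ℂ, Cn n) 𝓘(ℂ, F) ω g x) (h0 : ∀ᶠ y in 𝓝[range ι] x, g y = 0) :
    g =O[𝓝 x] c.w := by
  have hxs := c.dom_subset hx
  -- `g` vanishes at the foot ι(r y) of y, and `c.w y` is the chart displacement from the foot to y,
  -- so a Lipschitz constant for `g` in the chart is enough.
  obtain ⟨K, s, hs, hK⟩ := ((c.contDiffAt_comp_symm hg hxs).of_le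
    (by simp : (1 : WithTop ℕ∞) ≤ ω)).exists_lipschitzOnWith
  have hce : ContinuousAt c.chart x := c.chart.continuousAt hxs
  have ht := c.tendsto_ι_r hι hx hL
  have h1 : ∀ᶠ y in 𝓝 x, c.chart y ∈ s := hce.preimage_mem_nhds hs
  have h2 : ∀ᶠ y in 𝓝 x, c.chart (ι (c.r y)) ∈ s :=
    (tendsto_nhdsWithin_iff.1 ht).1.eventually h1
  refine Asymptotics.IsBigO.of_bound K ?_
  filter_upwards [h1, h2, ht.eventually h0, c.isOpen_dom.mem_nhds hx] with y hy1 hy2 hy3 hy4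
  have := hK.norm_sub_le hy1 hy2
  simpa [Function.comp, c.chart.left_inv (c.dom_subset hy4), c.chart.left_inv (c.maps_r y hy4),
    hy3, w] using this

end RetractionChart

end Retraction

/-! ### Local estimates of f in terms of the transversal coordinate -/

section LocalEstimates

open RiemannSphere Metric

variable {n : ℕ} {X : Type*} [TopologicalSpace X] [ChartedSpace (Cn n) X]
  {ι : OnePoint ℂ → X}

namespace RetractionChart

variable (c : RetractionChart n ι)

/-- If a holomorphic function vanishes to order at least `a` along the line, it is dominated by the
`a`-th power of the transversal coordinate. -/
theorem isBigO_norm_w_pow [IsManifold 𝓘(ℂ, Cn n) ω X] (hι : Continuous ι) {a : ℕ} (ha : a ≠ 0)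
    {g : X → ℂ} {x : X} (hx : x ∈ c.dom) (hL : x ∈ range ι)
    (hg : ContMDiffAt 𝓘(ℂ, Cn n) 𝓘(ℂ) ω g x) (h0 : ∀ᶠ y in 𝓝[range ι] x, g y = 0)
    (hv : VanishesToOrderAlong n g (range ι) a x) :
    g =O[𝓝 x] fun y => ‖c.w y‖ ^ a := by
  have hxs := c.dom_subset hx
  set G := g ∘ c.chart.symm with hG
  have hGx := c.contDiffAt_comp_symm hg hxs
  have hce : ContinuousAt c.chart x := c.chart.continuousAt hxs
  have hd : ∀ᶠ v in 𝓝 (c.chart x), DifferentiableAt ℂ G v ∧ ‖G v‖ < ‖G (c.chart x)‖ + 1 := by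
    refine Eventually.and ?_ (hGx.continuousAt.norm.eventually_lt_const (lt_add_one _))
    filter_upwards [(show AnalyticAt ℂ G (c.chart x) from hGx.analyticAt).eventually_analyticAt]
      with v hv
      using hv.differentiableAt
  obtain ⟨δ', hδ', hδ⟩ := Metric.eventually_nhds_iff_ball.1 hd
  set M := ‖G (c.chart x)‖ + 1
  set δ := δ' / 2 with hδδ
  have hδ0 : 0 < δ := by positivity
  have ht := c.tendsto_ι_r hι hx hL
  have ht' := (tendsto_nhdsWithin_iff.1 ht).1
  have h1 : ∀ᶠ y in 𝓝 x, c.chart y ∈ ball (c.chart x) δ :=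
    hce.preimage_mem_nhds (ball_mem_nhds _ hδ0)
  have hwc : ∀ᶠ y in 𝓝 x, ‖c.w y‖ < δ := by
    have hcr : ContinuousAt c.w x := by
      refine hce.sub (ContinuousAt.comp (g := c.chart) ?_ (c.continuousAt_ι_r hι hx))
      exact c.chart.continuousAt (c.maps_r x hx)
    have : ‖c.w x‖ < δ := by rw [(c.w_eq_zero_iff hx).2 hL, norm_zero]; exact hδ0
    exact hcr.norm.eventually_lt_const this
  have h3 : ∀ᶠ y in 𝓝 x, y ∈ (chartAt (Cn n) x).source :=
    (chartAt (Cn n) x).open_source.mem_nhds (mem_chart_source _ x)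
  refine Asymptotics.IsBigO.of_bound (M / δ ^ a) ?_
  filter_upwards [ht'.eventually h1, hwc, ht.eventually h0, ht.eventually hv, ht'.eventually h3,
    c.isOpen_dom.mem_nhds hx] with y hy1 hy2 hy3 hy4 hy5 hy6
  -- The Schwarz lemma of order `a` is applied around the foot of each y, on a ball of fixed radius
  -- δ with fixed bound M. Vanishing at all points of the line near x, and not only at x, is what
  -- makes the resulting constant independent of y.
  set y' := c.chart (ι (c.r y)) with hy'
  have hys := c.maps_r y hy6
  have hsub : ball y' δ ⊆ ball (c.chart x) δ' := ball_subset_ball' (by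
    have := mem_ball.1 hy1
    linarith)
  have hGy' : G y' = 0 := by simp [hG, hy', c.chart.left_inv hys, hy3]
  have hGy : G (c.chart y) = g y := by simp [hG, c.chart.left_inv (c.dom_subset hy6)]
  have hmem : c.chart y ∈ ball y' δ := by rw [mem_ball, dist_eq_norm]; exact hy2
  have hsymm : Tendsto c.chart.symm (𝓝 y') (𝓝 (ι (c.r y))) := by
    have := (c.chart.continuousAt_symm (c.chart.map_source hys)).tendsto
    rwa [c.chart.left_inv hys] at this
  -- The order of vanishing is measured in the preferred chart at `x`; differentiability of the
  -- transition map transfers it to `c.chart`.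
  have hO : G =O[𝓝 y'] fun v => ‖v - y'‖ ^ a := by
    refine (hy4.comp_tendsto hsymm).trans ?_
    refine Asymptotics.IsBigO.pow ?_ a
    refine Asymptotics.IsBigO.norm_norm ?_
    have hdiff : DifferentiableAt ℂ (chartAt (Cn n) x ∘ c.chart.symm) y' := by
      refine (c.contDiffAt_comp_symm ?_ hys).differentiableAt (by simp)
      exact (contMDiffOn_of_mem_maximalAtlas (IsManifold.chart_mem_maximalAtlas x)).contMDiffAt
        ((chartAt (Cn n) x).open_source.mem_nhds hy5)
    have := hdiff.isBigO_sub
    simpa [Function.comp_def, hy', c.chart.left_inv hys] using this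
  obtain ⟨k, rfl⟩ := Nat.exists_eq_succ_of_ne_zero ha
  have key := Complex.dist_le_mul_div_pow_of_mapsTo_ball_of_isLittleO (f := G) (c := y')
    (z := c.chart y) (R₁ := δ) (R₂ := M) (n := k)
    (fun v hv => (hδ v (hsub hv)).1.differentiableWithinAt) (fun v hv => ?_) ?_ hmem
  · rw [hGy, hGy', dist_zero_right, dist_eq_norm] at key
    refine key.trans (le_of_eq ?_)
    rw [div_pow, norm_pow, norm_norm]
    simp only [w, hy', Nat.succ_eq_add_one]; ring
  · rw [mem_closedBall, hGy', dist_zero_right]; exact (hδ v (hsub hv)).2.le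
  · simp only [hGy', sub_zero]
    refine hO.trans_isLittleO ?_
    have h5 : Tendsto (fun v => ‖v - y'‖) (𝓝 y') (𝓝 0) := by
      have : Continuous fun v => ‖v - y'‖ := by fun_prop
      simpa using this.tendsto y'
    exact (Asymptotics.isLittleO_pow_pow (Nat.lt_succ_self k)).comp_tendsto h5

/-- Superattraction concerns scalar functions vanishing on the line; it is applied to the components
of the transversal coordinate. This is the source of the bound D ∘ f ≤ C D^a. -/
theorem isBigO_w_comp [IsManifold 𝓘(ℂ, Cn n) ω X] (c' : RetractionChart n ι)
    (hι : ContMDiff 𝓘(ℂ) 𝓘(ℂ, Cn n) ω ι) {a : ℕ} (ha : a ≠ 0) {f : X → X}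
    (hfL : MapsTo f (range ι) (range ι)) {x : X}
    (hf : ContMDiffAt 𝓘(ℂ, Cn n) 𝓘(ℂ, Cn n) ω f x)
    (htrans : IsTransversallySuperattracting n f (range ι) a)
    (hx : x ∈ c.dom) (hL : x ∈ range ι) (hfx : f x ∈ c'.dom) :
    (c'.w ∘ f) =O[𝓝 x] fun y => ‖c.w y‖ ^ a := by
  have hfL' : Tendsto f (𝓝[range ι] x) (𝓝[range ι] (f x)) :=
    hf.continuousAt.continuousWithinAt.tendsto_nhdsWithin hfL
  have hw0 : ∀ᶠ y in 𝓝[range ι] (f x), c'.w y = 0 := by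
    filter_upwards [mem_nhdsWithin_of_mem_nhds (c'.isOpen_dom.mem_nhds hfx), self_mem_nhdsWithin]
      with y hy hyL using (c'.w_eq_zero_iff hy).2 hyL
  have hcomp : ∀ i : Fin n, (fun y => c'.w (f y) i) =O[𝓝 x] fun y => ‖c.w y‖ ^ a := by
    intro i
    have hχ : ContMDiffAt 𝓘(ℂ, Cn n) 𝓘(ℂ) ω (fun y => c'.w y i) (f x) :=
      ((EuclideanSpace.proj i : Cn n →L[ℂ] ℂ).contDiff.contMDiff.contMDiffAt).comp (f x)
        (c'.contMDiffAt_w hι hfx)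
    have hχ0 : ∀ᶠ y in 𝓝[range ι] (f x), c'.w y i = 0 := by
      filter_upwards [hw0] with y hy
      rw [hy]; rfl
    exact c.isBigO_norm_w_pow hι.continuous ha hx hL (hχ.comp x hf) (hfL'.eventually hχ0)
      (htrans (f x) (hfL hL) _ hχ hχ0 x hL rfl)
  have h2 : (fun y => WithLp.ofLp (c'.w (f y))) =O[𝓝 x] fun y => ‖c.w y‖ ^ a :=
    Asymptotics.isBigO_pi.2 hcomp
  exact ((EuclideanSpace.equiv (Fin n) ℂ).symm : (Fin n → ℂ) →L[ℂ] Cn n).isBigO_comp _ _ |>.trans h2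

/-- Two holomorphic maps to the Riemann sphere which agree along the line are close to each
other in the cone where the transversal coordinate is small compared with the gauge. -/
theorem exists_norm_coord_div_sub_one_le (hι : Continuous ι) {r r' : X → OnePoint ℂ} {x : X}
    (hx : x ∈ c.dom) (hL : x ∈ range ι)
    (hr : ContMDiffAt 𝓘(ℂ, Cn n) 𝓘(ℂ) ω r x) (hr' : ContMDiffAt 𝓘(ℂ, Cn n) 𝓘(ℂ) ω r' x)
    (h : ∀ᶠ y in 𝓝[range ι] x, r' y = r y) :
    ∃ C : ℝ, 0 < C ∧ ∀ᶠ y in 𝓝 x, 0 < gauge (r y) → C * ‖c.w y‖ ≤ gauge (r y) →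
      ‖coord (r' y) / coord (r y) - 1‖ ≤ C * ‖c.w y‖ / gauge (r y) := by
  have hxx : r' x = r x := h.self_of_nhdsWithin hL
  have hpos : ∀ y, 0 < gauge (r y) → coord (r y) ≠ 0 := fun y hy h0 => by
    simp [RiemannSphere.gauge, h0] at hy
  -- At ∞ the comparison is made for 1/z. The smallness hypothesis keeps the ratio of the inverted
  -- coordinates at least 1/2 in modulus, so the estimate can be inverted at the cost of a factor 2.
  by_cases hinf : r x = OnePoint.infty
  · have hne : inv (r x) ≠ OnePoint.infty := by
      rw [hinf, inv_infty]; exact OnePoint.coe_ne_infty 0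
    have h1 : ContMDiffAt 𝓘(ℂ, Cn n) 𝓘(ℂ) ω (fun y => coord (inv (r y))) x :=
      (contMDiffAt_coord hne).comp x ((RiemannSphere.contMDiff_inv _).comp x hr)
    have h2 : ContMDiffAt 𝓘(ℂ, Cn n) 𝓘(ℂ) ω (fun y => coord (inv (r' y))) x :=
      (contMDiffAt_coord (hxx ▸ hne)).comp x ((RiemannSphere.contMDiff_inv _).comp x hr')
    obtain ⟨K, hK⟩ := (c.isBigO_w hι hx hL (h2.sub h1) (by
      filter_upwards [h] with y hy
      simp [hy])).bound
    refine ⟨2 * (|K| + 1), by positivity, ?_⟩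
    filter_upwards [hK] with y hy hg hC
    have hz := hpos y hg
    simp only [coord_inv] at hy
    have hgi : gauge (r y) ≤ ‖coord (r y)‖⁻¹ := min_le_right _ _
    set z := coord (r y)
    set z' := coord (r' y)
    have hzn : 0 < ‖z‖ := norm_pos_iff.2 hz
    set s := ‖z'⁻¹ / z⁻¹ - 1‖ with hs
    have hs1 : s ≤ (|K| + 1) * ‖c.w y‖ / gauge (r y) := by
      have : z'⁻¹ / z⁻¹ - 1 = (z'⁻¹ - z⁻¹) * z := by field_simp
      rw [hs, this, norm_mul, le_div_iff₀ hg]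
      have hgz : ‖z‖ * gauge (r y) ≤ 1 := by
        calc ‖z‖ * gauge (r y) ≤ ‖z‖ * ‖z‖⁻¹ := by gcongr
          _ = 1 := mul_inv_cancel₀ hzn.ne'
      calc ‖z'⁻¹ - z⁻¹‖ * ‖z‖ * gauge (r y) = ‖z'⁻¹ - z⁻¹‖ * (‖z‖ * gauge (r y)) := by ring
        _ ≤ ‖z'⁻¹ - z⁻¹‖ * 1 := by gcongr
        _ ≤ (|K| + 1) * ‖c.w y‖ := by
          rw [mul_one]; refine hy.trans ?_
          gcongr; linarith [le_abs_self K]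
    have hs2 : (|K| + 1) * ‖c.w y‖ / gauge (r y) ≤ 1 / 2 := by
      rw [div_le_iff₀ hg]; linarith
    have hz' : z' ≠ 0 := by
      intro h0
      rw [h0] at hs
      simp at hs
      linarith
    have hratio : 1 / 2 ≤ ‖z'⁻¹ / z⁻¹‖ := by
      have := norm_sub_norm_le (1 : ℂ) (1 - z'⁻¹ / z⁻¹)
      rw [norm_sub_rev 1 (z'⁻¹ / z⁻¹), sub_sub_cancel, norm_one] at this
      linarith
    have e : z' / z - 1 = -(z'⁻¹ / z⁻¹ - 1) / (z'⁻¹ / z⁻¹) := by field_simp; ring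
    rw [e, norm_div, norm_neg, ← hs]
    calc s / ‖z'⁻¹ / z⁻¹‖ ≤ s / (1 / 2) := by gcongr
      _ = 2 * s := by ring
      _ ≤ 2 * ((|K| + 1) * ‖c.w y‖ / gauge (r y)) := by gcongr
      _ = _ := by ring
  · have h1 : ContMDiffAt 𝓘(ℂ, Cn n) 𝓘(ℂ) ω (fun y => coord (r y)) x :=
      (contMDiffAt_coord hinf).comp x hr
    have h2 : ContMDiffAt 𝓘(ℂ, Cn n) 𝓘(ℂ) ω (fun y => coord (r' y)) x :=
      (contMDiffAt_coord (hxx ▸ hinf)).comp x hr'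
    obtain ⟨K, hK⟩ := (c.isBigO_w hι hx hL (h2.sub h1) (by
      filter_upwards [h] with y hy
      simp [hy])).bound
    refine ⟨|K| + 1, by positivity, ?_⟩
    filter_upwards [hK] with y hy hg hC
    have hz := hpos y hg
    have hgi : gauge (r y) ≤ ‖coord (r y)‖ := min_le_left _ _
    have : coord (r' y) / coord (r y) - 1 = (coord (r' y) - coord (r y)) / coord (r y) := by
      field_simp
    rw [this, norm_div]
    calc ‖coord (r' y) - coord (r y)‖ / ‖coord (r y)‖
        ≤ ((|K| + 1) * ‖c.w y‖) / gauge (r y) := by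
          gcongr
          refine hy.trans ?_
          gcongr; linarith [le_abs_self K]
      _ = _ := rfl

end RetractionChart

end LocalEstimates

/-! ### The Böttcher coordinate of a cone around an invariant line -/

section Cone

open Metric

/-- A point `x` is described by an approximate coordinate `Z x = ζ (sel x) x` on the line and its
approximate distance `D x` from the line, up to errors controlled by `D x / gauge x`. In the chart
`e (sel x)` the coordinate `ζ (sel x)` is holomorphic. -/
structure ConeData {X E J : Type*} [TopologicalSpace X] [NormedAddCommGroup E] [NormedSpace ℂ E]
    (f : X → X) (a b : ℕ) (e : J → OpenPartialHomeomorph X E) (ζ : J → X → ℂ) (sel : X → J)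
    (D : X → ℝ) (Z : X → ℂ) (m : X → ℝ) (N : Set X) (C : ℝ) : Prop where
  two_le_b : 2 ≤ b
  b_le_a : b ≤ a
  two_le_C : 2 ≤ C
  m_eq : ∀ x, m x = min ‖Z x‖ ‖Z x‖⁻¹
  maps : MapsTo f N N
  D_nonneg : ∀ x, 0 ≤ D x
  D_comp_le : ∀ x ∈ N, D (f x) ≤ C * D x ^ a
  mem_source : ∀ x ∈ N, x ∈ (e (sel x)).source
  ball_subset : ∀ q ∈ N, ball (e (sel q) q) (1 / C) ⊆ (e (sel q)).target
  ratio : ∀ x ∈ N, 0 < m x → C * D x ≤ m x ^ b → ‖Z (f x) / Z x ^ b - 1‖ ≤ C * D x / m x ^ b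
  ratio_chart : ∀ q ∈ N, ∀ x ∈ (e (sel q)).source, ‖e (sel q) x - e (sel q) q‖ < 1 / C → x ∈ N →
    0 < m x → C * D x ≤ m x → ‖ζ (sel q) x / Z x - 1‖ ≤ C * D x / m x
  lipschitz : ∀ q ∈ N, ∀ x ∈ (e (sel q)).source, ‖e (sel q) x - e (sel q) q‖ < 1 / C →
    f x ∈ (e (sel (f q))).source ∧
    ‖e (sel (f q)) (f x) - e (sel (f q)) (f q)‖ ≤ C * ‖e (sel q) x - e (sel q) q‖
  holo : ∀ q ∈ N, ∀ x ∈ (e (sel q)).source, ‖e (sel q) x - e (sel q) q‖ < 1 / C →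
    DifferentiableAt ℂ (fun v => e (sel (f q)) (f ((e (sel q)).symm v))) (e (sel q) x)
  holo_coord : ∀ q ∈ N, ∀ x ∈ (e (sel q)).source, ‖e (sel q) x - e (sel q) q‖ < 1 / C →
    ζ (sel q) x ≠ 0 → DifferentiableAt ℂ (fun v => ζ (sel q) ((e (sel q)).symm v)) (e (sel q) x)

theorem norm_log_le_of_norm_sub_one_le {z : ℂ} {t : ℝ} (h : ‖z - 1‖ ≤ t) (ht : t ≤ 1 / 2) :
    ‖Complex.log z‖ ≤ 2 * t := by
  have h1 := Complex.norm_log_one_add_half_le_self (z := z - 1) (h.trans ht)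
  rw [add_sub_cancel] at h1
  linarith [norm_nonneg (z - 1)]

theorem ne_zero_of_norm_sub_one_le {z : ℂ} {t : ℝ} (h : ‖z - 1‖ ≤ t) (ht : t ≤ 1 / 2) : z ≠ 0 := by
  rintro rfl
  simp at h
  linarith

theorem exp_mem_slitPlane_of_norm_le_one {w : ℂ} (h : ‖w‖ ≤ 1) :
    Complex.exp w ∈ Complex.slitPlane ∧ Complex.log (Complex.exp w) = w := by
  have h1 := abs_le.1 ((Complex.abs_im_le_norm w).trans h)
  have hπ := Real.pi_gt_three
  have hlog : Complex.log (Complex.exp w) = w := Complex.log_exp (by linarith) (by linarith)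
  refine ⟨?_, hlog⟩
  rw [Complex.mem_slitPlane_iff_arg, ← Complex.log_im, hlog]
  exact ⟨by linarith, Complex.exp_ne_zero w⟩

namespace ConeData

variable {X E J : Type*} [TopologicalSpace X] [NormedAddCommGroup E] [NormedSpace ℂ E]
  {f : X → X} {a b : ℕ} {e : J → OpenPartialHomeomorph X E} {ζ : J → X → ℂ} {sel : X → J}
  {D : X → ℝ} {Z : X → ℂ} {m : X → ℝ} {N : Set X} {C : ℝ}

/-- The aperture of the invariant cone. -/
def aperture (b : ℕ) (C : ℝ) : ℝ := 1 / (C ^ 5 * 2 ^ b * ((b + 2) * 2))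

/-- The invariant cone. -/
def cone (b : ℕ) (D m : X → ℝ) (N : Set X) (C : ℝ) : Set X :=
  {x | x ∈ N ∧ 0 < m x ∧ D x < aperture b C * m x ^ b}

theorem m_pow_pos {X : Type*} {b : ℕ} {D m : X → ℝ} {N : Set X} {C : ℝ} {x : X}
    (hx : x ∈ cone b D m N C) : 0 < m x ^ b := pow_pos hx.2.1 b

theorem slope_lt {X : Type*} {b : ℕ} {D m : X → ℝ} {N : Set X} {C : ℝ} {x : X}
    (hx : x ∈ cone b D m N C) : D x / m x ^ b < aperture b C := by
  rw [div_lt_iff₀ (m_pow_pos hx)]; exact hx.2.2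

/-- The logarithm of the error of the approximate coordinate. -/
def logError (f : X → X) (b : ℕ) (Z : X → ℂ) (x : X) : ℂ := Complex.log (Z (f x) / Z x ^ b)

/-- The logarithmic correction turning the approximate coordinate into the Böttcher coordinate. -/
def correction (f : X → X) (b : ℕ) (Z : X → ℂ) (x : X) : ℂ :=
  ∑' k : ℕ, logError f b Z (f^[k] x) / (b : ℂ) ^ (k + 1)

/-- The Böttcher coordinate. -/
def bottcher (f : X → X) (b : ℕ) (Z : X → ℂ) (x : X) : ℂ := Z x * Complex.exp (correction f b Z x)

variable (h : ConeData f a b e ζ sel D Z m N C)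
include h

theorem C_pos : 0 < C := by linarith [h.two_le_C]

theorem aperture_pos : 0 < aperture b C := by
  have := h.C_pos
  unfold aperture; positivity

theorem m_le_one (x : X) : m x ≤ 1 := by
  rw [h.m_eq]
  by_cases h1 : ‖Z x‖ ≤ 1
  · exact (min_le_left _ _).trans h1
  · exact (min_le_right _ _).trans (inv_le_one_of_one_le₀ (not_le.1 h1).le)

/-- Keeps logarithms on the principal branch: in `differentiableAt_bottcher` the logarithmic errors
add up to at most b + 2 quantities, each bounded by 2 C times the aperture. -/
theorem aperture_mul_le : (b + 2) * 2 * (C * aperture b C) ≤ 1 / C ^ 4 := by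
  have hC := h.C_pos
  have : (b + 2) * 2 * (C * aperture b C) = 1 / C ^ 4 * (1 / 2 ^ b) := by
    unfold aperture; field_simp
  rw [this]
  refine mul_le_of_le_one_right (by positivity) ?_
  rw [div_le_one (by positivity)]
  exact one_le_pow₀ one_le_two

theorem C_pow_four : 1 / C ^ 4 ≤ 1 / 16 := by
  have : (2 : ℝ) ^ 4 ≤ C ^ 4 := pow_le_pow_left₀ (by norm_num) h.two_le_C 4
  exact one_div_le_one_div_of_le (by norm_num) (by linarith)

theorem C_mul_aperture_le : C * aperture b C ≤ 1 / 128 := by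
  have h1 := h.aperture_mul_le
  have h2 := h.C_pow_four
  have h3 : 0 < C * aperture b C := mul_pos h.C_pos h.aperture_pos
  have h4 : (2 : ℝ) ≤ b := by exact_mod_cast h.two_le_b
  nlinarith

/-- This is the contraction factor of the slope. The exponent 4 is chosen to exceed the cube of the
rate C at which the domains of the local models shrink. -/
theorem contraction_const : C * 2 ^ b * aperture b C ≤ 1 / C ^ 4 := by
  have hC := h.C_pos
  have : C * 2 ^ b * aperture b C = 1 / C ^ 4 * (1 / ((b + 2) * 2)) := by
    unfold aperture; field_simp
  rw [this]
  refine mul_le_of_le_one_right (by positivity) ?_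
  rw [div_le_one (by positivity)]
  have : (0 : ℝ) ≤ b := by positivity
  linarith

theorem Z_ne_zero {x : X} (hx : x ∈ cone b D m N C) : Z x ≠ 0 := fun h0 => by
  have := hx.2.1
  rw [h.m_eq, h0] at this
  simp at this

theorem slope_nonneg (x : X) : 0 ≤ D x / m x ^ b := by
  have h1 : 0 ≤ m x := by rw [h.m_eq]; positivity
  exact div_nonneg (h.D_nonneg x) (by positivity)

theorem C_mul_slope_le {x : X} (hx : x ∈ cone b D m N C) :
    C * (D x / m x ^ b) ≤ C * aperture b C := by
  have := h.C_pos
  have := slope_lt hx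
  gcongr

theorem ratio_le {x : X} (hx : x ∈ cone b D m N C) :
    ‖Z (f x) / Z x ^ b - 1‖ ≤ C * (D x / m x ^ b) := by
  rw [← mul_div_assoc]
  refine h.ratio x hx.1 hx.2.1 ?_
  have h1 := h.C_mul_slope_le hx
  have h2 := h.C_mul_aperture_le
  rw [← mul_div_assoc, div_le_iff₀ (m_pow_pos hx)] at h1
  have h3 := m_pow_pos hx
  nlinarith

theorem le_half {x : X} (hx : x ∈ cone b D m N C) : C * (D x / m x ^ b) ≤ 1 / 2 := by
  linarith [h.C_mul_slope_le hx, h.C_mul_aperture_le]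

/-- Z(f x) is Z(x)^b times a factor of modulus between 1/2 and 2, which bounds both |Z(f x)| and its
inverse from below. -/
theorem m_comp_ge {x : X} (hx : x ∈ cone b D m N C) : m x ^ b / 2 ≤ m (f x) := by
  have h1 := h.ratio_le hx
  have h2 := h.le_half hx
  have hz := h.Z_ne_zero hx
  have hzn : 0 < ‖Z x‖ := norm_pos_iff.2 hz
  set q := Z (f x) / Z x ^ b with hq
  have hfx : Z (f x) = q * Z x ^ b := by rw [hq]; field_simp
  have hq1 : 1 / 2 ≤ ‖q‖ := by
    have := norm_sub_norm_le (1 : ℂ) (1 - q)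
    rw [norm_sub_rev 1 q, sub_sub_cancel, norm_one] at this
    linarith
  have hq2 : ‖q‖ ≤ 2 := by
    have := norm_sub_norm_le q 1
    rw [norm_one] at this
    linarith
  have hm0 : 0 ≤ m x := hx.2.1.le
  have hm1 : m x ≤ ‖Z x‖ := by rw [h.m_eq]; exact min_le_left _ _
  have hm2 : m x ≤ ‖Z x‖⁻¹ := by rw [h.m_eq]; exact min_le_right _ _
  rw [h.m_eq (f x), hfx, norm_mul, norm_pow]
  refine le_min ?_ ?_
  · calc m x ^ b / 2 = 1 / 2 * m x ^ b := by ring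
      _ ≤ ‖q‖ * ‖Z x‖ ^ b := by gcongr
  · rw [mul_inv, ← inv_pow]
    calc m x ^ b / 2 = 2⁻¹ * m x ^ b := by ring
      _ ≤ ‖q‖⁻¹ * ‖Z x‖⁻¹ ^ b := by gcongr

/-- The hypothesis b ≤ a is decisive here. With D = s m^b, one has D(f x) ≤ C s^a (m^b)^a ≤ C s²
(m^b)^b, whereas m(f x)^b ≥ (m^b)^b / 2^b. The new slope is thus at most C 2^b s², quadratic in the
old one and so a contraction on a narrow cone. -/
theorem slope_comp_le {x : X} (hx : x ∈ cone b D m N C) :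
    D (f x) / m (f x) ^ b ≤ 1 / C ^ 4 * (D x / m x ^ b) := by
  have hC := h.C_pos
  have hmp := m_pow_pos hx
  have hm := h.m_comp_ge hx
  set s := D x / m x ^ b with hs
  have hs0 : 0 ≤ s := h.slope_nonneg x
  have hs1 := slope_lt hx
  have hap1 : aperture b C ≤ 1 := by
    have := h.C_mul_aperture_le
    have := h.two_le_C
    have := h.aperture_pos
    nlinarith
  have hD : D x = s * m x ^ b := by rw [hs]; field_simp
  have h1 : D (f x) ≤ C * (s ^ 2 * (m x ^ b) ^ b) := by
    refine (h.D_comp_le x hx.1).trans ?_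
    rw [hD, mul_pow]
    have e1 : s ^ a ≤ s ^ 2 :=
      pow_le_pow_of_le_one hs0 (hs1.le.trans hap1) (h.two_le_b.trans h.b_le_a)
    have e2 : (m x ^ b) ^ a ≤ (m x ^ b) ^ b :=
      pow_le_pow_of_le_one hmp.le (pow_le_one₀ hx.2.1.le (h.m_le_one x)) h.b_le_a
    gcongr
  have hmf : 0 < m (f x) := lt_of_lt_of_le (by positivity) hm
  have h2 : (m x ^ b) ^ b ≤ 2 ^ b * m (f x) ^ b := by
    rw [← mul_pow]; gcongr; linarith
  rw [div_le_iff₀ (by positivity)]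
  calc D (f x) ≤ C * (s ^ 2 * (m x ^ b) ^ b) := h1
    _ ≤ C * (s ^ 2 * (2 ^ b * m (f x) ^ b)) := by gcongr
    _ = (C * 2 ^ b * s) * s * m (f x) ^ b := by ring
    _ ≤ (C * 2 ^ b * aperture b C) * s * m (f x) ^ b := by gcongr
    _ ≤ 1 / C ^ 4 * s * m (f x) ^ b := by
      have := h.contraction_const
      gcongr

theorem mapsTo_cone : MapsTo f (cone b D m N C) (cone b D m N C) := by
  intro x hx
  have hmf : 0 < m (f x) :=
    lt_of_lt_of_le (by have := m_pow_pos hx; positivity) (h.m_comp_ge hx)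
  refine ⟨h.maps hx.1, hmf, ?_⟩
  rw [← div_lt_iff₀ (pow_pos hmf b)]
  refine lt_of_le_of_lt (h.slope_comp_le hx) (lt_of_le_of_lt ?_ (slope_lt hx))
  refine mul_le_of_le_one_left (h.slope_nonneg x) ?_
  linarith [h.C_pow_four]

theorem iterate_mem_cone {x : X} (hx : x ∈ cone b D m N C) (k : ℕ) :
    f^[k] x ∈ cone b D m N C := h.mapsTo_cone.iterate k hx

theorem D_comp_le_half {x : X} (hx : x ∈ cone b D m N C) : D (f x) ≤ D x / 2 := by
  have hC := h.C_pos
  have hD0 := h.D_nonneg x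
  have hm1 : m x ^ b ≤ 1 := pow_le_one₀ hx.2.1.le (h.m_le_one x)
  have hap := h.aperture_pos
  have hca := h.C_mul_aperture_le
  have hDa : D x ≤ aperture b C := hx.2.2.le.trans (mul_le_of_le_one_right hap.le hm1)
  have hD1 : D x ≤ 1 := by nlinarith [h.two_le_C]
  calc D (f x) ≤ C * D x ^ a := h.D_comp_le x hx.1
    _ ≤ C * D x ^ 2 := by
      gcongr C * ?_
      exact pow_le_pow_of_le_one hD0 hD1 (h.two_le_b.trans h.b_le_a)
    _ = C * D x * D x := by ring
    _ ≤ C * aperture b C * D x := by gcongr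
    _ ≤ 1 / 128 * D x := by gcongr
    _ ≤ D x / 2 := by linarith

theorem slope_iterate_le {x : X} (hx : x ∈ cone b D m N C) (k : ℕ) :
    D (f^[k] x) / m (f^[k] x) ^ b ≤ (1 / C ^ 4) ^ k * (D x / m x ^ b) := by
  have hC := h.C_pos
  induction k with
  | zero => simp
  | succ k ih =>
    rw [Function.iterate_succ_apply']
    refine (h.slope_comp_le (h.iterate_mem_cone hx k)).trans ?_
    rw [pow_succ' (1 / C ^ 4) k, mul_assoc]
    gcongr

theorem slope_iterate_le' {x : X} (hx : x ∈ cone b D m N C) (k : ℕ) :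
    D (f^[k] x) / m (f^[k] x) ^ b ≤ D x / m x ^ b := by
  have hC := h.C_pos
  refine (h.slope_iterate_le hx k).trans (mul_le_of_le_one_left (h.slope_nonneg x) ?_)
  exact pow_le_one₀ (by positivity) (by linarith [h.C_pow_four])

theorem exp_logError {x : X} (hx : x ∈ cone b D m N C) :
    Complex.exp (logError f b Z x) = Z (f x) / Z x ^ b :=
  Complex.exp_log (ne_zero_of_norm_sub_one_le (h.ratio_le hx) (h.le_half hx))

theorem norm_logError_le {x : X} (hx : x ∈ cone b D m N C) :
    ‖logError f b Z x‖ ≤ 2 * C * (D x / m x ^ b) := by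
  rw [mul_assoc]
  exact norm_log_le_of_norm_sub_one_le (h.ratio_le hx) (h.le_half hx)

theorem norm_term_le {x : X} (hx : x ∈ cone b D m N C) (k : ℕ) :
    ‖logError f b Z (f^[k] x) / (b : ℂ) ^ (k + 1)‖ ≤
      C * (D x / m x ^ b) * (1 / 2) ^ k := by
  have hC := h.C_pos
  have hb : (2 : ℝ) ≤ b := by exact_mod_cast h.two_le_b
  rw [norm_div, norm_pow, Complex.norm_natCast, div_le_iff₀ (by positivity)]
  have h1 := h.norm_logError_le (h.iterate_mem_cone hx k)
  have h2 := h.slope_iterate_le' hx k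
  have h3 : (1 : ℝ) ≤ (1 / 2) ^ (k + 1) * (b : ℝ) ^ (k + 1) := by
    rw [← mul_pow]; exact one_le_pow₀ (by linarith)
  have hs := h.slope_nonneg x
  calc ‖logError f b Z (f^[k] x)‖ ≤ 2 * C * (D x / m x ^ b) := h1.trans (by gcongr)
    _ ≤ 2 * C * (D x / m x ^ b) * ((1 / 2) ^ (k + 1) * (b : ℝ) ^ (k + 1)) :=
      le_mul_of_one_le_right (by positivity) h3
    _ = _ := by ring

theorem summable_correction {x : X} (hx : x ∈ cone b D m N C) :
    Summable fun k : ℕ => logError f b Z (f^[k] x) / (b : ℂ) ^ (k + 1) :=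
  Summable.of_norm_bounded (summable_geometric_two.mul_left (C * (D x / m x ^ b)))
    (h.norm_term_le hx)

theorem norm_correction_le {x : X} (hx : x ∈ cone b D m N C) :
    ‖correction f b Z x‖ ≤ 2 * C * (D x / m x ^ b) := by
  have := tsum_of_norm_bounded (hasSum_geometric_two.mul_left (C * (D x / m x ^ b)))
    (h.norm_term_le hx)
  refine this.trans (le_of_eq (by ring))

theorem norm_correction_le_one {x : X} (hx : x ∈ cone b D m N C) : ‖correction f b Z x‖ ≤ 1 := by
  linarith [h.norm_correction_le hx, h.le_half hx]

/-- Shifting the index of the series solves the cohomological equation; exponentiated, it becomes φ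
∘ f = φ^b. -/
theorem correction_comp {x : X} (hx : x ∈ cone b D m N C) :
    correction f b Z (f x) = b * correction f b Z x - logError f b Z x := by
  have hb : (b : ℂ) ≠ 0 := by
    have := h.two_le_b
    exact_mod_cast (by omega : b ≠ 0)
  rw [correction, correction, (h.summable_correction hx).tsum_eq_zero_add, mul_add, ← tsum_mul_left]
  have : ∀ k : ℕ, (b : ℂ) * (logError f b Z (f^[k + 1] x) / (b : ℂ) ^ (k + 1 + 1)) =
      logError f b Z (f^[k] (f x)) / (b : ℂ) ^ (k + 1) := fun k => by
    rw [Function.iterate_succ_apply, pow_succ (b : ℂ) (k + 1)]; field_simp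
  simp only [this, Function.iterate_zero, id, zero_add, pow_one]
  field_simp; ring

theorem bottcher_comp {x : X} (hx : x ∈ cone b D m N C) :
    bottcher f b Z (f x) = bottcher f b Z x ^ b := by
  have hz := h.Z_ne_zero hx
  have h1 := h.exp_logError hx
  rw [bottcher, bottcher, h.correction_comp hx, Complex.exp_sub, h1, mul_pow, ← Complex.exp_nat_mul]
  have hf := h.Z_ne_zero (h.mapsTo_cone hx)
  field_simp

theorem bottcher_iterate {x : X} (hx : x ∈ cone b D m N C) (k : ℕ) :
    bottcher f b Z (f^[k] x) = bottcher f b Z x ^ b ^ k := by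
  induction k with
  | zero => simp
  | succ k ih =>
    rw [Function.iterate_succ_apply', h.bottcher_comp (h.iterate_mem_cone hx k), ih, ← pow_mul,
      pow_succ]

/-- The remainder of the series is the correction at the k-th iterate, which is small because the
slope there is; this measures the distance from φ to its truncations. -/
theorem correction_eq_sum_add {x : X} (hx : x ∈ cone b D m N C) (k : ℕ) :
    correction f b Z x = ∑ j ∈ Finset.range k, logError f b Z (f^[j] x) / (b : ℂ) ^ (j + 1)
      + correction f b Z (f^[k] x) / (b : ℂ) ^ k := by
  have hb : (b : ℂ) ≠ 0 := by
    have := h.two_le_b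
    exact_mod_cast (by omega : b ≠ 0)
  induction k with
  | zero => simp
  | succ k ih =>
    rw [Finset.sum_range_succ, Function.iterate_succ_apply',
      h.correction_comp (h.iterate_mem_cone hx k), ih, pow_succ]
    field_simp; ring

theorem norm_bottcher_le {x : X} (hx : x ∈ cone b D m N C) :
    ‖bottcher f b Z x‖ ≤ Real.exp 1 * ‖Z x‖ := by
  rw [bottcher, norm_mul, mul_comm]
  gcongr
  refine (Complex.norm_exp_le_exp_norm _).trans ?_
  exact Real.exp_le_exp.2 (h.norm_correction_le_one hx)

end ConeData

end Cone

/-! ### Holomorphy of the Böttcher coordinate -/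

section BottcherHolomorphic

open Metric

namespace ConeData

variable {X E J : Type*} [TopologicalSpace X] [NormedAddCommGroup E] [NormedSpace ℂ E]
  {f : X → X} {a b : ℕ} {e : J → OpenPartialHomeomorph X E} {ζ : J → X → ℂ} {sel : X → J}
  {D : X → ℝ} {Z : X → ℂ} {m : X → ℝ} {N : Set X} {C : ℝ}
  (h : ConeData f a b e ζ sel D Z m N C)
include h

/-- Orbits that start close to `p` stay close to the orbit of `p` for a controlled time. -/
theorem iterate_chart {p : X} (hp : p ∈ N) (k : ℕ) {B : Set E} (hB : IsOpen B)
    (hBt : B ⊆ (e (sel p)).target)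
    (hBk : ∀ v ∈ B, C ^ k * ‖v - e (sel p) p‖ < 1 / C) (j : ℕ) (hj : j ≤ k) :
    ∀ v ∈ B, f^[j] ((e (sel p)).symm v) ∈ (e (sel (f^[j] p))).source ∧
      ‖e (sel (f^[j] p)) (f^[j] ((e (sel p)).symm v)) - e (sel (f^[j] p)) (f^[j] p)‖
        ≤ C ^ j * ‖v - e (sel p) p‖ ∧
      DifferentiableAt ℂ (fun v => e (sel (f^[j] p)) (f^[j] ((e (sel p)).symm v))) v := by
  have hC := h.C_pos
  induction j with
  | zero =>
    intro v hv
    simp only [Function.iterate_zero, id, pow_zero, one_mul]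
    rw [(e (sel p)).right_inv (hBt hv)]
    refine ⟨(e (sel p)).map_target (hBt hv), le_rfl, ?_⟩
    refine differentiableAt_id.congr_of_eventuallyEq ?_
    filter_upwards [hB.mem_nhds hv] with u hu using (e (sel p)).right_inv (hBt hu)
  | succ j ih =>
    have ih := ih (by omega)
    intro v hv
    obtain ⟨h1, h2, h3⟩ := ih v hv
    have hq : f^[j] p ∈ N := h.maps.iterate j hp
    have hlt : ‖e (sel (f^[j] p)) (f^[j] ((e (sel p)).symm v)) - e (sel (f^[j] p)) (f^[j] p)‖
        < 1 / C := by
      refine lt_of_le_of_lt (h2.trans ?_) (hBk v hv)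
      gcongr ?_ * _
      exact pow_le_pow_right₀ (by linarith [h.two_le_C]) (by omega)
    obtain ⟨g1, g2⟩ := h.lipschitz _ hq _ h1 hlt
    have g3 := h.holo _ hq _ h1 hlt
    simp only [Function.iterate_succ_apply']
    refine ⟨g1, ?_, ?_⟩
    · refine g2.trans ?_
      rw [pow_succ', mul_assoc]
      gcongr
    · refine (g3.comp v h3).congr_of_eventuallyEq ?_
      filter_upwards [hB.mem_nhds hv] with u hu
      simp only [Function.comp_apply]
      rw [(e (sel (f^[j] p))).left_inv (ih u hu).1]

/-- The Böttcher coordinate is holomorphic. -/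
theorem differentiableAt_bottcher {p : X} (hp : p ∈ N)
    (hnear : ∀ᶠ x in 𝓝 p, x ∈ cone b D m N C ∧ ‖Z x‖ ≤ 2) :
    DifferentiableAt ℂ (fun v => bottcher f b Z ((e (sel p)).symm v)) (e (sel p) p) := by
  have hC := h.C_pos
  have hC2 := h.two_le_C
  have hb2 : (2 : ℝ) ≤ b := by exact_mod_cast h.two_le_b
  have hb0 : (b : ℂ) ≠ 0 := by
    have := h.two_le_b
    exact_mod_cast (by omega : b ≠ 0)
  set i := e (sel p) with hi
  have hps : p ∈ i.source := h.mem_source p hp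
  have htend : Tendsto i.symm (𝓝 (i p)) (𝓝 p) := by
    have := (i.continuousAt_symm (i.map_source hps)).tendsto
    rwa [i.left_inv hps] at this
  obtain ⟨δ', hδ', hball⟩ := Metric.eventually_nhds_iff_ball.1 (htend.eventually hnear)
  set δ := min δ' (1 / C) with hδ
  have hδ0 : 0 < δ := lt_min hδ' (by positivity)
  set q : ℕ → X := fun j => f^[j] p with hq
  have hqN : ∀ j, q j ∈ N := fun j => h.maps.iterate j hp
  have hBsub : ∀ k, ball (i p) (δ / C ^ k) ⊆ ball (i p) δ := fun k =>
    ball_subset_ball (div_le_self hδ0.le (one_le_pow₀ (by linarith)))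
  have hcone : ∀ v ∈ ball (i p) δ, i.symm v ∈ cone b D m N C ∧ ‖Z (i.symm v)‖ ≤ 2 := fun v hv =>
    hball v (ball_subset_ball (min_le_left _ _) hv)
  have hBt : ball (i p) δ ⊆ i.target := fun v hv =>
    h.ball_subset p hp (ball_subset_ball (min_le_right _ _) hv)
  have horb : ∀ k j, j ≤ k → ∀ v ∈ ball (i p) (δ / C ^ k),
      f^[j] (i.symm v) ∈ (e (sel (q j))).source ∧
      ‖e (sel (q j)) (f^[j] (i.symm v)) - e (sel (q j)) (q j)‖ < 1 / C ∧
      DifferentiableAt ℂ (fun v => e (sel (q j)) (f^[j] (i.symm v))) v := by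
    intro k j hj v hv
    have hBk : ∀ v ∈ ball (i p) (δ / C ^ k), C ^ k * ‖v - i p‖ < 1 / C := fun v hv => by
      rw [mem_ball, dist_eq_norm, lt_div_iff₀ (by positivity)] at hv
      rw [mul_comm]; exact hv.trans_le (min_le_right _ _)
    obtain ⟨h1, h2, h3⟩ := h.iterate_chart hp k isOpen_ball ((hBsub k).trans hBt) hBk j hj v hv
    refine ⟨h1, lt_of_le_of_lt (h2.trans ?_) (hBk v hv), h3⟩
    gcongr ?_ * _
    exact pow_le_pow_right₀ (by linarith) hj
  -- `s j` reads the j-th iterate in the chart fixed by the orbit of `p`, hence is holomorphic where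
  -- it does not vanish. `z j` uses the chart selected at the moving point and may be discontinuous.
  -- Their ratio differs from 1 by at most C times the slope `κ j`.
  set s : ℕ → E → ℂ := fun j v => ζ (sel (q j)) (f^[j] (i.symm v)) with hs
  set z : ℕ → E → ℂ := fun j v => Z (f^[j] (i.symm v)) with hz
  set κ : ℕ → E → ℝ := fun j v => D (f^[j] (i.symm v)) / m (f^[j] (i.symm v)) ^ b with hκ
  have hκle : ∀ j, ∀ v ∈ ball (i p) δ, κ j v ≤ (1 / C ^ 4) ^ j * aperture b C := fun j v hv =>
    (h.slope_iterate_le (hcone v hv).1 j).trans (by gcongr; exact (slope_lt (hcone v hv).1).le)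
  have hκle' : ∀ j, ∀ v ∈ ball (i p) δ, C * κ j v ≤ C * aperture b C := fun j v hv =>
    h.C_mul_slope_le (h.iterate_mem_cone (hcone v hv).1 j)
  have hκ0 : ∀ j v, 0 ≤ κ j v := fun j v => h.slope_nonneg _
  have hsmall : ((b : ℝ) + 2) * 2 * (C * aperture b C) ≤ 1 / 16 :=
    h.aperture_mul_le.trans h.C_pow_four
  have hz0 : ∀ j, ∀ v ∈ ball (i p) δ, z j v ≠ 0 := fun j v hv =>
    h.Z_ne_zero (h.iterate_mem_cone (hcone v hv).1 j)
  have hsz : ∀ k j, j ≤ k → ∀ v ∈ ball (i p) (δ / C ^ k), ‖s j v / z j v - 1‖ ≤ C * κ j v := by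
    intro k j hj v hv
    have hx := h.iterate_mem_cone (hcone v (hBsub k hv)).1 j
    obtain ⟨h1, h2, -⟩ := horb k j hj v hv
    have hmm : m (f^[j] (i.symm v)) ^ b ≤ m (f^[j] (i.symm v)) :=
      pow_le_of_le_one hx.2.1.le (h.m_le_one _) (by have := h.two_le_b; omega)
    have hcd : C * D (f^[j] (i.symm v)) ≤ m (f^[j] (i.symm v)) ^ b := by
      have := h.le_half hx
      rw [← mul_div_assoc, div_le_iff₀ (m_pow_pos hx)] at this
      have := m_pow_pos hx
      linarith
    refine (h.ratio_chart _ (hqN j) _ h1 h2 hx.1 hx.2.1 (hcd.trans hmm)).trans ?_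
    simp only [hκ]; rw [← mul_div_assoc]
    have := h.D_nonneg (f^[j] (i.symm v))
    have := m_pow_pos hx
    gcongr
  have hhalf : ∀ j, ∀ v ∈ ball (i p) δ, C * κ j v ≤ 1 / 2 := fun j v hv =>
    h.le_half (h.iterate_mem_cone (hcone v hv).1 j)
  set σ : ℕ → E → ℂ := fun j v => Complex.log (s j v / z j v) with hσ
  set u : ℕ → E → ℂ := fun j v => logError f b Z (f^[j] (i.symm v)) with hu
  have hσle : ∀ k j, j ≤ k → ∀ v ∈ ball (i p) (δ / C ^ k), ‖σ j v‖ ≤ 2 * (C * κ j v) :=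
    fun k j hj v hv => norm_log_le_of_norm_sub_one_le (hsz k j hj v hv) (hhalf j v (hBsub k hv))
  have hs0 : ∀ k j, j ≤ k → ∀ v ∈ ball (i p) (δ / C ^ k), s j v ≠ 0 := fun k j hj v hv h0 => by
    have := ne_zero_of_norm_sub_one_le (hsz k j hj v hv) (hhalf j v (hBsub k hv))
    rw [h0, zero_div] at this
    exact this rfl
  have hexpσ : ∀ k j, j ≤ k → ∀ v ∈ ball (i p) (δ / C ^ k),
      Complex.exp (σ j v) = s j v / z j v := fun k j hj v hv =>
    Complex.exp_log (ne_zero_of_norm_sub_one_le (hsz k j hj v hv) (hhalf j v (hBsub k hv)))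
  -- the logarithmic errors of the local coordinates
  have hlog : ∀ k j, j + 1 ≤ k → ∀ v ∈ ball (i p) (δ / C ^ k),
      s (j + 1) v / s j v ^ b ∈ Complex.slitPlane ∧
      Complex.log (s (j + 1) v / s j v ^ b) = u j v + σ (j + 1) v - b * σ j v := by
    intro k j hj v hv
    have hv' := hBsub k hv
    have hx := h.iterate_mem_cone (hcone v hv').1 j
    -- A number of norm at most 1 is recovered from its exponential by the principal logarithm, so
    -- the identity between logarithms holds without a multiple of 2πi.
    have hw : ‖u j v + σ (j + 1) v - b * σ j v‖ ≤ 1 := by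
      have e1 : ‖u j v‖ ≤ 2 * (C * κ j v) := by
        rw [← mul_assoc]; exact h.norm_logError_le hx
      have e2 := hσle k (j + 1) hj v hv
      have e3 := hσle k j (by omega) v hv
      have e4 := hκle' j v hv'
      have e5 := hκle' (j + 1) v hv'
      have e6 : ‖(b : ℂ) * σ j v‖ ≤ b * (2 * (C * aperture b C)) := by
        rw [norm_mul, Complex.norm_natCast]; gcongr; linarith
      have e7 := (norm_sub_le (u j v + σ (j + 1) v) (b * σ j v))
      have e8 := norm_add_le (u j v) (σ (j + 1) v)
      nlinarith
    have hexp : Complex.exp (u j v + σ (j + 1) v - b * σ j v) = s (j + 1) v / s j v ^ b := by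
      rw [Complex.exp_sub, Complex.exp_add, hexpσ k (j + 1) hj v hv, Complex.exp_nat_mul,
        hexpσ k j (by omega) v hv]
      have e1 : Complex.exp (u j v) = z (j + 1) v / z j v ^ b := by
        have := h.exp_logError hx
        rw [← Function.iterate_succ_apply' f] at this
        exact this
      rw [e1]
      have := hz0 j v hv'
      have := hz0 (j + 1) v hv'
      have := hs0 k j (by omega) v hv
      rw [div_pow]
      field_simp
    rw [← hexp]
    exact exp_mem_slitPlane_of_norm_le_one hw
  -- The k-th model is the truncated Böttcher product written with the frozen coordinates `s`
  -- instead of `z`, hence holomorphic on the k-th ball.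
  set G : ℕ → E → ℂ := fun k v => s 0 v * Complex.exp (∑ j ∈ Finset.range k,
    Complex.log (s (j + 1) v / s j v ^ b) / (b : ℂ) ^ (j + 1)) with hG
  have hGeq : ∀ k, ∀ v ∈ ball (i p) (δ / C ^ k), G k v = z 0 v * Complex.exp
      (∑ j ∈ Finset.range k, u j v / (b : ℂ) ^ (j + 1) + σ k v / (b : ℂ) ^ k) := by
    intro k v hv
    -- The discrepancies σ telescope. Only σ 0, absorbed by replacing s 0 with z 0, and the last one
    -- divided by b^l remain.
    have hsum : ∀ l ≤ k, ∑ j ∈ Finset.range l, Complex.log (s (j + 1) v / s j v ^ b)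
        / (b : ℂ) ^ (j + 1) = ∑ j ∈ Finset.range l, u j v / (b : ℂ) ^ (j + 1)
          + σ l v / (b : ℂ) ^ l - σ 0 v := by
      intro l hl
      induction l with
      | zero => simp
      | succ l ih =>
        rw [Finset.sum_range_succ, Finset.sum_range_succ, ih (by omega), (hlog k l hl v hv).2,
          pow_succ]
        field_simp; ring
    simp only [hG]
    rw [hsum k le_rfl, Complex.exp_sub, hexpσ k 0 (Nat.zero_le k) v hv]
    have h1 := hz0 0 v (hBsub k hv)
    have h2 := hs0 k 0 (Nat.zero_le k) v hv
    field_simp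
  set A : ℝ := Real.exp 1 * 2 * (2 * (4 * (C * aperture b C))) with hA
  have hA0 : 0 ≤ A := by have := h.aperture_pos; positivity
  have happrox : ∀ k, ∀ v ∈ ball (i p) (δ / C ^ k),
      ‖bottcher f b Z (i.symm v) - G k v‖ ≤ A * (1 / C ^ 4) ^ k := by
    intro k v hv
    have hv' := hBsub k hv
    have hx := (hcone v hv').1
    set w : ℂ := σ k v / (b : ℂ) ^ k - correction f b Z (f^[k] (i.symm v)) / (b : ℂ) ^ k with hw
    have hGw : G k v = bottcher f b Z (i.symm v) * Complex.exp w := by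
      rw [hGeq k v hv, bottcher, mul_assoc, ← Complex.exp_add, h.correction_eq_sum_add hx k, hw]
      simp only [hz, hu, Function.iterate_zero, id]
      congr 2; ring
    have hbk : (1 : ℝ) ≤ (b : ℝ) ^ k := one_le_pow₀ (by linarith)
    have hwle : ‖w‖ ≤ 4 * (C * κ k v) := by
      have e1 := hσle k k le_rfl v hv
      have e2 := h.norm_correction_le (h.iterate_mem_cone hx k)
      rw [hw, ← sub_div, norm_div, norm_pow, Complex.norm_natCast]
      refine (div_le_self (norm_nonneg _) hbk).trans ((norm_sub_le _ _).trans ?_)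
      rw [mul_assoc] at e2
      change ‖correction f b Z (f^[k] (i.symm v))‖ ≤ 2 * (C * κ k v) at e2
      linarith
    have hw1 : ‖w‖ ≤ 1 := by
      have := hκle' k v hv'
      have := h.C_mul_aperture_le
      linarith
    have e1 : bottcher f b Z (i.symm v) - G k v =
        -(bottcher f b Z (i.symm v) * (Complex.exp w - 1)) := by rw [hGw]; ring
    have e2 : ‖bottcher f b Z (i.symm v)‖ ≤ Real.exp 1 * 2 :=
      (h.norm_bottcher_le hx).trans (by gcongr; exact (hcone v hv').2)
    have e3 : ‖Complex.exp w - 1‖ ≤ 2 * ‖w‖ := Complex.norm_exp_sub_one_le hw1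
    rw [e1, norm_neg, norm_mul]
    calc ‖bottcher f b Z (i.symm v)‖ * ‖Complex.exp w - 1‖
        ≤ (Real.exp 1 * 2) * (2 * (4 * (C * ((1 / C ^ 4) ^ k * aperture b C)))) := by
          gcongr
          exact e3.trans (by gcongr; exact hwle.trans (by gcongr; exact hκle k v hv'))
      _ = A * (1 / C ^ 4) ^ k := by rw [hA]; ring
  have hϑ1 : ∀ k : ℕ, (1 / C ^ 4) ^ k ≤ 1 := fun k =>
    pow_le_one₀ (by positivity) (by linarith [h.C_pow_four])
  -- Radii shrink by 1/C and errors by 1/C⁴ at each stage; the criterion holds because C³ / C⁴ = 1/C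
  -- < 1.
  refine differentiableAt_of_approx_on_shrinking_balls (δ := δ) (μ := C) (ϑ := 1 / C ^ 4)
    (A := A) (M := Real.exp 1 * 2 + A) hδ0 (by linarith) (by positivity) ?_ G ?_ ?_ happrox
  · have : 1 / C ^ 4 * C ^ 3 = 1 / C := by field_simp
    rw [this, div_lt_one hC]; linarith
  · intro k v hv
    refine DifferentiableAt.differentiableWithinAt ?_
    have hds : ∀ j ≤ k, DifferentiableAt ℂ (s j) v := by
      intro j hj
      obtain ⟨h1, h2, h3⟩ := horb k j hj v hv
      have h4 := h.holo_coord _ (hqN j) _ h1 h2 (hs0 k j hj v hv)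
      refine (h4.comp v h3).congr_of_eventuallyEq ?_
      filter_upwards [isOpen_ball.mem_nhds hv] with y hy
      simp only [hs, Function.comp_apply]
      rw [(e (sel (q j))).left_inv (horb k j hj y hy).1]
    refine (hds 0 (Nat.zero_le k)).mul (DifferentiableAt.cexp (DifferentiableAt.fun_sum ?_))
    intro j hj
    have hjk : j + 1 ≤ k := Finset.mem_range.1 hj
    have hquot : DifferentiableAt ℂ (fun v => s (j + 1) v / s j v ^ b) v := by
      simp only [div_eq_mul_inv]
      exact (hds (j + 1) hjk).fun_mul (((hds j (by omega)).fun_pow b).fun_inv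
        (pow_ne_zero b (hs0 k j (by omega) v hv)))
    simp only [div_eq_mul_inv _ ((b : ℂ) ^ (j + 1))]
    exact (hquot.clog (hlog k j hjk v hv).1).mul_const _
  · intro k v hv
    have hv' := hBsub k hv
    have e1 := happrox k v hv
    have e2 : ‖bottcher f b Z (i.symm v)‖ ≤ Real.exp 1 * 2 :=
      (h.norm_bottcher_le (hcone v hv').1).trans (by gcongr; exact (hcone v hv').2)
    have e3 := norm_sub_norm_le (G k v) (bottcher f b Z (i.symm v))
    rw [norm_sub_rev] at e3
    have e4 : A * (1 / C ^ 4) ^ k ≤ A := mul_le_of_le_one_right hA0 (hϑ1 k)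
    linarith

end ConeData

end BottcherHolomorphic

/-! ### Uniform estimates along the line, by compactness -/

section Uniform

open RiemannSphere Metric

theorem RiemannSphere.gauge_inv (p : OnePoint ℂ) : gauge (inv p) = gauge p := by
  simp only [RiemannSphere.gauge, coord_inv, norm_inv, _root_.inv_inv]
  exact min_comm _ _

theorem RiemannSphere.gauge_powMap {b : ℕ} (hb : b ≠ 0) (p : OnePoint ℂ) :
    RiemannSphere.gauge (powMap b p) = RiemannSphere.gauge p ^ b := by
  simp only [RiemannSphere.gauge, coord_powMap hb, norm_pow, ← inv_pow]
  rcases le_total ‖coord p‖ ‖coord p‖⁻¹ with h | h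
  · rw [min_eq_left h, min_eq_left (pow_le_pow_left₀ (norm_nonneg _) h b)]
  · rw [min_eq_right h, min_eq_right (pow_le_pow_left₀ (by positivity) h b)]

theorem RiemannSphere.continuous_gauge : Continuous RiemannSphere.gauge := by
  have hfin : ∀ p, p ≠ OnePoint.infty → ContinuousAt RiemannSphere.gauge p := by
    intro p hp
    have hc : ContinuousAt (fun q => ‖coord q‖) p := (contMDiffAt_coord hp).continuousAt.norm
    by_cases h0 : coord p = 0
    · have hg : RiemannSphere.gauge p = 0 := by simp [RiemannSphere.gauge, h0]
      rw [ContinuousAt, hg]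
      refine squeeze_zero gauge_nonneg (fun q => min_le_left _ _) ?_
      simpa [h0] using hc.tendsto
    · exact hc.min (hc.inv₀ (norm_ne_zero_iff.2 h0))
  rw [continuous_iff_continuousAt]
  intro p
  by_cases hp : p = OnePoint.infty
  · have h0 : inv p ≠ OnePoint.infty := by
      rw [hp, inv_infty]; exact OnePoint.coe_ne_infty 0
    have := (hfin _ h0).comp continuous_inv.continuousAt
    exact this.congr (Eventually.of_forall gauge_inv)
  · exact hfin p hp

/-- A uniform version, along a compact set, of estimates with a local constant. -/
theorem IsCompact.exists_forall_eventually_nhdsSet {X : Type*} [TopologicalSpace X] {L : Set X}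
    (hL : IsCompact L) {P : ℝ → X → Prop} (hmono : ∀ C C', C ≤ C' → ∀ x, P C x → P C' x)
    (h : ∀ ξ ∈ L, ∃ C, ∀ᶠ x in 𝓝 ξ, P C x) : ∃ C, ∀ᶠ x in 𝓝ˢ L, P C x := by
  refine hL.induction_on (p := fun s => ∃ C, ∀ᶠ x in 𝓝ˢ s, P C x) ⟨0, by simp⟩ ?_ ?_ ?_
  · rintro s t hst ⟨C, hC⟩
    exact ⟨C, hC.filter_mono (nhdsSet_mono hst)⟩
  · rintro s t ⟨C, hC⟩ ⟨C', hC'⟩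
    refine ⟨max C C', ?_⟩
    rw [nhdsSet_union, eventually_sup]
    exact ⟨hC.mono fun x => hmono _ _ (le_max_left _ _) x,
      hC'.mono fun x => hmono _ _ (le_max_right _ _) x⟩
  · intro ξ hξ
    obtain ⟨C, hC⟩ := h ξ hξ
    obtain ⟨V, hV, hVo, hξV⟩ := eventually_nhds_iff.1 hC
    exact ⟨V, mem_nhdsWithin_of_mem_nhds (hVo.mem_nhds hξV), C,
      Filter.eventually_of_mem (hVo.mem_nhdsSet.2 Subset.rfl) hV⟩

/-- A function with values in an index type which locally takes finitely many allowed values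
satisfies estimates with a local constant as soon as each allowed value does. -/
theorem exists_eventually_of_selection {X J : Type*} {l : Filter X} {P : J → ℝ → X → Prop}
    (hmono : ∀ i C C', C ≤ C' → ∀ x, P i C x → P i C' x) {t : Finset J} {A : J → Prop}
    {sel : X → J} (hsel : ∀ᶠ x in l, sel x ∈ t ∧ A (sel x))
    (h : ∀ i ∈ t, A i → ∃ C, ∀ᶠ x in l, P i C x) : ∃ C, ∀ᶠ x in l, P (sel x) C x := by
  have h' : ∀ i, ∃ C, i ∈ t → A i → ∀ᶠ x in l, P i C x := fun i => by
    by_cases hi : i ∈ t ∧ A i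
    · obtain ⟨C, hC⟩ := h i hi.1 hi.2
      exact ⟨C, fun _ _ => hC⟩
    · exact ⟨0, fun h1 h2 => absurd ⟨h1, h2⟩ hi⟩
  choose C hC using h'
  have hev : ∀ᶠ x in l, ∀ i ∈ t, A i → P i (C i) x := by
    rw [Filter.eventually_all_finset]
    intro i hi
    by_cases hA : A i
    · exact (hC i hi hA).mono fun x hx _ => hx
    · exact Eventually.of_forall fun x h => absurd h hA
  refine ⟨∑ i ∈ t, |C i|, ?_⟩
  filter_upwards [hev, hsel] with x hx hs
  refine hmono _ _ _ ?_ _ (hx _ hs.1 hs.2)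
  exact (le_abs_self _).trans (Finset.single_le_sum (f := fun i => |C i|)
    (fun i _ => abs_nonneg _) hs.1)

variable {n : ℕ} {X : Type*} [TopologicalSpace X] [ChartedSpace (Cn n) X] {ι : OnePoint ℂ → X}

/-- A property that holds near a point of the line holds on chart balls of uniform size. -/
theorem RetractionChart.exists_forall_ball (c : RetractionChart n ι) {x : X} (hx : x ∈ c.dom)
    {R : X → Prop} (hR : ∀ᶠ y in 𝓝 x, R y) :
    ∃ C : ℝ, 0 < C ∧ ∀ᶠ q in 𝓝 x, q ∈ c.chart.source ∧ ∀ v, ‖v - c.chart q‖ < 1 / C →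
      v ∈ c.chart.target ∧ R (c.chart.symm v) := by
  have hxs := c.dom_subset hx
  have h1 : ∀ᶠ v in 𝓝 (c.chart x), v ∈ c.chart.target ∧ R (c.chart.symm v) := by
    refine Eventually.and (c.chart.open_target.mem_nhds (c.chart.map_source hxs)) ?_
    have := (c.chart.continuousAt_symm (c.chart.map_source hxs)).tendsto
    rw [c.chart.left_inv hxs] at this
    exact this.eventually hR
  obtain ⟨δ, hδ, hball⟩ := Metric.eventually_nhds_iff_ball.1 h1
  refine ⟨2 / δ, by positivity, ?_⟩
  filter_upwards [(c.chart.continuousAt hxs).preimage_mem_nhds (ball_mem_nhds _ (half_pos hδ)),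
    c.chart.open_source.mem_nhds hxs] with q hq hqs
  refine ⟨hqs, fun v hv => hball v ?_⟩
  have h2 : dist (c.chart q) (c.chart x) < δ / 2 := hq
  rw [mem_ball]
  have h3 : dist v (c.chart q) < δ / 2 := by rw [dist_eq_norm]; simpa using hv
  linarith [dist_triangle v (c.chart q) (c.chart x)]

/-- Finitely many compact pieces cover the line, and `sel` picks one containing the point, with no
continuity. Since the pieces are closed, only charts whose domain contains ξ are selected near ξ, so
a local estimate for `sel` reduces to finitely many estimates with a fixed chart. -/
theorem exists_selection [T2Space X] [CompactSpace X] [IsManifold 𝓘(ℂ, Cn n) ω X]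
    (hι : Manifold.IsSmoothEmbedding 𝓘(ℂ) 𝓘(ℂ, Cn n) ω ι) :
    ∃ (c : OnePoint ℂ → RetractionChart n ι) (t : Finset (OnePoint ℂ)) (K : OnePoint ℂ → Set X)
      (sel : X → OnePoint ℂ), (∀ p, IsCompact (K p) ∧ K p ⊆ (c p).dom) ∧
      ∀ ξ ∈ range ι, ∀ᶠ x in 𝓝 ξ, (sel x ∈ t ∧ x ∈ K (sel x)) ∧ ξ ∈ (c (sel x)).dom := by
  classical
  choose c hc using exists_retractionChart hι
  have hK : ∀ p, ∃ K : Set X, IsCompact K ∧ ι p ∈ interior K ∧ K ⊆ (c p).dom := fun p =>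
    exists_compact_subset (c p).isOpen_dom (hc p)
  choose K hKc hKi hKd using hK
  have hLc : IsCompact (range ι) := isCompact_range hι.isEmbedding.continuous
  obtain ⟨t, ht⟩ := hLc.elim_finite_subcover (fun p => interior (K p)) (fun p => isOpen_interior)
    (by rintro _ ⟨p, rfl⟩; exact mem_iUnion.2 ⟨p, hKi p⟩)
  -- Off the finite cover the value of the selection is irrelevant.
  refine ⟨c, t, K, fun x => if h : ∃ p ∈ t, x ∈ K p then h.choose else OnePoint.infty,
    fun p => ⟨hKc p, hKd p⟩, fun ξ hξ => ?_⟩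
  obtain ⟨p, hpt, hp⟩ := mem_iUnion₂.1 (ht hξ)
  have h1 : ∀ᶠ x in 𝓝 ξ, ∀ i ∈ t, x ∈ K i → ξ ∈ (c i).dom := by
    rw [Filter.eventually_all_finset]
    intro i _
    by_cases hi : ξ ∈ (c i).dom
    · exact Eventually.of_forall fun _ _ => hi
    · have : ξ ∉ K i := fun h => hi (hKd i h)
      filter_upwards [(hKc i).isClosed.isOpen_compl.mem_nhds this] with x hx h
      exact absurd h hx
  filter_upwards [h1, isOpen_interior.mem_nhds hp] with x hx hxp
  have hex : ∃ p ∈ t, x ∈ K p := ⟨p, hpt, interior_subset hxp⟩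
  rw [dif_pos hex]
  exact ⟨hex.choose_spec, hx _ hex.choose_spec.1 hex.choose_spec.2⟩

/-- The estimates with local constants become estimates with one constant C on a tube `N` around the
line, by compactness of the line and finiteness of the set of charts. The extra conclusions identify
the neighbourhoods of the line with the sublevel sets of D in `N`. -/
theorem exists_coneData [T2Space X] [CompactSpace X] [IsManifold 𝓘(ℂ, Cn n) ω X]
    (hι : Manifold.IsSmoothEmbedding 𝓘(ℂ) 𝓘(ℂ, Cn n) ω ι) {f : X → X} {a b : ℕ} (hb : 2 ≤ b)
    (hab : b ≤ a) (hf : ∀ᶠ x in 𝓝ˢ (range ι), ContMDiffAt 𝓘(ℂ, Cn n) 𝓘(ℂ, Cn n) ω f x)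
    (hconj : ∀ p, f (ι p) = ι (powMap b p))
    (htrans : IsTransversallySuperattracting n f (range ι) a) :
    ∃ (c : OnePoint ℂ → RetractionChart n ι) (sel : X → OnePoint ℂ) (N : Set X) (C : ℝ),
      ConeData f a b (fun p => (c p).chart) (fun p x => coord ((c p).r x)) sel
        (fun x => ‖(c (sel x)).w x‖) (fun x => coord ((c (sel x)).r x))
        (fun x => RiemannSphere.gauge ((c (sel x)).r x)) N C ∧
      N ∈ 𝓝ˢ (range ι) ∧
      (∀ x ∈ N, x ∈ (c (sel x)).dom ∧ ContMDiffAt 𝓘(ℂ, Cn n) 𝓘(ℂ, Cn n) ω f x) ∧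
      (∀ V ∈ 𝓝ˢ (range ι), ∃ ε > 0, ∀ x ∈ N, ‖(c (sel x)).w x‖ < ε → x ∈ V) ∧
      (∀ q, Tendsto (fun x => (c (sel x)).r x) (𝓝 (ι q)) (𝓝 q)) ∧
      ∀ ξ ∈ range ι, Tendsto (fun x => ‖(c (sel x)).w x‖) (𝓝 ξ) (𝓝 0) := by
  have hb0 : b ≠ 0 := by omega
  have ha0 : a ≠ 0 := by omega
  have hιc : Continuous ι := hι.isEmbedding.continuous
  have hιs : ContMDiff 𝓘(ℂ) 𝓘(ℂ, Cn n) ω ι := hι.contMDiff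
  have hLc : IsCompact (range ι) := isCompact_range hιc
  have hfL : MapsTo f (range ι) (range ι) := by
    rintro _ ⟨p, rfl⟩; rw [hconj]; exact mem_range_self _
  obtain ⟨c, t, K, sel, hK, hsel⟩ := exists_selection hι
  have hfat : ∀ ξ ∈ range ι, ContMDiffAt 𝓘(ℂ, Cn n) 𝓘(ℂ, Cn n) ω f ξ := fun ξ hξ =>
    eventually_nhdsSet_iff_forall.1 hf ξ hξ |>.self_of_nhds
  have hself : ∀ ξ ∈ range ι, ∀ᶠ x in 𝓝 ξ, ContMDiffAt 𝓘(ℂ, Cn n) 𝓘(ℂ, Cn n) ω f x :=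
    fun ξ hξ => eventually_nhdsSet_iff_forall.1 hf ξ hξ
  have hsel1 : ∀ ξ ∈ range ι, ∀ᶠ x in 𝓝 ξ, sel x ∈ t ∧ ξ ∈ (c (sel x)).dom := fun ξ hξ =>
    (hsel ξ hξ).mono fun x hx => ⟨hx.1.1, hx.2⟩
  have hsel2 : ∀ ξ ∈ range ι, ∀ᶠ x in 𝓝 ξ, sel (f x) ∈ t ∧ f ξ ∈ (c (sel (f x))).dom :=
    fun ξ hξ => (hfat ξ hξ).continuousAt.tendsto.eventually (hsel1 _ (hfL hξ))
  -- the transversal distance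
  have hD0 : ∀ ξ ∈ range ι, Tendsto (fun x => ‖(c (sel x)).w x‖) (𝓝 ξ) (𝓝 0) := by
    intro ξ hξ
    rw [Metric.tendsto_nhds]
    intro ε hε
    have : ∀ᶠ x in 𝓝 ξ, ∀ i ∈ t, ξ ∈ (c i).dom → ‖(c i).w x‖ < ε := by
      rw [Filter.eventually_all_finset]
      intro i _
      by_cases hi : ξ ∈ (c i).dom
      · have h1 : ‖(c i).w ξ‖ < ε := by rwa [((c i).w_eq_zero_iff hi).2 hξ, norm_zero]
        filter_upwards [((c i).contMDiffAt_w hιs hi).continuousAt.norm.eventually_lt_const h1]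
          with x hx _ using hx
      · exact Eventually.of_forall fun _ h => absurd h hi
    filter_upwards [this, hsel1 ξ hξ] with x hx hs
    simpa using hx _ hs.1 hs.2
  have hr : ∀ q, Tendsto (fun x => (c (sel x)).r x) (𝓝 (ι q)) (𝓝 q) := by
    intro q V hV
    have : ∀ᶠ x in 𝓝 (ι q), ∀ i ∈ t, ι q ∈ (c i).dom → (c i).r x ∈ V := by
      rw [Filter.eventually_all_finset]
      intro i _
      by_cases hi : ι q ∈ (c i).dom
      · have h1 := ((c i).contMDiffAt_r hi).continuousAt.tendsto
        rw [(c i).r_apply q hi] at h1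
        filter_upwards [h1.eventually hV] with x hx _ using hx
      · exact Eventually.of_forall fun _ h => absurd h hi
    rw [mem_map]
    filter_upwards [this, hsel1 (ι q) (mem_range_self q)] with x hx hs
    exact hx _ hs.1 hs.2
  -- Outside a neighbourhood of the line, the transversal coordinate has no zero on the compact
  -- piece, hence is bounded below there.
  have hbasis : ∀ V ∈ 𝓝ˢ (range ι), ∃ ε > 0, ∀ x, sel x ∈ t → x ∈ K (sel x) →
      ‖(c (sel x)).w x‖ < ε → x ∈ V := by
    intro V hV
    obtain ⟨O, hO, hLO, hOV⟩ := mem_nhdsSet_iff_exists.1 hV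
    have h1 : ∀ i, ∃ ε > 0, ∀ x ∈ K i, ‖(c i).w x‖ < ε → x ∈ V := by
      intro i
      have hcomp : IsCompact (K i \ O) := (hK i).1.diff hO
      have hcont : ContinuousOn (fun x => ‖(c i).w x‖) (K i \ O) := fun x hx =>
        ((c i).contMDiffAt_w hιs ((hK i).2 hx.1)).continuousAt.norm.continuousWithinAt
      have hpos : ∀ x ∈ K i \ O, 0 < ‖(c i).w x‖ := fun x hx =>
        norm_pos_iff.2 fun h0 => hx.2 (hLO (((c i).w_eq_zero_iff ((hK i).2 hx.1)).1 h0))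
      obtain ⟨ε, hε, hle⟩ := hcomp.exists_forall_le' hcont hpos
      refine ⟨ε, hε, fun x hx hlt => hOV ?_⟩
      by_contra hxO
      exact absurd hlt (not_lt.2 (hle x ⟨hx, hxO⟩))
    choose ε hε hεV using h1
    obtain ⟨δ, hδ, hδle⟩ : ∃ δ > 0, ∀ i ∈ t, δ ≤ ε i := by
      rcases t.eq_empty_or_nonempty with rfl | hne
      · exact ⟨1, one_pos, by simp⟩
      · obtain ⟨i, _, hi⟩ := t.exists_min_image ε hne
        exact ⟨ε i, hε i, hi⟩
    exact ⟨δ, hδ, fun x hx hxK hlt => hεV _ x hxK (hlt.trans_le (hδle _ hx))⟩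
  -- uniform estimates
  have hE1 : ∃ C, ∀ᶠ x in 𝓝ˢ (range ι), ‖(c (sel (f x))).w (f x)‖ ≤ C * ‖(c (sel x)).w x‖ ^ a := by
    refine hLc.exists_forall_eventually_nhdsSet
      (P := fun C x => ‖(c (sel (f x))).w (f x)‖ ≤ C * ‖(c (sel x)).w x‖ ^ a) ?_ fun ξ hξ => ?_
    · intro C C' hC x hx; exact hx.trans (by gcongr)
    refine exists_eventually_of_selection (t := t) (A := fun i => ξ ∈ (c i).dom)
      (P := fun i C x => ‖(c (sel (f x))).w (f x)‖ ≤ C * ‖(c i).w x‖ ^ a) ?_ (hsel1 ξ hξ)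
      fun i hi hi' => ?_
    · intro i C C' hC x hx; exact hx.trans (by gcongr)
    refine exists_eventually_of_selection (sel := fun x => sel (f x)) (t := t)
      (A := fun j => f ξ ∈ (c j).dom)
      (P := fun j C x => ‖(c j).w (f x)‖ ≤ C * ‖(c i).w x‖ ^ a) ?_ (hsel2 ξ hξ)
      fun j hj hj' => ?_
    · intro i C C' hC x hx; exact hx.trans (by gcongr)
    obtain ⟨C, hC⟩ := ((c i).isBigO_w_comp (c j) hιs ha0 hfL (hfat ξ hξ) htrans hi' hξ hj').bound
    refine ⟨C, hC.mono fun x hx => ?_⟩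
    simpa using hx
  obtain ⟨C₁, hC₁⟩ := hE1
  have hE2 : ∃ C, ∀ᶠ x in 𝓝ˢ (range ι), 0 < RiemannSphere.gauge ((c (sel x)).r x) →
      C * ‖(c (sel x)).w x‖ ≤ RiemannSphere.gauge ((c (sel x)).r x) ^ b →
      ‖coord ((c (sel (f x))).r (f x)) / coord ((c (sel x)).r x) ^ b - 1‖ ≤
        C * ‖(c (sel x)).w x‖ / RiemannSphere.gauge ((c (sel x)).r x) ^ b := by
    have hmono : ∀ (i j : OnePoint ℂ) (C C' : ℝ), C ≤ C' → ∀ x,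
        (0 < RiemannSphere.gauge ((c i).r x) →
          C * ‖(c i).w x‖ ≤ RiemannSphere.gauge ((c i).r x) ^ b →
          ‖coord ((c j).r (f x)) / coord ((c i).r x) ^ b - 1‖ ≤
            C * ‖(c i).w x‖ / RiemannSphere.gauge ((c i).r x) ^ b) →
        (0 < RiemannSphere.gauge ((c i).r x) →
          C' * ‖(c i).w x‖ ≤ RiemannSphere.gauge ((c i).r x) ^ b →
          ‖coord ((c j).r (f x)) / coord ((c i).r x) ^ b - 1‖ ≤
            C' * ‖(c i).w x‖ / RiemannSphere.gauge ((c i).r x) ^ b) := by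
      intro i j C C' hC x hx h1 h2
      exact (hx h1 (le_trans (by gcongr) h2)).trans (by gcongr)
    refine hLc.exists_forall_eventually_nhdsSet (fun C C' hC x => hmono _ _ C C' hC x)
      fun ξ hξ => ?_
    refine exists_eventually_of_selection (t := t) (A := fun i => ξ ∈ (c i).dom)
      (P := fun i C x => 0 < RiemannSphere.gauge ((c i).r x) →
          C * ‖(c i).w x‖ ≤ RiemannSphere.gauge ((c i).r x) ^ b →
          ‖coord ((c (sel (f x))).r (f x)) / coord ((c i).r x) ^ b - 1‖ ≤
            C * ‖(c i).w x‖ / RiemannSphere.gauge ((c i).r x) ^ b)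
      (fun i C C' hC x => hmono _ _ C C' hC x) (hsel1 ξ hξ) fun i hi hi' => ?_
    refine exists_eventually_of_selection (sel := fun x => sel (f x)) (t := t)
      (A := fun j => f ξ ∈ (c j).dom)
      (P := fun j C x => 0 < RiemannSphere.gauge ((c i).r x) →
          C * ‖(c i).w x‖ ≤ RiemannSphere.gauge ((c i).r x) ^ b →
          ‖coord ((c j).r (f x)) / coord ((c i).r x) ^ b - 1‖ ≤
            C * ‖(c i).w x‖ / RiemannSphere.gauge ((c i).r x) ^ b)
      (fun j C C' hC x => hmono _ _ C C' hC x) (hsel2 ξ hξ) fun j hj hj' => ?_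
    -- The maps z^b ∘ r_i and r_j ∘ f to the sphere agree on the line. The gauge of the former is
    -- the b-th power of that of r_i, whence the denominator m^b in the cone.
    obtain ⟨C, hC0, hC⟩ := (c i).exists_norm_coord_div_sub_one_le hιc
      (r := fun x => powMap b ((c i).r x)) (r' := fun x => (c j).r (f x)) hi' hξ
      ((contMDiff_powMap hb0 _).comp ξ ((c i).contMDiffAt_r hi'))
      (((c j).contMDiffAt_r hj').comp ξ (hfat ξ hξ)) (by
        have h1 : ∀ᶠ y in 𝓝 ξ, f y ∈ (c j).dom :=
          (hfat ξ hξ).continuousAt.preimage_mem_nhds ((c j).isOpen_dom.mem_nhds hj')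
        filter_upwards [mem_nhdsWithin_of_mem_nhds h1, self_mem_nhdsWithin,
          mem_nhdsWithin_of_mem_nhds ((c i).isOpen_dom.mem_nhds hi')] with y hy1 hy2 hy3
        obtain ⟨q, rfl⟩ := hy2
        have hy1 : f (ι q) ∈ (c j).dom := hy1
        rw [hconj] at hy1
        rw [hconj, (c j).r_apply _ hy1, (c i).r_apply _ hy3])
    refine ⟨C, hC.mono fun x hx h1 h2 => ?_⟩
    simp only [RiemannSphere.gauge_powMap hb0, coord_powMap hb0] at hx
    exact hx (pow_pos h1 b) h2
  obtain ⟨C₂, hC₂⟩ := hE2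
  -- Here `q` is the centre whose chart is frozen and `x` a nearby point; the retraction of the
  -- frozen chart is compared with the one selected at `x`.
  have hE3 : ∃ C, ∀ᶠ q in 𝓝ˢ (range ι), 0 < C ∧ ∀ x ∈ (c (sel q)).chart.source,
      ‖(c (sel q)).chart x - (c (sel q)).chart q‖ < 1 / C →
      0 < RiemannSphere.gauge ((c (sel x)).r x) →
      C * ‖(c (sel x)).w x‖ ≤ RiemannSphere.gauge ((c (sel x)).r x) →
      ‖coord ((c (sel q)).r x) / coord ((c (sel x)).r x) - 1‖ ≤
        C * ‖(c (sel x)).w x‖ / RiemannSphere.gauge ((c (sel x)).r x) := by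
    have hmono : ∀ (i : OnePoint ℂ) (C C' : ℝ), C ≤ C' → ∀ q,
        (0 < C ∧ ∀ x ∈ (c i).chart.source,
          ‖(c i).chart x - (c i).chart q‖ < 1 / C →
          0 < RiemannSphere.gauge ((c (sel x)).r x) →
          C * ‖(c (sel x)).w x‖ ≤ RiemannSphere.gauge ((c (sel x)).r x) →
          ‖coord ((c i).r x) / coord ((c (sel x)).r x) - 1‖ ≤
            C * ‖(c (sel x)).w x‖ / RiemannSphere.gauge ((c (sel x)).r x)) →
        (0 < C' ∧ ∀ x ∈ (c i).chart.source,
          ‖(c i).chart x - (c i).chart q‖ < 1 / C' →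
          0 < RiemannSphere.gauge ((c (sel x)).r x) →
          C' * ‖(c (sel x)).w x‖ ≤ RiemannSphere.gauge ((c (sel x)).r x) →
          ‖coord ((c i).r x) / coord ((c (sel x)).r x) - 1‖ ≤
            C' * ‖(c (sel x)).w x‖ / RiemannSphere.gauge ((c (sel x)).r x)) := by
      rintro i C C' hC q ⟨h0, h⟩
      refine ⟨h0.trans_le hC, fun x hx h1 h2 h3 => ?_⟩
      exact (h x hx (h1.trans_le (one_div_le_one_div_of_le h0 hC)) h2
        (le_trans (by gcongr) h3)).trans (by gcongr)
    refine hLc.exists_forall_eventually_nhdsSet (fun C C' hC x => hmono _ C C' hC x) fun ξ hξ => ?_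
    refine exists_eventually_of_selection (t := t) (A := fun i => ξ ∈ (c i).dom)
      (P := fun i C q => 0 < C ∧ ∀ x ∈ (c i).chart.source,
          ‖(c i).chart x - (c i).chart q‖ < 1 / C →
          0 < RiemannSphere.gauge ((c (sel x)).r x) →
          C * ‖(c (sel x)).w x‖ ≤ RiemannSphere.gauge ((c (sel x)).r x) →
          ‖coord ((c i).r x) / coord ((c (sel x)).r x) - 1‖ ≤
            C * ‖(c (sel x)).w x‖ / RiemannSphere.gauge ((c (sel x)).r x))
      (fun i C C' hC x => hmono _ C C' hC x) (hsel1 ξ hξ) fun i hi hi' => ?_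
    have hloc : ∃ C, ∀ᶠ x in 𝓝 ξ, 0 < RiemannSphere.gauge ((c (sel x)).r x) →
          C * ‖(c (sel x)).w x‖ ≤ RiemannSphere.gauge ((c (sel x)).r x) →
          ‖coord ((c i).r x) / coord ((c (sel x)).r x) - 1‖ ≤
            C * ‖(c (sel x)).w x‖ / RiemannSphere.gauge ((c (sel x)).r x) := by
      refine exists_eventually_of_selection (t := t) (A := fun i => ξ ∈ (c i).dom)
        (P := fun j C x =>
          0 < RiemannSphere.gauge ((c j).r x) →
          C * ‖(c j).w x‖ ≤ RiemannSphere.gauge ((c j).r x) →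
          ‖coord ((c i).r x) / coord ((c j).r x) - 1‖ ≤
            C * ‖(c j).w x‖ / RiemannSphere.gauge ((c j).r x)) ?_ (hsel1 ξ hξ) fun j hj hj' => ?_
      · intro j C C' hC x hx h1 h2
        exact (hx h1 (le_trans (by gcongr) h2)).trans (by gcongr)
      obtain ⟨C, hC0, hC⟩ := (c j).exists_norm_coord_div_sub_one_le hιc hj' hξ
        ((c j).contMDiffAt_r hj') ((c i).contMDiffAt_r hi') (by
          filter_upwards [self_mem_nhdsWithin,
            mem_nhdsWithin_of_mem_nhds ((c i).isOpen_dom.mem_nhds hi'),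
            mem_nhdsWithin_of_mem_nhds ((c j).isOpen_dom.mem_nhds hj')] with y hy1 hy2 hy3
          obtain ⟨q, rfl⟩ := hy1
          rw [(c i).r_apply _ hy2, (c j).r_apply _ hy3])
      exact ⟨C, hC⟩
    obtain ⟨C, hC⟩ := hloc
    obtain ⟨C', hC'0, hC'⟩ := (c i).exists_forall_ball hi' hC
    refine ⟨max C C', hC'.mono fun q hq => ⟨hC'0.trans_le (le_max_right _ _), ?_⟩⟩
    intro x hx h1 h2 h3
    have h4 := (hq.2 ((c i).chart x) (h1.trans_le
      (one_div_le_one_div_of_le hC'0 (le_max_right _ _)))).2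
    rw [(c i).chart.left_inv hx] at h4
    exact (h4 h2 (le_trans (by gcongr; exact le_max_left _ _) h3)).trans
      (by gcongr; exact le_max_left _ _)
  obtain ⟨C₃, hC₃⟩ := hE3
  have hE4 : ∃ C, ∀ᶠ q in 𝓝ˢ (range ι), 0 < C ∧ q ∈ (c (sel q)).chart.source ∧
      ball ((c (sel q)).chart q) (1 / C) ⊆ (c (sel q)).chart.target ∧
      ∀ x ∈ (c (sel q)).chart.source, ‖(c (sel q)).chart x - (c (sel q)).chart q‖ < 1 / C →
        (coord ((c (sel q)).r x) ≠ 0 → DifferentiableAt ℂ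
          (fun v => coord ((c (sel q)).r ((c (sel q)).chart.symm v))) ((c (sel q)).chart x)) := by
    have hmono : ∀ (i : OnePoint ℂ) (C C' : ℝ), C ≤ C' → ∀ q,
        (0 < C ∧ q ∈ (c i).chart.source ∧ ball ((c i).chart q) (1 / C) ⊆ (c i).chart.target ∧
          ∀ x ∈ (c i).chart.source, ‖(c i).chart x - (c i).chart q‖ < 1 / C →
          (coord ((c i).r x) ≠ 0 → DifferentiableAt ℂ
            (fun v => coord ((c i).r ((c i).chart.symm v))) ((c i).chart x))) →
        (0 < C' ∧ q ∈ (c i).chart.source ∧ ball ((c i).chart q) (1 / C') ⊆ (c i).chart.target ∧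
          ∀ x ∈ (c i).chart.source, ‖(c i).chart x - (c i).chart q‖ < 1 / C' →
          (coord ((c i).r x) ≠ 0 → DifferentiableAt ℂ
            (fun v => coord ((c i).r ((c i).chart.symm v))) ((c i).chart x))) := by
      rintro i C C' hC q ⟨h0, h1, h2, h3⟩
      have hle := one_div_le_one_div_of_le h0 hC
      exact ⟨h0.trans_le hC, h1, (ball_subset_ball hle).trans h2,
        fun x hx hlt => h3 x hx (hlt.trans_le hle)⟩
    refine hLc.exists_forall_eventually_nhdsSet (fun C C' hC x => hmono _ C C' hC x) fun ξ hξ => ?_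
    refine exists_eventually_of_selection (t := t) (A := fun i => ξ ∈ (c i).dom)
      (P := fun i C q => 0 < C ∧ q ∈ (c i).chart.source ∧
          ball ((c i).chart q) (1 / C) ⊆ (c i).chart.target ∧
          ∀ x ∈ (c i).chart.source, ‖(c i).chart x - (c i).chart q‖ < 1 / C →
          (coord ((c i).r x) ≠ 0 → DifferentiableAt ℂ
            (fun v => coord ((c i).r ((c i).chart.symm v))) ((c i).chart x)))
      (fun i C C' hC x => hmono _ C C' hC x) (hsel1 ξ hξ) fun i hi hi' => ?_
    obtain ⟨C, hC0, hC⟩ := (c i).exists_forall_ball hi' ((c i).isOpen_dom.mem_nhds hi')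
    refine ⟨C, hC.mono fun q hq => ⟨hC0, hq.1, fun v hv => (hq.2 v ?_).1, fun x hx hlt hne => ?_⟩⟩
    · rwa [mem_ball, dist_eq_norm] at hv
    · have hxd : x ∈ (c i).dom := by
        have := (hq.2 _ hlt).2
        rwa [(c i).chart.left_inv hx] at this
      -- `coord` takes the default value 0 at ∞, so its nonvanishing excludes both 0 and the pole.
      have hninf : (c i).r x ≠ OnePoint.infty := fun h0 => hne (by rw [h0, coord_infty])
      exact ((c i).contDiffAt_comp_symm ((contMDiffAt_coord hninf).comp x
        ((c i).contMDiffAt_r hxd)) hx).differentiableAt (by simp)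
  obtain ⟨C₄, hC₄⟩ := hE4
  have hE5 : ∃ C, ∀ᶠ q in 𝓝ˢ (range ι), 0 < C ∧ ∀ x ∈ (c (sel q)).chart.source,
      ‖(c (sel q)).chart x - (c (sel q)).chart q‖ < 1 / C →
      f x ∈ (c (sel (f q))).chart.source ∧
      ‖(c (sel (f q))).chart (f x) - (c (sel (f q))).chart (f q)‖ ≤
        C * ‖(c (sel q)).chart x - (c (sel q)).chart q‖ ∧
      DifferentiableAt ℂ (fun v => (c (sel (f q))).chart (f ((c (sel q)).chart.symm v)))
        ((c (sel q)).chart x) := by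
    have hmono : ∀ (i j : OnePoint ℂ) (C C' : ℝ), C ≤ C' → ∀ q,
        (0 < C ∧ ∀ x ∈ (c i).chart.source, ‖(c i).chart x - (c i).chart q‖ < 1 / C →
          f x ∈ (c j).chart.source ∧ ‖(c j).chart (f x) - (c j).chart (f q)‖ ≤
            C * ‖(c i).chart x - (c i).chart q‖ ∧
          DifferentiableAt ℂ (fun v => (c j).chart (f ((c i).chart.symm v))) ((c i).chart x)) →
        (0 < C' ∧ ∀ x ∈ (c i).chart.source, ‖(c i).chart x - (c i).chart q‖ < 1 / C' →
          f x ∈ (c j).chart.source ∧ ‖(c j).chart (f x) - (c j).chart (f q)‖ ≤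
            C' * ‖(c i).chart x - (c i).chart q‖ ∧
          DifferentiableAt ℂ (fun v => (c j).chart (f ((c i).chart.symm v))) ((c i).chart x)) := by
      rintro i j C C' hC q ⟨h0, h⟩
      refine ⟨h0.trans_le hC, fun x hx hlt => ?_⟩
      obtain ⟨h1, h2, h3⟩ := h x hx (hlt.trans_le (one_div_le_one_div_of_le h0 hC))
      exact ⟨h1, h2.trans (by gcongr), h3⟩
    refine hLc.exists_forall_eventually_nhdsSet (fun C C' hC x => hmono _ _ C C' hC x)
      fun ξ hξ => ?_
    refine exists_eventually_of_selection (t := t) (A := fun i => ξ ∈ (c i).dom)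
      (P := fun i C q => 0 < C ∧ ∀ x ∈ (c i).chart.source,
          ‖(c i).chart x - (c i).chart q‖ < 1 / C →
          f x ∈ (c (sel (f q))).chart.source ∧
          ‖(c (sel (f q))).chart (f x) - (c (sel (f q))).chart (f q)‖ ≤
            C * ‖(c i).chart x - (c i).chart q‖ ∧
          DifferentiableAt ℂ (fun v => (c (sel (f q))).chart (f ((c i).chart.symm v)))
            ((c i).chart x))
      (fun i C C' hC x => hmono _ _ C C' hC x) (hsel1 ξ hξ) fun i hi hi' => ?_
    refine exists_eventually_of_selection (sel := fun x => sel (f x)) (t := t)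
      (A := fun j => f ξ ∈ (c j).dom)
      (P := fun j C q => 0 < C ∧ ∀ x ∈ (c i).chart.source,
          ‖(c i).chart x - (c i).chart q‖ < 1 / C →
          f x ∈ (c j).chart.source ∧ ‖(c j).chart (f x) - (c j).chart (f q)‖ ≤
            C * ‖(c i).chart x - (c i).chart q‖ ∧
          DifferentiableAt ℂ (fun v => (c j).chart (f ((c i).chart.symm v))) ((c i).chart x))
      (fun j C C' hC x => hmono _ _ C C' hC x) (hsel2 ξ hξ) fun j hj hj' => ?_
    have his := (c i).dom_subset hi'
    have hcd : ∀ x ∈ (c i).chart.source, f x ∈ (c j).chart.source →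
        ContMDiffAt 𝓘(ℂ, Cn n) 𝓘(ℂ, Cn n) ω f x →
        ContDiffAt ℂ ω (fun v => (c j).chart (f ((c i).chart.symm v))) ((c i).chart x) :=
      fun x hx hfx hfx' => (c i).contDiffAt_comp_symm (((c j).contMDiffAt_chart hfx).comp x hfx') hx
    obtain ⟨κ, s, hs, hκ⟩ := ((hcd ξ his ((c j).dom_subset hj') (hfat ξ hξ)).of_le
      (by simp : (1 : WithTop ℕ∞) ≤ ω)).exists_lipschitzOnWith
    have hsx : ∀ᶠ x in 𝓝 ξ, (c i).chart x ∈ s :=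
      ((c i).chart.continuousAt his).preimage_mem_nhds hs
    have hfx : ∀ᶠ x in 𝓝 ξ, f x ∈ (c j).chart.source :=
      (hfat ξ hξ).continuousAt.preimage_mem_nhds
        ((c j).chart.open_source.mem_nhds ((c j).dom_subset hj'))
    obtain ⟨C, hC0, hC⟩ := (c i).exists_forall_ball hi' (hsx.and (hfx.and (hself ξ hξ)))
    refine ⟨max C κ, ?_⟩
    filter_upwards [hC, hsx] with q hq hqs
    refine ⟨hC0.trans_le (le_max_left _ _), fun x hx hlt => ?_⟩
    obtain ⟨g1, g2, g3⟩ := (hq.2 _ (hlt.trans_le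
      (one_div_le_one_div_of_le hC0 (le_max_left _ _)))).2
    rw [(c i).chart.left_inv hx] at g1 g2 g3
    refine ⟨g2, ?_, (hcd x hx g2 g3).differentiableAt (by simp)⟩
    have := hκ.norm_sub_le g1 hqs
    simp only [(c i).chart.left_inv hx, (c i).chart.left_inv hq.1] at this
    exact this.trans (by gcongr; exact le_max_right _ _)
  obtain ⟨C₅, hC₅⟩ := hE5
  set C := max 2 (max C₁ (max C₂ (max C₃ (max C₄ C₅)))) with hC
  have hCle : 2 ≤ C ∧ C₁ ≤ C ∧ C₂ ≤ C ∧ C₃ ≤ C ∧ C₄ ≤ C ∧ C₅ ≤ C := by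
    simp only [hC]
    refine ⟨?_, ?_, ?_, ?_, ?_, ?_⟩ <;> simp
  obtain ⟨l0, l1, l2, l3, l4, l5⟩ := hCle
  have hC0 : 0 < C := by linarith
  have hgood : ∀ᶠ x in 𝓝ˢ (range ι), sel x ∈ t ∧ x ∈ K (sel x) :=
    eventually_nhdsSet_iff_forall.2 fun ξ hξ => (hsel ξ hξ).mono fun x hx => hx.1
  have hgoodf : ∀ᶠ x in 𝓝ˢ (range ι), sel (f x) ∈ t ∧ f x ∈ K (sel (f x)) :=
    eventually_nhdsSet_iff_forall.2 fun ξ hξ => (hfat ξ hξ).continuousAt.tendsto.eventually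
      ((hsel _ (hfL hξ)).mono fun x hx => hx.1)
  obtain ⟨ε, hε0, hε⟩ := hbasis _ (hC₁.and (hC₂.and (hC₃.and (hC₄.and (hC₅.and
    (hgoodf.and hf))))))
  -- With D < 1/C one gets D(f x) ≤ C D² ≤ D, which makes the tube forward invariant.
  set η := min ε (1 / C) with hη
  have hη0 : 0 < η := lt_min hε0 (by positivity)
  set N : Set X := {x | (sel x ∈ t ∧ x ∈ K (sel x)) ∧ ‖(c (sel x)).w x‖ < η} with hN
  have hNε : ∀ x ∈ N, _ := fun x hx => hε x hx.1.1 hx.1.2 (hx.2.trans_le (min_le_left _ _))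
  refine ⟨c, sel, N, C, ?_, ?_, ?_, ?_, hr, hD0⟩
  · refine
      { two_le_b := hb, b_le_a := hab, two_le_C := l0, m_eq := fun x => rfl,
        maps := ?_, D_nonneg := fun x => norm_nonneg _, D_comp_le := ?_, mem_source := ?_,
        ball_subset := ?_, ratio := ?_, ratio_chart := ?_, lipschitz := ?_, holo := ?_,
        holo_coord := ?_ }
    · intro x hx
      obtain ⟨h1, -, -, -, -, h6, -⟩ := hNε x hx
      refine ⟨h6, ?_⟩
      have hw0 := norm_nonneg ((c (sel x)).w x)
      have hw1 : C * ‖(c (sel x)).w x‖ ≤ 1 := by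
        have := hx.2.trans_le (min_le_right _ _)
        rw [lt_div_iff₀ hC0] at this; linarith
      have hw2 : ‖(c (sel x)).w x‖ ≤ 1 := by nlinarith
      calc ‖(c (sel (f x))).w (f x)‖ ≤ C₁ * ‖(c (sel x)).w x‖ ^ a := h1
        _ ≤ C * ‖(c (sel x)).w x‖ ^ 2 := by
          gcongr ?_ * ?_
          exact pow_le_pow_of_le_one hw0 hw2 (hb.trans hab)
        _ = (C * ‖(c (sel x)).w x‖) * ‖(c (sel x)).w x‖ := by ring
        _ ≤ 1 * ‖(c (sel x)).w x‖ := by gcongr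
        _ < η := by rw [one_mul]; exact hx.2
    · intro x hx
      obtain ⟨h1, -⟩ := hNε x hx
      exact h1.trans (by gcongr)
    · intro x hx
      exact (c (sel x)).dom_subset ((hK _).2 hx.1.2)
    · intro q hq
      obtain ⟨-, -, -, ⟨h0, -, h2, -⟩, -⟩ := hNε q hq
      exact (ball_subset_ball (one_div_le_one_div_of_le h0 l4)).trans h2
    · intro x hx h1 h2
      obtain ⟨-, h3, -⟩ := hNε x hx
      exact (h3 h1 (le_trans (by gcongr) h2)).trans (by gcongr)
    · intro q hq x hx hlt _ h1 h2
      obtain ⟨-, -, ⟨h0, h3⟩, -⟩ := hNε q hq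
      exact (h3 x hx (hlt.trans_le (one_div_le_one_div_of_le h0 l3)) h1
        (le_trans (by gcongr) h2)).trans (by gcongr)
    · intro q hq x hx hlt
      obtain ⟨-, -, -, -, ⟨h0, h3⟩, -⟩ := hNε q hq
      obtain ⟨g1, g2, -⟩ := h3 x hx (hlt.trans_le (one_div_le_one_div_of_le h0 l5))
      exact ⟨g1, g2.trans (by gcongr)⟩
    · intro q hq x hx hlt
      obtain ⟨-, -, -, -, ⟨h0, h3⟩, -⟩ := hNε q hq
      exact (h3 x hx (hlt.trans_le (one_div_le_one_div_of_le h0 l5))).2.2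
    · intro q hq x hx hlt hne
      obtain ⟨-, -, -, ⟨h0, -, -, h3⟩, -⟩ := hNε q hq
      exact h3 x hx (hlt.trans_le (one_div_le_one_div_of_le h0 l4)) hne
  · refine mem_nhdsSet_iff_forall.2 fun ξ hξ => ?_
    filter_upwards [hsel ξ hξ, (hD0 ξ hξ).eventually_lt_const hη0] with x hx hx'
      using ⟨hx.1, hx'⟩
  · intro x hx
    obtain ⟨-, -, -, -, -, -, h7⟩ := hNε x hx
    exact ⟨(hK _).2 hx.1.2, h7⟩
  · intro V hV
    obtain ⟨ε', hε', h⟩ := hbasis V hV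
    exact ⟨ε', hε', fun x hx hlt => h x hx.1.1 hx.1.2 hlt⟩

end Uniform

/-! ### Real analytic hypersurfaces -/

section Hypersurface

/-- The zero set of a real analytic function with nonzero derivative can be straightened. -/
theorem exists_analytic_straightening {E : Type*} [NormedAddCommGroup E] [NormedSpace ℝ E]
    [FiniteDimensional ℝ E] {h : E → ℝ} {v₀ : E} (hh : AnalyticAt ℝ h v₀)
    (hd : fderiv ℝ h v₀ ≠ 0) {A : Set E} (hA : A ∈ 𝓝 v₀) :
    ∃ (Ψ : OpenPartialHomeomorph E E) (V : Submodule ℝ E), v₀ ∈ Ψ.source ∧ Ψ.source ⊆ A ∧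
      AnalyticOnNhd ℝ Ψ Ψ.source ∧ AnalyticOnNhd ℝ Ψ.symm Ψ.target ∧
      Module.finrank ℝ V + 1 = Module.finrank ℝ E ∧ ∀ v ∈ Ψ.source, h v = 0 ↔ Ψ v ∈ V := by
  have : CompleteSpace E := FiniteDimensional.complete ℝ E
  set l := fderiv ℝ h v₀ with hl
  obtain ⟨u, hu⟩ : ∃ u, l u = 1 := by
    obtain ⟨w, hw⟩ : ∃ w, l w ≠ 0 := by
      by_contra! hc
      exact hd (ContinuousLinearMap.ext hc)
    exact ⟨(l w)⁻¹ • w, by simp [hw]⟩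
  -- Since l u = 1, l(F v) = h v for every v, so F carries the zero set of h into the kernel of l.
  -- Its derivative at v₀ is the identity, so F is a local change of coordinates.
  set F : E → E := fun v => v + (h v - l v) • u with hF
  have hFan : AnalyticAt ℝ F v₀ :=
    analyticAt_id.add ((hh.sub (l.analyticAt v₀)).smul analyticAt_const)
  have hFd : HasFDerivAt F ((ContinuousLinearEquiv.refl ℝ E : E ≃L[ℝ] E) : E →L[ℝ] E) v₀ := by
    have h1 := (hasFDerivAt_id (𝕜 := ℝ) v₀).add
      (((hh.differentiableAt.hasFDerivAt).sub (l.hasFDerivAt (x := v₀))).smul_const u)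
    rw [← hl, sub_self, ContinuousLinearMap.zero_smulRight, add_zero] at h1
    exact h1
  have hstrict : HasStrictFDerivAt F ((ContinuousLinearEquiv.refl ℝ E : E ≃L[ℝ] E) : E →L[ℝ] E)
      v₀ := by
    have := hFan.hasStrictFDerivAt
    rwa [hFd.fderiv] at this
  set R := hstrict.toOpenPartialHomeomorph F with hR
  have hv₀ : v₀ ∈ R.source := hstrict.mem_toOpenPartialHomeomorph_source
  -- The inverse must be analytic on its whole domain, so the source is shrunk to points where the
  -- derivative of F remains invertible.
  have hinv : ∀ᶠ v in 𝓝 v₀, fderiv ℝ F v ∈ range ((↑) : (E ≃L[ℝ] E) → E →L[ℝ] E) := by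
    refine hFan.fderiv.continuousAt.preimage_mem_nhds ?_
    rw [hFd.fderiv]
    exact ContinuousLinearEquiv.nhds _
  obtain ⟨O, hO, hOo, hv₀O⟩ := eventually_nhds_iff.1
    (hFan.eventually_analyticAt.and (hinv.and (Filter.eventually_mem_set.2 hA)))
  have hcoe : ∀ v, (R.restrOpen O hOo) v = F v := fun v => rfl
  have hsrc : (R.restrOpen O hOo).source = R.source ∩ O := R.restrOpen_source O hOo
  refine ⟨R.restrOpen O hOo, LinearMap.ker l.toLinearMap, ?_, ?_, ?_, ?_, ?_, ?_⟩
  · rw [hsrc]; exact ⟨hv₀, hv₀O⟩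
  · rw [hsrc]; exact fun v hv => (hO v hv.2).2.2
  · rw [hsrc]; exact fun v hv => (hO v hv.2).1
  · intro y hy
    have hmem : (R.restrOpen O hOo).symm y ∈ O := by
      have := (R.restrOpen O hOo).map_target hy
      rw [hsrc] at this
      exact this.2
    obtain ⟨h1, ⟨i, hi⟩, -⟩ := hO _ hmem
    exact (R.restrOpen O hOo).analyticAt_symm (i := i) hy h1 hi.symm
  · refine Module.Dual.finrank_ker_add_one_of_ne_zero (f := l.toLinearMap) ?_
    intro h0
    exact hd (ContinuousLinearMap.coe_injective h0)
  · intro v _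
    rw [hcoe, LinearMap.mem_ker]
    simp [hF, hu]

/-- In a direction where the complex derivative of G takes the value G(v₀), the real derivative of
|G|² is 2|G(v₀)|², which is nonzero. -/
theorem analyticAt_normSq_sub_one {E : Type*} [NormedAddCommGroup E] [NormedSpace ℂ E]
    [NormedSpace ℝ E] [IsScalarTower ℝ ℂ E] {G : E → ℂ} {v₀ : E} (hG : AnalyticAt ℂ G v₀)
    (hd : fderiv ℂ G v₀ ≠ 0) (h0 : G v₀ ≠ 0) :
    AnalyticAt ℝ (fun v => (G v).re ^ 2 + (G v).im ^ 2 - 1) v₀ ∧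
      fderiv ℝ (fun v => (G v).re ^ 2 + (G v).im ^ 2 - 1) v₀ ≠ 0 := by
  have hGR : AnalyticAt ℝ G v₀ := hG.restrictScalars
  have hre : AnalyticAt ℝ (fun v => (G v).re) v₀ := (Complex.reCLM.analyticAt _).comp hGR
  have him : AnalyticAt ℝ (fun v => (G v).im) v₀ := (Complex.imCLM.analyticAt _).comp hGR
  refine ⟨((hre.pow 2).add (him.pow 2)).sub analyticAt_const, ?_⟩
  have hGd : HasFDerivAt G ((fderiv ℂ G v₀).restrictScalars ℝ) v₀ :=
    hG.differentiableAt.hasFDerivAt.restrictScalars ℝ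
  have h1 : HasFDerivAt (fun v => (G v).re)
      (Complex.reCLM.comp ((fderiv ℂ G v₀).restrictScalars ℝ)) v₀ :=
    Complex.reCLM.hasFDerivAt.comp v₀ hGd
  have h2 : HasFDerivAt (fun v => (G v).im)
      (Complex.imCLM.comp ((fderiv ℂ G v₀).restrictScalars ℝ)) v₀ :=
    Complex.imCLM.hasFDerivAt.comp v₀ hGd
  have h3 := ((h1.pow 2).add (h2.pow 2)).sub_const 1
  change HasFDerivAt (fun v => (G v).re ^ 2 + (G v).im ^ 2 - 1) _ v₀ at h3
  rw [h3.fderiv]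
  obtain ⟨w, hw⟩ : ∃ w, fderiv ℂ G v₀ w ≠ 0 := by
    by_contra! hc
    exact hd (ContinuousLinearMap.ext hc)
  intro hzero
  have h4 := DFunLike.congr_fun hzero ((G v₀ / fderiv ℂ G v₀ w) • w)
  have h5 : fderiv ℂ G v₀ ((G v₀ / fderiv ℂ G v₀ w) • w) = G v₀ := by
    rw [map_smul, smul_eq_mul, div_mul_cancel₀ _ hw]
  simp only [add_apply, smul_apply, ContinuousLinearMap.comp_apply,
    ContinuousLinearMap.coe_restrictScalars', h5, Complex.reCLM_apply, Complex.imCLM_apply,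
    zero_apply, smul_eq_mul] at h4
  have h6 : 0 < (G v₀).re * (G v₀).re + (G v₀).im * (G v₀).im := by
    have := Complex.normSq_pos.2 h0
    rwa [Complex.normSq_apply] at this
  norm_num at h4
  nlinarith

theorem finrank_real_Cn (n : ℕ) : Module.finrank ℝ (Cn n) = 2 * n := by
  rw [← Module.finrank_mul_finrank ℝ ℂ (Cn n), Complex.finrank_real_complex,
    finrank_euclideanSpace_fin]

end Hypersurface

/-- Turns disjointness of the line from `indet` into holomorphy of f on an open neighbourhood of the
line. -/
theorem IsAnalyticSubset.isClosed {E H M : Type*} [NormedAddCommGroup E] [NormedSpace ℂ E]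
    [TopologicalSpace H] {I : ModelWithCorners ℂ E H} [TopologicalSpace M] [ChartedSpace H M]
    {A : Set M} (hA : IsAnalyticSubset I A) : IsClosed A := by
  rw [← isOpen_compl_iff, isOpen_iff_mem_nhds]
  intro x hx
  obtain ⟨U, hU, hxU, k, g, hg, hgA⟩ := hA x
  have h1 : ∃ i, g i x ≠ 0 := by
    by_contra! hc
    exact hx ((hgA x hxU).2 hc)
  obtain ⟨i, hi⟩ := h1
  have h2 : ContinuousAt (g i) x := (hg i).continuousOn.continuousAt (hU.mem_nhds hxU)
  filter_upwards [hU.mem_nhds hxU, h2.eventually_ne hi] with y hyU hy hyA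
  exact hy ((hgA y hyU).1 hyA i)

/-! ### Change of charts -/

theorem comp_symm_eventuallyEq {X E F : Type*} [TopologicalSpace X] [TopologicalSpace E]
    [TopologicalSpace F] {e : OpenPartialHomeomorph X E} {e' : OpenPartialHomeomorph X F} {p : X}
    (φ : X → ℂ) (hp : p ∈ e.source) (hp' : p ∈ e'.source) :
    φ ∘ e.symm =ᶠ[𝓝 (e p)] (φ ∘ e'.symm) ∘ (e' ∘ e.symm) := by
  have h1 : Tendsto e.symm (𝓝 (e p)) (𝓝 p) := by
    have := (e.continuousAt_symm (e.map_source hp)).tendsto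
    rwa [e.left_inv hp] at this
  filter_upwards [h1.eventually (e'.open_source.mem_nhds hp')] with v hv
  simp only [Function.comp_apply, e'.left_inv hv]

section ChangeOfCharts

variable {n : ℕ} {X : Type*} [TopologicalSpace X] [ChartedSpace (Cn n) X]
  {e e' : OpenPartialHomeomorph X (Cn n)} {p : X}

theorem differentiableAt_transition (he : e ∈ IsManifold.maximalAtlas 𝓘(ℂ, Cn n) ω X)
    (he' : e' ∈ IsManifold.maximalAtlas 𝓘(ℂ, Cn n) ω X) (hp : p ∈ e.source) (hp' : p ∈ e'.source) :
    DifferentiableAt ℂ (e' ∘ e.symm) (e p) := by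
  have h1 : ContMDiffAt 𝓘(ℂ, Cn n) 𝓘(ℂ, Cn n) ω e.symm (e p) :=
    (contMDiffOn_symm_of_mem_maximalAtlas he).contMDiffAt
      (e.open_target.mem_nhds (e.map_source hp))
  have h2 : ContMDiffAt 𝓘(ℂ, Cn n) 𝓘(ℂ, Cn n) ω e' (e.symm (e p)) := by
    rw [e.left_inv hp]
    exact (contMDiffOn_of_mem_maximalAtlas he').contMDiffAt (e'.open_source.mem_nhds hp')
  exact (contMDiffAt_iff_contDiffAt.1 (h2.comp _ h1)).differentiableAt (by simp)

theorem DifferentiableAt.change_chart {φ : X → ℂ}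
    (h : DifferentiableAt ℂ (φ ∘ e'.symm) (e' p))
    (he : e ∈ IsManifold.maximalAtlas 𝓘(ℂ, Cn n) ω X)
    (he' : e' ∈ IsManifold.maximalAtlas 𝓘(ℂ, Cn n) ω X) (hp : p ∈ e.source) (hp' : p ∈ e'.source) :
    DifferentiableAt ℂ (φ ∘ e.symm) (e p) := by
  refine DifferentiableAt.congr_of_eventuallyEq ?_ (comp_symm_eventuallyEq φ hp hp')
  refine DifferentiableAt.comp _ ?_ (differentiableAt_transition he he' hp hp')
  simpa [e.left_inv hp] using h

theorem fderiv_change_chart_ne_zero {φ : X → ℂ}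
    (h : DifferentiableAt ℂ (φ ∘ e'.symm) (e' p))
    (he : e ∈ IsManifold.maximalAtlas 𝓘(ℂ, Cn n) ω X)
    (he' : e' ∈ IsManifold.maximalAtlas 𝓘(ℂ, Cn n) ω X) (hp : p ∈ e.source) (hp' : p ∈ e'.source)
    (hne : fderiv ℂ (φ ∘ e.symm) (e p) ≠ 0) : fderiv ℂ (φ ∘ e'.symm) (e' p) ≠ 0 := by
  intro h0
  apply hne
  have hpt : (e' ∘ e.symm) (e p) = e' p := by simp [e.left_inv hp]
  rw [(comp_symm_eventuallyEq φ hp hp').fderiv_eq, fderiv_comp, hpt, h0,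
    ContinuousLinearMap.zero_comp]
  · rwa [hpt]
  · exact differentiableAt_transition he he' hp hp'

end ChangeOfCharts

/-! ### The local stable set as a level set of the modulus of the Böttcher coordinate -/

section StableSet

namespace ConeData

variable {X E J : Type*} [TopologicalSpace X] [NormedAddCommGroup E] [NormedSpace ℂ E]
  {f : X → X} {a b : ℕ} {e : J → OpenPartialHomeomorph X E} {ζ : J → X → ℂ} {sel : X → J}
  {D : X → ℝ} {Z : X → ℂ} {m : X → ℝ} {N : Set X} {C : ℝ}
  (h : ConeData f a b e ζ sel D Z m N C)
include h

/-- The modulus along the orbit is |φ x|^{b^k}, which tends to 0 or to infinity unless |φ x| = 1. -/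
theorem norm_bottcher_eq_one {x : X} (hx : x ∈ cone b D m N C)
    (hlim : Tendsto (fun k => ‖bottcher f b Z (f^[k] x)‖) atTop (𝓝 1)) :
    ‖bottcher f b Z x‖ = 1 := by
  have hpow : Tendsto (fun k : ℕ => b ^ k) atTop atTop :=
    tendsto_pow_atTop_atTop_of_one_lt h.two_le_b
  simp only [h.bottcher_iterate hx, norm_pow] at hlim
  rcases lt_trichotomy ‖bottcher f b Z x‖ 1 with h1 | h1 | h1
  · have h2 := (tendsto_pow_atTop_nhds_zero_of_lt_one (norm_nonneg _) h1).comp hpow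
    exact absurd (tendsto_nhds_unique hlim h2) one_ne_zero
  · exact h1
  · have h2 := (tendsto_pow_atTop_atTop_of_one_lt h1).comp hpow
    exact absurd hlim (not_tendsto_nhds_of_tendsto_atTop h2 1)

/-- If |φ x| = 1, then |Z x| is the exponential of minus the real part of the correction, which is
O(D); so Z x is nearly unimodular when D x is small. -/
theorem one_sub_m_le {x : X} (hx : x ∈ cone b D m N C) (h1 : ‖bottcher f b Z x‖ = 1) :
    1 - m x ≤ 2 * C * 2 ^ b * D x := by
  have hC := h.C_pos
  have hD := h.D_nonneg x
  set t := (correction f b Z x).re with ht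
  have habs : |t| ≤ 2 * C * (D x / m x ^ b) :=
    (Complex.abs_re_le_norm _).trans (h.norm_correction_le hx)
  have hZ : ‖Z x‖ = Real.exp (-t) := by
    rw [bottcher, norm_mul, Complex.norm_exp] at h1
    rw [Real.exp_neg]
    exact eq_inv_of_mul_eq_one_left h1
  have hm : 1 - |t| ≤ m x := by
    rw [h.m_eq, hZ, ← Real.exp_neg, neg_neg]
    refine le_min ?_ ?_
    · linarith [Real.add_one_le_exp (-t), le_abs_self t]
    · linarith [Real.add_one_le_exp t, neg_abs_le t]
  have hhalf : 1 / 2 ≤ m x := by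
    have := h.C_mul_slope_le hx
    have := h.C_mul_aperture_le
    linarith
  have h2 : D x / m x ^ b ≤ 2 ^ b * D x := by
    rw [div_le_iff₀ (m_pow_pos hx)]
    have : (1 : ℝ) ≤ 2 ^ b * m x ^ b := by
      rw [← mul_pow]; exact one_le_pow₀ (by linarith)
    nlinarith
  have h3 : 2 * C * (D x / m x ^ b) ≤ 2 * C * (2 ^ b * D x) := by gcongr
  linarith

theorem D_iterate_le {x : X} (hx : x ∈ cone b D m N C) (k : ℕ) :
    D (f^[k] x) ≤ D x * (1 / 2) ^ k := by
  induction k with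
  | zero => simp
  | succ k ih =>
    rw [Function.iterate_succ_apply', pow_succ]
    linarith [h.D_comp_le_half (h.iterate_mem_cone hx k)]

/-- Points of the cone close to the line on which the Böttcher coordinate is unimodular lie in a
given neighbourhood `Ω` of the circle. -/
theorem exists_mem_of_norm_bottcher_eq_one {L Ω : Set X} {η : ℝ} (hη : 0 < η)
    (hΩ : ∀ᶠ x in 𝓝ˢ L, 1 - η < m x → x ∈ Ω)
    (hbasis : ∀ V ∈ 𝓝ˢ L, ∃ ε > 0, ∀ x ∈ N, D x < ε → x ∈ V) :
    ∃ δ > 0, ∀ x ∈ cone b D m N C, D x < δ → ‖bottcher f b Z x‖ = 1 → x ∈ Ω := by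
  have hC := h.C_pos
  obtain ⟨ε, hε, hεV⟩ := hbasis _ hΩ
  refine ⟨min ε (η / (2 * C * 2 ^ b)), by positivity, fun x hx hD hn => ?_⟩
  refine hεV x hx.1 (hD.trans_le (min_le_left _ _)) ?_
  have h1 := h.one_sub_m_le hx hn
  have h2 := hD.trans_le (min_le_right _ _)
  rw [lt_div_iff₀ (by positivity)] at h2
  linarith

/-- Near each of its points, the local stable set is the level set where the Böttcher coordinate is
unimodular. -/
theorem eventually_mem_localStableSet_iff {S Ω : Set X} (hΩ : IsOpen Ω) (hSΩ : S ⊆ Ω)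
    (hΩc : Ω ⊆ cone b D m N C) (hf : ∀ x ∈ N, ContinuousAt f x)
    (hlim : Tendsto (fun x => ‖bottcher f b Z x‖) (𝓝ˢ S) (𝓝 1))
    (hD : ∀ ξ ∈ S, Tendsto D (𝓝 ξ) (𝓝 0))
    (hmem : ∀ V : Set X, IsOpen V → S ⊆ V → ∃ δ > 0, ∀ x ∈ cone b D m N C, D x < δ →
      ‖bottcher f b Z x‖ = 1 → x ∈ V) {p : X} (hp : p ∈ localStableSet f S Ω) :
    (∀ x ∈ localStableSet f S Ω, ‖bottcher f b Z x‖ = 1) ∧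
      ∀ᶠ x in 𝓝 p, x ∈ localStableSet f S Ω ↔ ‖bottcher f b Z x‖ = 1 := by
  have hone : ∀ x ∈ localStableSet f S Ω, ‖bottcher f b Z x‖ = 1 := fun x hx =>
    h.norm_bottcher_eq_one (hΩc (hx.1 0)) (hlim.comp hx.2)
  refine ⟨hone, ?_⟩
  obtain ⟨δ, hδ, hδΩ⟩ := hmem Ω hΩ hSΩ
  have hT : {x | x ∈ cone b D m N C ∧ D x < δ} ∈ 𝓝ˢ S := by
    rw [mem_nhdsSet_iff_forall]
    intro ξ hξ
    filter_upwards [hΩ.mem_nhds (hSΩ hξ), (hD ξ hξ).eventually_lt_const hδ] with x hx hx'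
    exact ⟨hΩc hx, hx'⟩
  obtain ⟨O, hO, hSO, hOT⟩ := mem_nhdsSet_iff_exists.1 hT
  -- At time K the orbit of p has entered the region where D < δ. Staying in Ω up to time K is an
  -- open condition on the starting point; afterwards |φ| = 1 and the decay of D keep the orbit in
  -- Ω.
  obtain ⟨K, hK⟩ := (hp.2.eventually (hO.mem_nhdsSet.2 hSO)).exists
  have hcont : ∀ j, ContinuousAt f^[j] p := fun j => by
    induction j with
    | zero => exact continuousAt_id
    | succ j ih =>
      rw [Function.iterate_succ']
      exact (hf _ (hΩc (hp.1 j)).1).comp ih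
  have h1 : ∀ᶠ x in 𝓝 p, ∀ j ∈ Finset.range (K + 1), f^[j] x ∈ Ω := by
    rw [Filter.eventually_all_finset]
    exact fun j _ => (hcont j).preimage_mem_nhds (hΩ.mem_nhds (hp.1 j))
  filter_upwards [h1, (hcont K).preimage_mem_nhds (hO.mem_nhds hK)] with x hxΩ hxK
  refine ⟨hone x, fun hx1 => ?_⟩
  have hxc : x ∈ cone b D m N C := hΩc (hxΩ 0 (by simp))
  obtain ⟨-, hyδ⟩ := hOT hxK
  have hn : ∀ k, ‖bottcher f b Z (f^[k] x)‖ = 1 := fun k => by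
    rw [h.bottcher_iterate hxc, norm_pow, hx1, one_pow]
  have hmono : ∀ i, D (f^[i + K] x) ≤ D (f^[K] x) * (1 / 2) ^ i := fun i => by
    rw [Function.iterate_add_apply]
    exact h.D_iterate_le (h.iterate_mem_cone hxc K) i
  refine ⟨fun k => ?_, ?_⟩
  · rcases le_or_gt k K with hk | hk
    · exact hxΩ k (by simp; omega)
    · obtain ⟨i, rfl⟩ := Nat.exists_eq_add_of_le' hk.le
      refine hδΩ _ (h.iterate_mem_cone hxc _) (lt_of_le_of_lt (hmono i) ?_) (hn _)
      refine lt_of_le_of_lt (mul_le_of_le_one_right (h.D_nonneg _) ?_) hyδ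
      exact pow_le_one₀ (by norm_num) (by norm_num)
  -- Convergence uses `hmem` again, with an arbitrary open neighbourhood of S in place of Ω.
  · rw [← tendsto_add_atTop_iff_nat K]
    intro V hV
    obtain ⟨V', hV', hSV', hVV'⟩ := mem_nhdsSet_iff_exists.1 hV
    obtain ⟨δ', hδ', hmemV⟩ := hmem V' hV' hSV'
    have hlim0 : Tendsto (fun i : ℕ => D (f^[K] x) * (1 / 2 : ℝ) ^ i) atTop (𝓝 0) := by
      simpa using (tendsto_pow_atTop_nhds_zero_of_lt_one (r := (1 / 2 : ℝ)) (by norm_num)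
        (by norm_num)).const_mul (D (f^[K] x))
    change ∀ᶠ i in atTop, f^[i + K] x ∈ V
    filter_upwards [hlim0.eventually_lt_const hδ'] with i hi
    exact hVV' (hmemV _ (h.iterate_mem_cone hxc _) ((hmono i).trans_lt hi) (hn _))

end ConeData

namespace RiemannSphere

theorem gauge_eq_one {q : OnePoint ℂ} (hq : q ∈ unitCircle) : RiemannSphere.gauge q = 1 := by
  obtain ⟨z, hz, rfl⟩ := hq
  have : ‖z‖ = 1 := by simpa using hz
  simp [RiemannSphere.gauge, this]

theorem gauge_lt_one {q : OnePoint ℂ} (hq : q ∉ unitCircle) : RiemannSphere.gauge q < 1 := by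
  induction q using OnePoint.rec with
  | infty => simp [RiemannSphere.gauge]
  | coe z =>
    have hz : ‖z‖ ≠ 1 := fun h => hq ⟨z, by simpa using h, rfl⟩
    rw [RiemannSphere.gauge, coord_coe, min_lt_iff]
    rcases lt_or_gt_of_ne hz with h | h
    · exact Or.inl h
    · exact Or.inr (inv_lt_one_of_one_lt₀ h)

/-- Points near the line at which the gauge is close to `1` are close to the circle. -/
theorem exists_eventually_mem_of_gauge {X : Type*} [TopologicalSpace X] {ι : OnePoint ℂ → X}
    (hι : Continuous ι) {m : X → ℝ}
    (hm : ∀ q, Tendsto m (𝓝 (ι q)) (𝓝 (RiemannSphere.gauge q))) {Ω : Set X} (hΩ : IsOpen Ω)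
    (hS : ι '' unitCircle ⊆ Ω) :
    ∃ η > 0, ∀ᶠ x in 𝓝ˢ (range ι), 1 - η < m x → x ∈ Ω := by
  have := (isCompact_range hι).exists_forall_eventually_nhdsSet
    (P := fun C x => 0 < C ∧ (1 - 1 / C < m x → x ∈ Ω)) ?_ ?_
  · obtain ⟨C, hC⟩ := this
    have hC0 : 0 < C := by
      have := (eventually_nhdsSet_iff_forall.1 hC (ι OnePoint.infty) (mem_range_self _))
      exact this.self_of_nhds.1
    exact ⟨1 / C, by positivity, hC.mono fun x hx => hx.2⟩
  · rintro C C' hCC' x ⟨hC, hx⟩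
    refine ⟨hC.trans_le hCC', fun h => hx (lt_of_le_of_lt ?_ h)⟩
    have := one_div_le_one_div_of_le hC hCC'
    linarith
  · rintro _ ⟨q, rfl⟩
    by_cases hq : q ∈ unitCircle
    · refine ⟨1, ?_⟩
      filter_upwards [hΩ.mem_nhds (hS ⟨q, hq, rfl⟩)] with x hx using ⟨one_pos, fun _ => hx⟩
    · have h1 := gauge_lt_one hq
      set g := RiemannSphere.gauge q
      -- With this constant the threshold 1 - 1/C is (1 + g)/2, which m stays below near ι q, so the
      -- implication is vacuous there.
      refine ⟨2 / (1 - g), ?_⟩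
      filter_upwards [(hm q).eventually_lt_const (u := (1 + g) / 2) (by linarith)] with x hx
      have h2 : 0 < 1 - g := by linarith
      refine ⟨by positivity, fun h3 => ?_⟩
      rw [one_div_div] at h3
      linarith

end RiemannSphere

end StableSet

/-! ### From a holomorphic submersion to a real analytic hypersurface -/

section LevelSet

variable {n : ℕ} {X : Type*} [TopologicalSpace X] [ChartedSpace (Cn n) X]

/-- A level set `{|φ| = 1}` of a holomorphic submersion is a real analytic hypersurface. -/
theorem isRealAnalyticSubmanifold_of_eventually_iff [IsManifold 𝓘(ℂ, Cn n) ω X] {W : Set X}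
    {φ : X → ℂ}
    (h : ∀ p ∈ W, ‖φ p‖ = 1 ∧ (∀ᶠ x in 𝓝 p, x ∈ W ↔ ‖φ x‖ = 1) ∧
      AnalyticAt ℂ (φ ∘ (chartAt (Cn n) p).symm) (chartAt (Cn n) p p) ∧
      fderiv ℂ (φ ∘ (chartAt (Cn n) p).symm) (chartAt (Cn n) p p) ≠ 0) :
    IsRealAnalyticSubmanifold (Cn n) (2 * n - 1) W := by
  intro p hp
  obtain ⟨h1, h2, h3, h4⟩ := h p hp
  set c := chartAt (Cn n) p
  have hpc : p ∈ c.source := mem_chart_source _ _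
  have h0 : (φ ∘ c.symm) (c p) ≠ 0 := by
    rw [Function.comp_apply, c.left_inv hpc]
    intro h0
    simp [h0] at h1
  obtain ⟨han, hd⟩ := analyticAt_normSq_sub_one h3 h4 h0
  have hA : {v | v ∈ c.target ∧ (c.symm v ∈ W ↔ ‖φ (c.symm v)‖ = 1)} ∈ 𝓝 (c p) := by
    have ht : Tendsto c.symm (𝓝 (c p)) (𝓝 p) := by
      have := (c.continuousAt_symm (c.map_source hpc)).tendsto
      rwa [c.left_inv hpc] at this
    filter_upwards [c.open_target.mem_nhds (c.map_source hpc), ht.eventually h2] with v hv hv'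
    exact ⟨hv, hv'⟩
  obtain ⟨Ψ, V, hs, hsub, ha1, ha2, hV, hiff⟩ := exists_analytic_straightening han hd hA
  refine ⟨Ψ, V, hs, fun v hv => (hsub hv).1, ha1, ha2, ?_, fun v hv => ?_⟩
  · rw [finrank_real_Cn] at hV
    omega
  · rw [(hsub hv).2, ← hiff v hv, Function.comp_apply, sub_eq_zero, sq, sq,
      ← Complex.normSq_apply, Complex.normSq_eq_norm_sq]
    exact (pow_eq_one_iff_of_nonneg (norm_nonneg _) two_ne_zero).symm

end LevelSet

end

/-! ### The main theorem -/

theorem theoremA {n : ℕ} (hn : 1 < n)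
    {X : Type*} [TopologicalSpace X] [T2Space X] [CompactSpace X] [ConnectedSpace X]
    [ChartedSpace (Cn n) X] [IsManifold 𝓘(ℂ, Cn n) ω X]
    -- the dominant meromorphic map `f : X ⇢ X`
    (f : MeromorphicSelfMap n X) (hf : f.IsDominant)
    -- the embedded projective line `L = range ι`, near which `f` is holomorphic
    (ι : OnePoint ℂ → X) (hι : Manifold.IsSmoothEmbedding 𝓘(ℂ) 𝓘(ℂ, Cn n) ω ι)
    (hhol : Disjoint (range ι) f.indet)
    (a b : ℕ) (hb : 2 ≤ b)
    -- `L` is invariant and `f` restricted to `L` is conjugate to `z ↦ z ^ b`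
    (hconj : ∀ p : OnePoint ℂ, f.toFun (ι p) = ι (RiemannSphere.powMap b p))
    (htrans : IsTransversallySuperattracting n f.toFun (range ι) a)
    (hab : b ≤ a) :
    -- for every sufficiently small open neighbourhood `Ω` of the invariant circle
    ∃ Ω₀ : Set X, IsOpen Ω₀ ∧ ι '' RiemannSphere.unitCircle ⊆ Ω₀ ∧
      ∀ Ω : Set X, IsOpen Ω → ι '' RiemannSphere.unitCircle ⊆ Ω → Ω ⊆ Ω₀ →
        IsRealAnalyticSubmanifold (Cn n) (2 * n - 1)
          (localStableSet f.toFun (ι '' RiemannSphere.unitCircle) Ω) := by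
  have hindet : IsOpen f.indetᶜ := f.isAnalyticSubset_indet.isClosed.isOpen_compl
  have hfL : ∀ᶠ x in 𝓝ˢ (range ι), ContMDiffAt 𝓘(ℂ, Cn n) 𝓘(ℂ, Cn n) ω f.toFun x := by
    filter_upwards [hindet.mem_nhdsSet.2 hhol.subset_compl_right] with x hx
    exact f.holomorphic.contMDiffAt (hindet.mem_nhds hx)
  obtain ⟨c, sel, N, C, h, hN, hNdom, hbasis, hr, hD⟩ := exists_coneData hι hb hab hfL hconj htrans
  set F := f.toFun
  set D : X → ℝ := fun x => ‖(c (sel x)).w x‖ with hDdef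
  set Z : X → ℂ := fun x => RiemannSphere.coord ((c (sel x)).r x) with hZdef
  set m : X → ℝ := fun x => RiemannSphere.gauge ((c (sel x)).r x) with hmdef
  set φ : X → ℂ := ConeData.bottcher F b Z with hφ
  set S : Set X := ι '' RiemannSphere.unitCircle with hS
  have hm : ∀ q, Tendsto m (𝓝 (ι q)) (𝓝 (RiemannSphere.gauge q)) := fun q =>
    (RiemannSphere.continuous_gauge.tendsto q).comp (hr q)
  have hNat : ∀ q, N ∈ 𝓝 (ι q) := fun q => mem_nhdsSet_iff_forall.1 hN _ (mem_range_self q)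
  -- the circle lies in the interior of the cone
  have hcone : ∀ q ∈ RiemannSphere.unitCircle, ∀ᶠ x in 𝓝 (ι q),
      x ∈ ConeData.cone b D m N C ∧ ‖Z x‖ ≤ 2 := by
    intro q hq
    have hg := RiemannSphere.gauge_eq_one hq
    have h1 : ∀ᶠ x in 𝓝 (ι q), 1 / 2 < m x :=
      (hm q).eventually_const_lt (by rw [hg]; norm_num)
    have h2 : ∀ᶠ x in 𝓝 (ι q), D x < ConeData.aperture b C * (1 / 2) ^ b :=
      (hD _ (mem_range_self q)).eventually_lt_const (by have := h.aperture_pos; positivity)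
    filter_upwards [hNat q, h1, h2] with x hxN hx1 hx2
    refine ⟨⟨hxN, by linarith, hx2.trans_le ?_⟩, ?_⟩
    · have := h.aperture_pos
      gcongr
    · have h3 : m x ≤ ‖Z x‖⁻¹ := min_le_right _ _
      have h4 : (1 / 2 : ℝ) ≤ ‖Z x‖⁻¹ := by linarith
      have h5 : 0 < ‖Z x‖ := inv_pos.1 (by linarith)
      rw [one_div, inv_le_inv₀ (by norm_num) h5] at h4
      exact h4
  -- The bound on ‖Z‖ only ensures that φ is bounded, as the approximation by holomorphic models
  -- requires.
  set U : Set X := interior {x | x ∈ ConeData.cone b D m N C ∧ ‖Z x‖ ≤ 2} with hU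
  have hUo : IsOpen U := isOpen_interior
  have hSU : S ⊆ U := by
    rintro _ ⟨q, hq, rfl⟩
    exact mem_interior_iff_mem_nhds.2 (hcone q hq)
  have hUc : ∀ x ∈ U, x ∈ ConeData.cone b D m N C := fun x hx => (interior_subset hx).1
  -- the Böttcher coordinate is holomorphic near the circle
  have hdiff : ∀ p ∈ U, ∀ e ∈ IsManifold.maximalAtlas 𝓘(ℂ, Cn n) ω X, p ∈ e.source →
      DifferentiableAt ℂ (φ ∘ e.symm) (e p) := by
    intro p hp e he hpe
    have h1 := h.differentiableAt_bottcher (hUc p hp).1 (mem_interior_iff_mem_nhds.1 hp)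
    exact DifferentiableAt.change_chart (e' := (c (sel p)).chart) h1 he (c (sel p)).chart_mem hpe
      (h.mem_source p (hUc p hp).1)
  have hana : ∀ p ∈ U, ∀ e ∈ IsManifold.maximalAtlas 𝓘(ℂ, Cn n) ω X, p ∈ e.source →
      AnalyticAt ℂ (φ ∘ e.symm) (e p) := by
    intro p hp e he hpe
    refine DifferentiableOn.analyticOnNhd_of_finiteDimensional (s := e.target ∩ e.symm ⁻¹' U) ?_
      (e.isOpen_inter_preimage_symm hUo) _ ⟨e.map_source hpe, ?_⟩
    · rintro v ⟨hv, hvU⟩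
      have := hdiff _ hvU e he (e.map_target hv)
      rw [e.right_inv hv] at this
      exact this.differentiableWithinAt
    · rwa [mem_preimage, e.left_inv hpe]
  -- On the line D = 0, so the correction vanishes and φ is the affine coordinate.
  have hφι : ∀ q, ι q ∈ ConeData.cone b D m N C → φ (ι q) = RiemannSphere.coord q := by
    intro q hq
    have hdom := (hNdom _ hq.1).1
    have hD0 : D (ι q) = 0 := norm_eq_zero.2 (((c _).w_eq_zero_iff hdom).2 (mem_range_self q))
    have h1 := h.norm_correction_le hq
    rw [hD0, zero_div, mul_zero, norm_le_zero_iff] at h1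
    rw [hφ, ConeData.bottcher, h1, Complex.exp_zero, mul_one]
    exact congrArg RiemannSphere.coord ((c _).r_apply q hdom)
  have hφc : ∀ p ∈ U, ContinuousAt φ p := by
    intro p hp
    have hps : p ∈ (chartAt (Cn n) p).source := mem_chart_source _ _
    have h1 := (hdiff p hp _ (IsManifold.chart_mem_maximalAtlas p) hps).continuousAt.comp
      ((chartAt (Cn n) p).continuousAt hps)
    refine h1.congr ?_
    filter_upwards [(chartAt (Cn n) p).open_source.mem_nhds hps] with x hx
    simp only [Function.comp_apply, (chartAt (Cn n) p).left_inv hx]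
  have hlim : Tendsto (fun x => ‖φ x‖) (𝓝ˢ S) (𝓝 1) := by
    intro V hV
    change {x | ‖φ x‖ ∈ V} ∈ 𝓝ˢ S
    rw [mem_nhdsSet_iff_forall]
    rintro _ ⟨q, hq, rfl⟩
    have hqU : ι q ∈ U := hSU ⟨q, hq, rfl⟩
    have h1 : ‖φ (ι q)‖ = 1 := by
      rw [hφι q (hUc _ hqU)]
      obtain ⟨z, hz, rfl⟩ := hq
      simpa using hz
    refine (hφc _ hqU).norm.preimage_mem_nhds ?_
    rwa [h1]
  -- it is a submersion near the circle
  have hsub : ∀ ξ ∈ S, ∀ᶠ x in 𝓝 ξ, fderiv ℂ (φ ∘ (chartAt (Cn n) ξ).symm)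
      (chartAt (Cn n) ξ x) ≠ 0 := by
    rintro _ ⟨_, ⟨z, hz, rfl⟩, rfl⟩
    set ξ := ι (z : OnePoint ℂ) with hξ
    have hξU : ξ ∈ U := hSU ⟨_, ⟨z, hz, rfl⟩, rfl⟩
    set e := chartAt (Cn n) ξ
    have he : e ∈ IsManifold.maximalAtlas 𝓘(ℂ, Cn n) ω X := IsManifold.chart_mem_maximalAtlas ξ
    have hξe : ξ ∈ e.source := mem_chart_source _ _
    have hιz : ContMDiffAt 𝓘(ℂ) 𝓘(ℂ, Cn n) ω (fun w : ℂ => ι (w : OnePoint ℂ)) z :=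
      (hι.contMDiff.comp RiemannSphere.contMDiff_coe).contMDiffAt
    have hg : DifferentiableAt ℂ (fun w : ℂ => e (ι (w : OnePoint ℂ))) z := by
      have h1 : ContMDiffAt 𝓘(ℂ, Cn n) 𝓘(ℂ, Cn n) ω e ξ :=
        (contMDiffOn_of_mem_maximalAtlas he).contMDiffAt (e.open_source.mem_nhds hξe)
      exact (contMDiffAt_iff_contDiffAt.1 (h1.comp z hιz)).differentiableAt (by simp)
    have hne : fderiv ℂ (φ ∘ e.symm) (e ξ) ≠ 0 := by
      -- Along the line φ(ι w) = w, which by the chain rule is incompatible with a vanishing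
      -- derivative.
      intro h0
      have h1 : HasFDerivAt (φ ∘ e.symm) (0 : Cn n →L[ℂ] ℂ) (e ξ) := by
        rw [← h0]; exact (hdiff ξ hξU e he hξe).hasFDerivAt
      have h2 := HasFDerivAt.comp z h1 hg.hasFDerivAt
      have h3 : HasFDerivAt (id : ℂ → ℂ) (0 : ℂ →L[ℂ] ℂ) z := by
        rw [ContinuousLinearMap.zero_comp] at h2
        refine h2.congr_of_eventuallyEq ?_
        filter_upwards [hιz.continuousAt.preimage_mem_nhds
          ((hUo.inter e.open_source).mem_nhds ⟨hξU, hξe⟩)] with w hw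
        rw [Function.comp_apply, Function.comp_apply, e.left_inv hw.2, hφι _ (hUc _ hw.1),
          RiemannSphere.coord_coe, id]
      have h4 := h3.unique (hasFDerivAt_id z)
      simpa using DFunLike.congr_fun h4 1
    exact ((hana ξ hξU e he hξe).fderiv.continuousAt.comp (e.continuousAt hξe)).eventually_ne hne
  -- Nonvanishing of the derivative is required in some chart only, since the chart preferred at x
  -- changes with x; `fderiv_change_chart_ne_zero` transfers it afterwards.
  set Ω₀ : Set X := interior {x | x ∈ U ∧ ∃ e ∈ IsManifold.maximalAtlas 𝓘(ℂ, Cn n) ω X,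
    x ∈ e.source ∧ fderiv ℂ (φ ∘ e.symm) (e x) ≠ 0} with hΩ₀
  refine ⟨Ω₀, isOpen_interior, fun ξ hξ => ?_, fun Ω hΩ hSΩ hΩΩ₀ => ?_⟩
  · refine mem_interior_iff_mem_nhds.2 ?_
    filter_upwards [hsub ξ hξ, hUo.mem_nhds (hSU hξ),
      (chartAt (Cn n) ξ).open_source.mem_nhds (mem_chart_source _ _)] with x hx hxU hxs
    exact ⟨hxU, _, IsManifold.chart_mem_maximalAtlas ξ, hxs, hx⟩
  · have hΩU : ∀ x ∈ Ω, x ∈ U := fun x hx => (interior_subset (hΩΩ₀ hx)).1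
    refine isRealAnalyticSubmanifold_of_eventually_iff (φ := φ) fun p hp => ?_
    have hpΩ : p ∈ Ω := hp.1 0
    obtain ⟨h1, h2⟩ := h.eventually_mem_localStableSet_iff hΩ hSΩ
      (fun x hx => hUc x (hΩU x hx)) (fun x hx => (hNdom x hx).2.continuousAt) hlim
      (by rintro _ ⟨q, -, rfl⟩; exact hD _ (mem_range_self q))
      (fun V hV hSV => by
        obtain ⟨η, hη, hηV⟩ := RiemannSphere.exists_eventually_mem_of_gauge
          hι.isEmbedding.continuous hm hV hSV
        exact h.exists_mem_of_norm_bottcher_eq_one hη hηV hbasis) hp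
    obtain ⟨hpU, e, he, hpe, hne⟩ := interior_subset (hΩΩ₀ hpΩ)
    have hc := IsManifold.chart_mem_maximalAtlas (I := 𝓘(ℂ, Cn n)) (n := ω) p
    have hpc := mem_chart_source (Cn n) p
    exact ⟨h1 p hp, h2, hana p hpU _ hc hpc,
      fderiv_change_chart_ne_zero (hdiff p hpU _ hc hpc) he hc hpe hpc hne⟩
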